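/- Setting. Let $T,\delta>0$, let $A,B,C,D$ be real matrices of sizes $n\times n,\ n\times m,\ l\times n,\ l\times m$, let $x_0\in\mathbb R^n$, let $K\subseteq\mathbb R^k$ be nonempty, closed and convex, and let $f,x_d,u_d$ be square integrable functions on $(0,T)$ with values in $\mathbb R^l,\mathbb R^n,\mathbb R^m$, defined at every point of $(0,T]$ and such that, for $\varphi\in\{f,x_d,u_d\}$, the step functions equal to $\varphi(t_{i+1})$ on $(t_i,t_{i+1}]$, where $t_i=iT/N$ and $i=0,\dots,N-1$, converge to $\varphi$ in $L^2(0,T)$ as $N\to\infty$ (this holds, for instance, if $\varphi$ is continuous on $[0,T]$). Let $\xi$ be a random element of a measurable space $\Xi$, and let $F:\mathbb R^n\times\Xi\to\mathbb R$, $g:\mathbb R^n\times\Xi\to\mathbb R^k$ be measurable in $\xi$ for each $z$ and continuously differentiable in $z$ for almost every $\xi$, with $\mathbb E|F(z,\xi)|<\infty$ for all $z$; let $M:\Xi\to\mathbb R^{n\times n}$, $q:\Xi\to\mathbb R^n$ be measurable. Original problem: minimize $$\Phi(x,u)=\mathbb E[F(x(T),\xi)]+\tfrac12\|x-x_d\|_{L^2}^2+\tfrac\delta2\|u-u_d\|_{L^2}^2$$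 over $(x,u)\in H^1(0,T)^n\times L^2(0,T)^m$ with $\dot x=Ax+Bu$ and $Cx+Du-f\le0$ a.e. on $(0,T)$, $x(0)=x_0$, $0\le x(T)\perp\mathbb E[M(\xi)x(T)+q(\xi)]\ge0$ and $\mathbb E[g(x(T),\xi)]\in K$. Let $\hat{\mathcal S}$ be its set of optimal solutions. Time-stepping problem: let $\xi_1,\xi_2,\dots$ be an i.i.d. sample of $\xi$. For $\epsilon>0$ and positive integers $\nu,N$, put $h=T/N$, $t_i=ih$, and minimize $$\frac1\nu\sum_{j=1}^\nu F(\mathbf x_N,\xi_j)+\frac h2\sum_{i=1}^N\big(\|\mathbf x_i-x_d(t_i)\|^2+\delta\|\mathbf u_i-u_d(t_i)\|^2\big)$$ over $\mathbf x_1,\dots,\mathbf x_N\in\mathbb R^n$, $\mathbf u_1,\dots,\mathbf u_N\in\mathbb R^m$, with $\mathbf x_0=x_0$, subject to $\mathbf x_{i+1}-\mathbf x_i=hA\mathbf x_{i+1}+hB\mathbf u_{i+1}$ and $C\mathbf x_{i+1}+D\mathbf u_{i+1}-f(t_{i+1})\le0$ for $i=0,\dots,N-1$, to $\big\|\min\{\mathbf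 x_N,\frac1\nu\sum_{j=1}^\nu[M(\xi_j)\mathbf x_N+q(\xi_j)]\}\big\|\le\epsilon$ (componentwise minimum) and to $\mathrm{dist}\big(\frac1\nu\sum_{j=1}^\nu g(\mathbf x_N,\xi_j),K\big)\le\epsilon$. Let $\hat{\mathcal S}^{\epsilon,\nu}_h$ be the set of pairs $(x_h,u_h)$ obtained from its optimal solutions by $x_h(t)=\mathbf x_i+\frac{t-t_i}h(\mathbf x_{i+1}-\mathbf x_i)$, $u_h(t)=\mathbf u_{i+1}$ for $t\in(t_i,t_{i+1}]$. Assume: 1. There are nonnegative measurable functions $\kappa_1,\dots,\kappa_4$ on $\Xi$ with $\mathbb E[\kappa_i(\xi)]<\infty$ such that for all $z_1,z_2\in\mathbb R^n$ and a.e. $\xi$, $|F(z_1,\xi)-F(z_2,\xi)|\le\kappa_1(\xi)\|z_1-z_2\|$ and $\|g(z_1,\xi)\|\le\kappa_2(\xi)\|z_1\|$, and for all $\xi$, $\|M(\xi)\|\le\kappa_3(\xi)$ and $\|q(\xi)\|\le\kappa_4(\xi)$. 2. $l<m$, $D$ has full row rank, and, with $D^\dagger=D^\top(DD^\top)^{-1}$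 and $Y\in\mathbb R^{m\times(m-l)}$ of full column rank with $DY=0$, the matrix $[BY\ \ (A-BD^\dagger C)BY\ \cdots\ (A-BD^\dagger C)^{n-1}BY]$ has full row rank $n$. 3. The closed ball in $\mathbb R^k$ with centre $0$ and radius $\beta\,\mathbb E[\kappa_2(\xi)]\,\|\mathbb E[q(\xi)]\|_1$ is contained in $K$, where $\beta$ is the maximum of $\|(\mathbb E[M_{J,J}(\xi)])^{-1}\|_1$ (the matrix norm induced by the $\ell^1$ norm) over the nonempty $J\subseteq\{1,\dots,n\}$ with $\mathbb E[M_{J,J}(\xi)]$ nonsingular, and $\beta=1$ if there is no such $J$. 4. There is $v\ge0$ in $\mathbb R^n$ with $\mathbb E[M(\xi)v+q(\xi)]\ge0$. 5. $\bar M=\mathbb E[M(\xi)]$ is a Z-matrix (its off-diagonal entries are $\le0$) or is adequate (for $Q\in\{\bar M,\bar M^\top\}$ and $z\in\mathbb R^n$, $z_i(Qz)_i\le0$ for all $i$ implies $Qz=0$). Then $\hat{\mathcal S}\neq\emptyset$ and, with probability 1: for every $\epsilon>0$, $\hat{\mathcal S}^{\epsilon,\nu}_h\ne\emptyset$ for all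 sufficiently large $\nu$ and then all sufficiently small $h=T/N$ (how small may depend on $\epsilon$, $\nu$); and $$\lim_{\epsilon\downarrow0}\ \limsup_{\nu\to\infty}\ \limsup_{h\downarrow0}\ \mathbb D\big(\hat{\mathcal S}^{\epsilon,\nu}_h,\hat{\mathcal S}\big)=0,$$ where $\mathbb D(S_1,S_2)=\sup_{(x,u)\in S_1}\inf_{(x',u')\in S_2}\big(\|x-x'\|_{H^1}+\|u-u'\|_{L^2}\big)$ and $\|x\|_{H^1}=(\|x\|_{L^2}^2+\|\dot x\|_{L^2}^2)^{1/2}$. -/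

import Mathlib

open MeasureTheory ProbabilityTheory Filter Set
open scoped Topology ENNReal Matrix ContDiff

noncomputable section

/-- `ℝᵏ` with the Euclidean norm. -/
abbrev Vec (k : ℕ) : Type := EuclideanSpace ℝ (Fin k)

/-- The matrix-vector product, as a vector of Euclidean space. -/
def mulV {a b : ℕ} (A : Matrix (Fin a) (Fin b) ℝ) (v : Vec b) : Vec a :=
  WithLp.toLp 2 (A *ᵥ v.ofLp)

/-- The componentwise minimum of two vectors. -/
def vecMin {k : ℕ} (v w : Vec k) : Vec k := WithLp.toLp 2 fun i => min (v i) (w i)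

/-- Lebesgue measure on the time interval `(0,T)`. -/
abbrev timeMeasure (T : ℝ) : Measure ℝ := volume.restrict (Ioo 0 T)

/-- `L²(0,T)ᵏ`. -/
abbrev L2 (T : ℝ) (k : ℕ) : Type := Lp (Vec k) 2 (timeMeasure T)

/-- `v` is the weak derivative of `x` on `(0,T)`. -/
def IsWeakDeriv {T : ℝ} {n : ℕ} (x v : L2 T n) : Prop :=
  ∀ φ : ℝ → ℝ, ContDiff ℝ ∞ φ → HasCompactSupport φ → tsupport φ ⊆ Ioo 0 T →
    ∫ t in Ioo 0 T, deriv φ t • x t = -∫ t in Ioo 0 T, φ t • v t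

/-- `H¹(0,T)ⁿ`: square integrable functions with a square integrable weak derivative, which is
recorded together with the function that determines it. -/
structure H1 (T : ℝ) (n : ℕ) where
  /-- the function -/
  val : L2 T n
  /-- its weak derivative -/
  der : L2 T n
  isWeakDeriv : IsWeakDeriv val der

open Classical in
/-- The value at `t ∈ [0,T]` of an `H¹` function, namely the value of its representative that is
continuous on `[0,T]` (such a representative always exists, and for `T > 0` it is unique on
`[0,T]`). -/
def H1.value {T : ℝ} {n : ℕ} (x : H1 T n) (t : ℝ) : Vec n :=
  if h : ∃ y : ℝ → Vec n, ContinuousOn y (Icc 0 T) ∧ y =ᵐ[timeMeasure T] x.val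
  then h.choose t else 0

/-- The space `H¹(0,T)ⁿ × L²(0,T)ᵐ` of states and controls. -/
abbrev StateControl (T : ℝ) (n m : ℕ) : Type := H1 T n × L2 T m

/-- `‖x - x'‖_{H¹} + ‖u - u'‖_{L²}`, where `‖x‖_{H¹} = (‖x‖²_{L²} + ‖ẋ‖²_{L²})^{1/2}`. -/
def scDist {T : ℝ} {n m : ℕ} (p p' : StateControl T n m) : ℝ :=
  Real.sqrt (‖p.1.val - p'.1.val‖ ^ 2 + ‖p.1.der - p'.1.der‖ ^ 2) + ‖p.2 - p'.2‖

/-- The deviation `𝔻(S₁,S₂) = sup_{p ∈ S₁} inf_{p' ∈ S₂} dist(p,p')` of `S₁` from `S₂`, as an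
extended nonnegative number (infimum over `∅` is `∞`). -/
def deviation {T : ℝ} {n m : ℕ} (S₁ S₂ : Set (StateControl T n m)) : ℝ≥0∞ :=
  ⨆ p ∈ S₁, ⨅ p' ∈ S₂, ENNReal.ofReal (scDist p p')

/-- The data of an optimal control problem with terminal stochastic complementarity constraints.
Here `f`, `xd`, `ud` are functions with values at every time, since the time-stepping problem
uses their values at grid points. -/
structure ControlProblem (n m l k : ℕ) (Ξ : Type*) where
  T : ℝ
  A : Matrix (Fin n) (Fin n) ℝ
  B : Matrix (Fin n) (Fin m) ℝ
  C : Matrix (Fin l) (Fin n) ℝ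
  D : Matrix (Fin l) (Fin m) ℝ
  f : ℝ → Vec l
  x₀ : Vec n
  δ : ℝ
  xd : ℝ → Vec n
  ud : ℝ → Vec m
  K : Set (Vec k)
  F : Vec n → Ξ → ℝ
  g : Vec n → Ξ → Vec k
  M : Ξ → Matrix (Fin n) (Fin n) ℝ
  q : Ξ → Vec n

/-- The values of `φ` at the grid points `t_i = iT/N` represent `φ` in `L²(0,T)`: the step
functions equal to `φ(t_{i+1})` on `(t_i,t_{i+1}]` converge to `φ` in `L²(0,T)` as `N → ∞`. -/
def GridConsistent (T : ℝ) {k : ℕ} (φ : ℝ → Vec k) : Prop :=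
  Tendsto (fun N : ℕ => ∑ i ∈ Finset.range N,
      ∫ t in Ioc ((i : ℝ) * (T / N)) (((i : ℝ) + 1) * (T / N)),
        ‖φ t - φ (((i : ℝ) + 1) * (T / N))‖ ^ 2) atTop (𝓝 0)

/-- Column adequate: `z_i (Mz)_i ≤ 0` for all `i` implies `Mz = 0`. -/
def ColumnAdequate {n : ℕ} (M : Matrix (Fin n) (Fin n) ℝ) : Prop :=
  ∀ z : Fin n → ℝ, (∀ i, z i * (M *ᵥ z) i ≤ 0) → M *ᵥ z = 0

/-- Adequate: column adequate with column adequate transpose. -/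
def Adequate {n : ℕ} (M : Matrix (Fin n) (Fin n) ℝ) : Prop :=
  ColumnAdequate M ∧ ColumnAdequate Mᵀ

/-- Z-matrix: nonpositive off-diagonal entries. -/
def IsZMatrix {n : ℕ} (M : Matrix (Fin n) (Fin n) ℝ) : Prop :=
  ∀ i j, i ≠ j → M i j ≤ 0

/-- The matrix norm `‖·‖₁` induced by the `ℓ¹` norm: the largest absolute column sum. -/
def matrixOneNorm {ι : Type*} [Fintype ι] (M : Matrix ι ι ℝ) : ℝ := ⨆ j, ∑ i, |M i j|

/-- The principal submatrix `M_{J,J}`. -/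
def principalSub {n : ℕ} (M : Matrix (Fin n) (Fin n) ℝ) (J : Finset (Fin n)) :
    Matrix J J ℝ := M.submatrix (fun i : J => (i : Fin n)) (fun j : J => (j : Fin n))

/-- The nonempty index sets `J` with `M_{J,J}` nonsingular. -/
def nonsingularSets {n : ℕ} (M : Matrix (Fin n) (Fin n) ℝ) : Set (Finset (Fin n)) :=
  {J | J.Nonempty ∧ (principalSub M J).det ≠ 0}

open Classical in
/-- `β = max ‖(M_{J,J})⁻¹‖₁` over the nonsingular principal submatrices (a finite family), and
`β = 1` if there is none. -/
def betaConst {n : ℕ} (M : Matrix (Fin n) (Fin n) ℝ) : ℝ :=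
  if nonsingularSets M = ∅ then 1
  else sSup ((fun J => matrixOneNorm (principalSub M J)⁻¹) '' nonsingularSets M)

namespace ControlProblem

variable {n m l k : ℕ} {Ξ : Type*} (P : ControlProblem n m l k Ξ)

/-! ### Assumptions on the data -/

/-- The standing conventions on the data, for `ξ` of law `μ`. -/
structure Standing [MeasurableSpace Ξ] (μ : Measure Ξ) : Prop where
  T_pos : 0 < P.T
  δ_pos : 0 < P.δ
  f_mem : MemLp P.f 2 (timeMeasure P.T)
  xd_mem : MemLp P.xd 2 (timeMeasure P.T)
  ud_mem : MemLp P.ud 2 (timeMeasure P.T)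
  f_grid : GridConsistent P.T P.f
  xd_grid : GridConsistent P.T P.xd
  ud_grid : GridConsistent P.T P.ud
  K_nonempty : P.K.Nonempty
  K_closed : IsClosed P.K
  K_convex : Convex ℝ P.K
  F_contDiff : ∀ᵐ s ∂μ, ContDiff ℝ 1 fun z => P.F z s
  F_meas : ∀ z, Measurable (P.F z)
  F_integrable : ∀ z, Integrable (P.F z) μ
  g_contDiff : ∀ᵐ s ∂μ, ContDiff ℝ 1 fun z => P.g z s
  g_meas : ∀ z, Measurable (P.g z)
  M_meas : ∀ i j, Measurable fun s => P.M s i j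
  q_meas : Measurable P.q

/-- The Lipschitz and growth bounds with integrable factors `κ₁, …, κ₄`. The bound on `M` says
that its operator norm is at most `κ₃`. -/
structure GrowthBounds [MeasurableSpace Ξ] (μ : Measure Ξ) (κ₁ κ₂ κ₃ κ₄ : Ξ → ℝ) : Prop where
  nonneg : ∀ s, 0 ≤ κ₁ s ∧ 0 ≤ κ₂ s ∧ 0 ≤ κ₃ s ∧ 0 ≤ κ₄ s
  meas : Measurable κ₁ ∧ Measurable κ₂ ∧ Measurable κ₃ ∧ Measurable κ₄
  integrable : Integrable κ₁ μ ∧ Integrable κ₂ μ ∧ Integrable κ₃ μ ∧ Integrable κ₄ μ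
  F_lipschitz : ∀ z₁ z₂, ∀ᵐ s ∂μ, |P.F z₁ s - P.F z₂ s| ≤ κ₁ s * ‖z₁ - z₂‖
  g_bound : ∀ z, ∀ᵐ s ∂μ, ‖P.g z s‖ ≤ κ₂ s * ‖z‖
  M_bound : ∀ s z, ‖mulV (P.M s) z‖ ≤ κ₃ s * ‖z‖
  q_bound : ∀ s, ‖P.q s‖ ≤ κ₄ s

/-- `A - B D† C`, where `D† = Dᵀ (D Dᵀ)⁻¹` is the pseudoinverse of a matrix `D` of full row
rank. -/
def reducedA : Matrix (Fin n) (Fin n) ℝ :=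
  P.A - P.B * (P.Dᵀ * (P.D * P.Dᵀ)⁻¹) * P.C

/-- The block matrix `[BY, (A - BD†C)BY, …, (A - BD†C)ⁿ⁻¹BY]`. -/
def controllabilityMatrix (Y : Matrix (Fin m) (Fin (m - l)) ℝ) :
    Matrix (Fin n) (Fin n × Fin (m - l)) ℝ :=
  Matrix.of fun i p => (P.reducedA ^ (p.1 : ℕ) * (P.B * Y)) i p.2

/-- `D` has full row rank `l < m`, and for a matrix `Y` of full column rank `m - l` with `DY = 0`
the controllability matrix has full row rank. -/
structure Controllable (Y : Matrix (Fin m) (Fin (m - l)) ℝ) : Prop where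
  lt : l < m
  rank_D : P.D.rank = l
  rank_Y : Y.rank = m - l
  D_mul_Y : P.D * Y = 0
  rank_controllability : (P.controllabilityMatrix Y).rank = n

/-- `𝔼[M(ξ)]`. -/
def meanM [MeasurableSpace Ξ] (μ : Measure Ξ) : Matrix (Fin n) (Fin n) ℝ :=
  Matrix.of fun i j => ∫ s, P.M s i j ∂μ

/-- `𝔼[M(ξ) z + q(ξ)]`. -/
def meanLCP [MeasurableSpace Ξ] (μ : Measure Ξ) (z : Vec n) : Vec n :=
  ∫ s, (mulV (P.M s) z + P.q s) ∂μ

/-- `‖𝔼[q(ξ)]‖₁`. -/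
def meanQOneNorm [MeasurableSpace Ξ] (μ : Measure Ξ) : ℝ := ∑ i, |(∫ s, P.q s ∂μ) i|

/-! ### The original problem -/

/-- The differential equation, the mixed constraint (both a.e. on `(0,T)`) and the initial
condition. -/
def Dynamics (p : StateControl P.T n m) : Prop :=
  (∀ᵐ t ∂timeMeasure P.T, p.1.der t = mulV P.A (p.1.val t) + mulV P.B (p.2 t)) ∧
  (∀ᵐ t ∂timeMeasure P.T, ∀ j, (mulV P.C (p.1.val t) + mulV P.D (p.2 t) - P.f t) j ≤ 0) ∧
  p.1.value 0 = P.x₀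

/-- `½‖x - x_d‖²_{L²} + (δ/2)‖u - u_d‖²_{L²}`. -/
def trackingCost (p : StateControl P.T n m) : ℝ :=
  1 / 2 * (∫ t in Ioo 0 P.T, ‖p.1.val t - P.xd t‖ ^ 2) +
    P.δ / 2 * ∫ t in Ioo 0 P.T, ‖p.2 t - P.ud t‖ ^ 2

/-- The terminal constraints `0 ≤ z ⊥ 𝔼[M(ξ)z + q(ξ)] ≥ 0` and `𝔼[g(z,ξ)] ∈ K`. -/
def Terminal [MeasurableSpace Ξ] (μ : Measure Ξ) (z : Vec n) : Prop :=
  (∀ i, 0 ≤ z i) ∧ (∀ i, 0 ≤ P.meanLCP μ z i) ∧ ∑ i, z i * P.meanLCP μ z i = 0 ∧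
  ∫ s, P.g z s ∂μ ∈ P.K

/-- The objective `Φ`. -/
def objective [MeasurableSpace Ξ] (μ : Measure Ξ) (p : StateControl P.T n m) : ℝ :=
  (∫ s, P.F (p.1.value P.T) s ∂μ) + P.trackingCost p

/-- The feasible set `𝒮`. -/
def feasibleSet [MeasurableSpace Ξ] (μ : Measure Ξ) : Set (StateControl P.T n m) :=
  {p | P.Dynamics p ∧ P.Terminal μ (p.1.value P.T)}

/-- The set of optimal solutions `Ŝ`. -/
def optimalSet [MeasurableSpace Ξ] (μ : Measure Ξ) : Set (StateControl P.T n m) :=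
  {p | p ∈ P.feasibleSet μ ∧ ∀ p' ∈ P.feasibleSet μ, P.objective μ p ≤ P.objective μ p'}

/-! ### The relaxed sample average problem, discretised in time -/

/-- The sample average `(1/ν) ∑_{j < ν} G(s_j)`. -/
def sampleAvg {E : Type*} [AddCommGroup E] [Module ℝ E] (ν : ℕ) (s : ℕ → Ξ) (G : Ξ → E) : E :=
  (ν : ℝ)⁻¹ • ∑ j ∈ Finset.range ν, G (s j)

/-- The relaxed sample average terminal constraints, with `K^ε = {z | dist(z,K) ≤ ε}`. -/
def RelaxedTerminal (ε : ℝ) (ν : ℕ) (s : ℕ → Ξ) (z : Vec n) : Prop :=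
  ‖vecMin z (sampleAvg ν s fun a => mulV (P.M a) z + P.q a)‖ ≤ ε ∧
  Metric.infDist (sampleAvg ν s fun a => P.g z a) P.K ≤ ε

/-- The step size `h = T/N`. -/
def step (N : ℕ) : ℝ := P.T / N

/-- The grid points `t_i = i h`. -/
def grid (N i : ℕ) : ℝ := i * P.step N

/-- A discrete state `𝐱_0, …, 𝐱_N` and a discrete control `𝐮_1, …, 𝐮_N`; the entry with index
`i : Fin N` of the control is `𝐮_{i+1}`. -/
abbrev Discrete (n m N : ℕ) : Type := (Fin (N + 1) → Vec n) × (Fin N → Vec m)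

/-- Feasibility for the time-stepping problem (implicit Euler). -/
def DiscreteFeasible (ε : ℝ) (ν : ℕ) (s : ℕ → Ξ) (N : ℕ) (d : Discrete n m N) : Prop :=
  d.1 0 = P.x₀ ∧
  (∀ i : Fin N, d.1 i.succ - d.1 i.castSucc =
    P.step N • mulV P.A (d.1 i.succ) + P.step N • mulV P.B (d.2 i)) ∧
  (∀ i : Fin N, ∀ j,
    (mulV P.C (d.1 i.succ) + mulV P.D (d.2 i) - P.f (P.grid N (i + 1))) j ≤ 0) ∧
  P.RelaxedTerminal ε ν s (d.1 (Fin.last N))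

/-- The objective of the time-stepping problem. -/
def discreteObjective (ν : ℕ) (s : ℕ → Ξ) (N : ℕ) (d : Discrete n m N) : ℝ :=
  sampleAvg ν s (fun a => P.F (d.1 (Fin.last N)) a) +
    P.step N / 2 * ∑ i : Fin N, (‖d.1 i.succ - P.xd (P.grid N (i + 1))‖ ^ 2 +
      P.δ * ‖d.2 i - P.ud (P.grid N (i + 1))‖ ^ 2)

/-- Optimality for the time-stepping problem. -/
def DiscreteOptimal (ε : ℝ) (ν : ℕ) (s : ℕ → Ξ) (N : ℕ) (d : Discrete n m N) : Prop :=
  P.DiscreteFeasible ε ν s N d ∧ ∀ d', P.DiscreteFeasible ε ν s N d' →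
    P.discreteObjective ν s N d ≤ P.discreteObjective ν s N d'

/-- `p = (x_h, u_h)` is the pair of the piecewise linear interpolant of the discrete state and the
piecewise constant interpolant of the discrete control. -/
def IsInterpolant (N : ℕ) (d : Discrete n m N) (p : StateControl P.T n m) : Prop :=
  ∀ i : Fin N, ∀ᵐ t ∂timeMeasure P.T, t ∈ Ioc (P.grid N i) (P.grid N (i + 1)) →
    p.1.val t = d.1 i.castSucc +
      ((t - P.grid N i) / P.step N) • (d.1 i.succ - d.1 i.castSucc) ∧
    p.2 t = d.2 i

/-- The set `Ŝ_h^{ε,ν}` of interpolants of optimal solutions of the time-stepping problem with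
`h = T/N`. -/
def discreteOptimalSet (ε : ℝ) (ν : ℕ) (s : ℕ → Ξ) (N : ℕ) : Set (StateControl P.T n m) :=
  {p | ∃ d, P.DiscreteOptimal ε ν s N d ∧ P.IsInterpolant N d p}

end ControlProblem

end

/-!
The proof reduces both optimal control problems to the minimisation of a function of the terminal
state `z ∈ ℝⁿ` alone, where compactness is available.

*Slack variables.* With `s = Cx + Du - f ≤ 0` and a free part `w`, every control is
`u = D†(f + s - Cx) + Yw`, and the state is an affine function of `y = (s, w)` through
`(1 - V Â)⁻¹`, where `Â = A - B D† C` and `V` is integration (`isUnit_one_sub_volterra`). The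
implicit Euler scheme is the same problem with `V` replaced by the operator `v ↦ ∫₀^{θ(t)} v`,
`θ(t)` being the next grid point, which converges to `V` in operator norm, and with `f, x_d, u_d`
replaced by their step functions. In this form there is one family of least squares problems:
minimise the tracking cost `½‖G y - b‖²` over `s ≤ 0` with prescribed terminal state `L y + c = z`.
Square integrable `y` may be admitted for the grid problems too, since averaging the control over
the cells does not increase the cost (`exists_discreteDynamics`).

*Stability of the tracking problems.* `G` is bounded below uniformly in `V`, and the rank condition
makes the terminal map onto in the direction `w`, which is not constrained (`surjective_terminal`).
Hence the minimiser `y(z)` is unique and, with the optimal value, converges locally uniformly in `z`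
as the grid is refined (`eventually_argmin_close`).

*The terminal constraints.* The sample averages of `F`, `g` and `Mz + q` converge uniformly on
bounded sets with probability one (`uniform_sampleAvg`). The limiting constraints are consistent:
the complementarity problem has a solution whose support gives a nonsingular principal submatrix,
so that its `ℓ¹` norm is at most `β ‖𝔼 q‖₁` (`exists_lcpSolution_sum_abs_le`), and by the hypothesis
on the ball in `K` such a point also satisfies `𝔼 g ∈ K`. For Z-matrices a feasible point with
minimal sum of coordinates is such a solution; for adequate matrices one follows the central path
of a strictly feasible perturbation.

*Conclusion.* The reduced costs are coercive, since the tracking cost grows quadratically in `z`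
while the expectation of `F` decreases at most linearly. So the minimisers of the relaxed problems
approach those of the limit problem (`StableMinimization.argmin_close`), and by the stability of
`y(z)` the interpolants approach optimal solutions in `H¹ × L²` (`eventually_scDist_le`).
-/

open MeasureTheory ProbabilityTheory Filter Set
open scoped Topology ENNReal Matrix ContDiff

noncomputable section

/-! ### Linear complementarity problems -/

/-- `z` solves the linear complementarity problem `0 ≤ z ⊥ M z + q ≥ 0`. -/
structure IsLCPSolution {n : ℕ} (M : Matrix (Fin n) (Fin n) ℝ) (q z : Fin n → ℝ) : Prop where
  nonneg : ∀ i, 0 ≤ z i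
  slack_nonneg : ∀ i, 0 ≤ (M *ᵥ z + q) i
  compl : ∀ i, z i * (M *ᵥ z + q) i = 0

open Classical in
/-- The set of indices at which `z` does not vanish. -/
def supportSet {n : ℕ} (z : Fin n → ℝ) : Finset (Fin n) := Finset.univ.filter fun i => z i ≠ 0

/-- A solution is basic if the principal submatrix on its support is nonsingular (a vacuous
condition for `z = 0`). -/
def IsBasic {n : ℕ} (M : Matrix (Fin n) (Fin n) ℝ) (z : Fin n → ℝ) : Prop :=
  (principalSub M (supportSet z)).det ≠ 0

lemma mem_supportSet {n : ℕ} {z : Fin n → ℝ} {i : Fin n} : i ∈ supportSet z ↔ z i ≠ 0 := by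
  simp [supportSet]

lemma principalSub_mulVec {n : ℕ} (M : Matrix (Fin n) (Fin n) ℝ) (J : Finset (Fin n))
    {z : Fin n → ℝ} (hz : ∀ i, i ∉ J → z i = 0) (i : J) :
    (principalSub M J *ᵥ fun j : J => z j) i = (M *ᵥ z) i := by
  simp only [Matrix.mulVec, dotProduct, principalSub, Matrix.submatrix_apply]
  rw [Finset.sum_coe_sort J (fun j => M i j * z j)]
  refine Finset.sum_subset (Finset.subset_univ J) fun j _ hj => ?_
  rw [hz j hj, mul_zero]

lemma exists_extend {n : ℕ} (J : Finset (Fin n)) (v : J → ℝ) :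
    ∃ V : Fin n → ℝ, (∀ i, i ∉ J → V i = 0) ∧ (fun j : J => V j) = v := by
  classical
  refine ⟨fun i => if h : i ∈ J then v ⟨i, h⟩ else 0, fun i hi => by simp [hi], ?_⟩
  funext j
  simp

/-- A singular principal submatrix has a kernel vector, extended by zero. -/
lemma exists_kernel_of_det_eq_zero {n : ℕ} {M : Matrix (Fin n) (Fin n) ℝ} {J : Finset (Fin n)}
    (h : (principalSub M J).det = 0) :
    ∃ V : Fin n → ℝ, V ≠ 0 ∧ (∀ i, i ∉ J → V i = 0) ∧ ∀ i ∈ J, (M *ᵥ V) i = 0 := by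
  obtain ⟨v, hv, hMv⟩ := Matrix.exists_mulVec_eq_zero_iff.mpr h
  obtain ⟨V, hV, rfl⟩ := exists_extend J v
  refine ⟨V, fun h0 => hv (by simp [h0]; rfl), hV, fun i hi => ?_⟩
  rw [← principalSub_mulVec M J hV ⟨i, hi⟩, hMv]
  rfl

/-- The nonzero part of a basic solution is `-(M_{J,J})⁻¹ q_J`. -/
lemma IsLCPSolution.eq_inv_mulVec {n : ℕ} {M : Matrix (Fin n) (Fin n) ℝ} {q z : Fin n → ℝ}
    (h : IsLCPSolution M q z) (hb : IsBasic M z) :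
    (fun j : supportSet z => z j) =
      -((principalSub M (supportSet z))⁻¹ *ᵥ fun j : supportSet z => q j) := by
  have h1 : principalSub M (supportSet z) *ᵥ (fun j : supportSet z => z j) =
      -fun j : supportSet z => q j := by
    funext i
    rw [principalSub_mulVec M _ (fun i hi => by simpa [mem_supportSet] using hi)]
    have := (mul_eq_zero.mp (h.compl i)).resolve_left (mem_supportSet.mp i.2)
    simp only [Pi.add_apply] at this
    simp only [Pi.neg_apply]
    linarith
  rw [← Matrix.mulVec_neg, ← h1, Matrix.mulVec_mulVec,
    Matrix.nonsing_inv_mul _ (isUnit_iff_ne_zero.mpr hb), Matrix.one_mulVec]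

lemma abs_sum_mulVec_le {ι : Type*} [Fintype ι] (A : Matrix ι ι ℝ) (v : ι → ℝ) :
    ∑ i, |(A *ᵥ v) i| ≤ matrixOneNorm A * ∑ j, |v j| := by
  calc ∑ i, |(A *ᵥ v) i| ≤ ∑ i, ∑ j, |A i j| * |v j| := by
        refine Finset.sum_le_sum fun i _ => ?_
        simp only [Matrix.mulVec, dotProduct, ← abs_mul]
        exact Finset.abs_sum_le_sum_abs _ _
    _ = ∑ j, (∑ i, |A i j|) * |v j| := by
        rw [Finset.sum_comm]
        simp [Finset.sum_mul]
    _ ≤ ∑ j, matrixOneNorm A * |v j| := by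
        refine Finset.sum_le_sum fun j _ => mul_le_mul_of_nonneg_right ?_ (abs_nonneg _)
        exact le_ciSup (f := fun j => ∑ i, |A i j|) (Set.finite_range _).bddAbove j
    _ = _ := by rw [Finset.mul_sum]

lemma matrixOneNorm_nonneg {ι : Type*} [Fintype ι] (A : Matrix ι ι ℝ) : 0 ≤ matrixOneNorm A :=
  Real.iSup_nonneg fun _ => Finset.sum_nonneg fun _ _ => abs_nonneg _

lemma betaConst_nonneg {n : ℕ} (M : Matrix (Fin n) (Fin n) ℝ) : 0 ≤ betaConst M := by
  unfold betaConst
  split_ifs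
  · exact zero_le_one
  · refine Real.sSup_nonneg ?_
    rintro _ ⟨J, _, rfl⟩
    exact matrixOneNorm_nonneg _

/-- The `ℓ¹` norm of a basic solution is bounded through the inverse of the principal submatrix on
its support. -/
lemma IsLCPSolution.sum_abs_le {n : ℕ} {M : Matrix (Fin n) (Fin n) ℝ} {q z : Fin n → ℝ}
    (h : IsLCPSolution M q z) (hb : IsBasic M z) :
    ∑ i, |z i| ≤ betaConst M * ∑ i, |q i| := by
  classical
  rcases (supportSet z).eq_empty_or_nonempty with hJ | hJ
  · have hz : ∀ i, z i = 0 := fun i => by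
      by_contra hi
      simpa [hJ] using mem_supportSet.mpr hi
    simpa [hz] using mul_nonneg (betaConst_nonneg M) (Finset.sum_nonneg fun i _ => abs_nonneg (q i))
  · have hmem : supportSet z ∈ nonsingularSets M := ⟨hJ, hb⟩
    have hβ : matrixOneNorm (principalSub M (supportSet z))⁻¹ ≤ betaConst M := by
      unfold betaConst
      rw [if_neg (Set.nonempty_iff_ne_empty.mp ⟨_, hmem⟩)]
      exact le_csSup ((Set.toFinite _).image _).bddAbove ⟨_, hmem, rfl⟩
    have hsum : ∑ i, |z i| = ∑ j : supportSet z, |z j| := by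
      rw [Finset.sum_coe_sort (supportSet z) (fun j => |z j|)]
      refine (Finset.sum_subset (Finset.subset_univ _) fun j _ hj => ?_).symm
      rw [mem_supportSet, not_not] at hj
      simp [hj]
    have hqsum : ∑ j : supportSet z, |q j| ≤ ∑ i, |q i| := by
      rw [Finset.sum_coe_sort (supportSet z) (fun j => |q j|)]
      exact Finset.sum_le_sum_of_subset_of_nonneg (Finset.subset_univ _)
        fun _ _ _ => abs_nonneg _
    calc ∑ i, |z i| = ∑ j : supportSet z,
          |((principalSub M (supportSet z))⁻¹ *ᵥ fun j : supportSet z => q j) j| := by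
          rw [hsum]
          refine Finset.sum_congr rfl fun j _ => ?_
          have := congrFun (h.eq_inv_mulVec hb) j
          simp only [Pi.neg_apply] at this
          rw [this, abs_neg]
      _ ≤ _ := abs_sum_mulVec_le _ _
      _ ≤ betaConst M * ∑ j : supportSet z, |q j| :=
          mul_le_mul_of_nonneg_right hβ (Finset.sum_nonneg fun _ _ => abs_nonneg _)
      _ ≤ _ := mul_le_mul_of_nonneg_left hqsum (betaConst_nonneg M)

/-- A feasible linear complementarity problem with a Z-matrix has a basic solution: a feasible
point of least coordinate sum is one. -/
theorem IsZMatrix.exists_basic_solution {n : ℕ} {M : Matrix (Fin n) (Fin n) ℝ} (hM : IsZMatrix M)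
    {q v : Fin n → ℝ} (hv : ∀ i, 0 ≤ v i) (hMv : ∀ i, 0 ≤ (M *ᵥ v + q) i) :
    ∃ z, IsLCPSolution M q z ∧ IsBasic M z := by
  classical
  have hcont : Continuous fun z : Fin n → ℝ => M *ᵥ z + q := by fun_prop
  obtain ⟨z, ⟨⟨hz0, hzw⟩, -⟩, hmin'⟩ : ∃ z ∈ {z : Fin n → ℝ | (∀ i, 0 ≤ z i) ∧
      ∀ i, 0 ≤ (M *ᵥ z + q) i} ∩ {z | ∑ i, z i ≤ ∑ i, v i}, IsMinOn (fun z => ∑ i, z i)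
      ({z : Fin n → ℝ | (∀ i, 0 ≤ z i) ∧ ∀ i, 0 ≤ (M *ᵥ z + q) i} ∩
        {z | ∑ i, z i ≤ ∑ i, v i}) z := by
    have hmem : v ∈ {z | ∑ i, z i ≤ ∑ i, v i} := le_refl (∑ i, v i)
    refine IsCompact.exists_isMinOn ?_ ?_ (by fun_prop)
    rotate_left
    · exact ⟨v, ⟨hv, hMv⟩, hmem⟩
    refine IsCompact.of_isClosed_subset
      (isCompact_Icc (a := (0 : Fin n → ℝ)) (b := fun _ => ∑ i, v i)) ?_ ?_
    · refine IsClosed.inter (IsClosed.inter ?_ ?_) (isClosed_le (by fun_prop) (by fun_prop))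
      · change IsClosed {z : Fin n → ℝ | ∀ i, 0 ≤ z i}
        simp only [Set.ofPred_forall]
        exact isClosed_iInter fun i => isClosed_le continuous_const (continuous_apply i)
      · change IsClosed {z | ∀ i, 0 ≤ (M *ᵥ z + q) i}
        simp only [Set.ofPred_forall]
        exact isClosed_iInter fun i =>
          isClosed_le continuous_const ((continuous_apply i).comp hcont)
    · rintro z ⟨⟨hz, -⟩, hs⟩
      exact ⟨hz, fun i => (Finset.single_le_sum (fun j _ => hz j) (Finset.mem_univ i)).trans hs⟩
  have hmin : ∀ z' : Fin n → ℝ, (∀ i, 0 ≤ z' i) → (∀ i, 0 ≤ (M *ᵥ z' + q) i) →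
      ∑ i, z i ≤ ∑ i, z' i := by
    intro z' h1 h2
    by_cases h : ∑ i, z' i ≤ ∑ i, v i
    · exact hmin' ⟨⟨h1, h2⟩, h⟩
    · exact (hmin' ⟨⟨hv, hMv⟩, le_refl (∑ i, v i)⟩ : ∑ i, z i ≤ ∑ i, v i).trans (le_of_not_ge h)
  -- No nonnegative direction `p ≠ 0` can be subtracted from `z` without leaving the feasible set.
  have key : ∀ p : Fin n → ℝ, (∀ i, 0 ≤ p i) → (∀ i, p i ≤ z i) →
      (∀ i, (M *ᵥ p) i ≤ (M *ᵥ z + q) i) → p = 0 := by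
    intro p hp hpz hw
    have h1 := hmin (z - p) (fun i => by simpa using hpz i) (fun i => by
      have := hw i
      simp only [Matrix.mulVec_sub, Pi.add_apply, Pi.sub_apply] at this ⊢
      linarith)
    simp only [Pi.sub_apply, Finset.sum_sub_distrib] at h1
    have h2 : ∑ i, p i = 0 := le_antisymm (by linarith) (Finset.sum_nonneg fun i _ => hp i)
    funext i
    exact (Finset.sum_eq_zero_iff_of_nonneg (fun i _ => hp i)).mp h2 i (Finset.mem_univ i)
  have hneg : ∀ (p : Fin n → ℝ) (i : Fin n), (∀ j, 0 ≤ p j) → p i = 0 → (M *ᵥ p) i ≤ 0 := by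
    intro p i hp hi
    simp only [Matrix.mulVec, dotProduct]
    refine Finset.sum_nonpos fun j _ => ?_
    by_cases hij : i = j
    · rw [← hij, hi, mul_zero]
    · exact mul_nonpos_of_nonpos_of_nonneg (hM i j hij) (hp j)
  refine ⟨z, ⟨hz0, hzw, fun i => ?_⟩, fun hdet => ?_⟩
  · by_contra hne
    have hzi : 0 < z i := lt_of_le_of_ne (hz0 i) fun h => hne (by rw [← h, zero_mul])
    have hwi : 0 < (M *ᵥ z + q) i := lt_of_le_of_ne (hzw i) fun h => hne (by rw [← h, mul_zero])
    set w := (M *ᵥ z + q) i with hw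
    have hden : 0 < |M i i| + 1 := by positivity
    set t := min (z i) (w / (|M i i| + 1)) with ht
    have htpos : 0 < t := lt_min hzi (div_pos hwi hden)
    have hp : Pi.single i t = (0 : Fin n → ℝ) := by
      refine key _ (fun j => ?_) (fun j => ?_) (fun j => ?_)
      · by_cases hj : j = i
        · subst hj; simpa using htpos.le
        · simp [hj]
      · by_cases hj : j = i
        · subst hj; simp [ht]
        · simpa [hj] using hz0 j
      · rw [Matrix.mulVec_single]
        by_cases hj : j = i
        · subst hj
          have h1 : t * (|M j j| + 1) ≤ w := by
            rw [← le_div_iff₀ hden]; exact min_le_right _ _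
          have h2 : M j j * t ≤ |M j j| * t := mul_le_mul_of_nonneg_right (le_abs_self _) htpos.le
          simp only [Pi.smul_apply, Matrix.col_apply, MulOpposite.smul_eq_mul_unop,
            MulOpposite.unop_op, ← hw]
          nlinarith
        · have : M j i * t ≤ 0 := mul_nonpos_of_nonpos_of_nonneg (hM j i hj) htpos.le
          simpa using this.trans (hzw j)
    have := congrFun hp i
    simp at this
    exact htpos.ne' this
  · obtain ⟨V, hV0, hVJ, hMV⟩ := exists_kernel_of_det_eq_zero hdet
    obtain ⟨V, ⟨i₀, hi₀⟩, hVJ, hMV⟩ : ∃ V : Fin n → ℝ, (∃ i, 0 < V i) ∧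
        (∀ i, i ∉ supportSet z → V i = 0) ∧ ∀ i ∈ supportSet z, (M *ᵥ V) i = 0 := by
      obtain ⟨i, hi⟩ := Function.ne_iff.mp hV0
      rcases lt_or_gt_of_ne hi with h | h
      · exact ⟨-V, ⟨i, by simpa using h⟩, fun j hj => by simp [hVJ j hj], fun j hj => by
          simp [Matrix.mulVec_neg, hMV j hj]⟩
      · exact ⟨V, ⟨i, h⟩, hVJ, hMV⟩
    have hVz : ∀ i, z i = 0 → V i = 0 := fun i hi => hVJ i (by simp [mem_supportSet, hi])
    -- The positive part of a kernel vector is a direction that decreases no slack.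
    have hplus : ∀ i, (M *ᵥ fun j => max (V j) 0) i ≤ 0 := by
      intro i
      rcases le_or_gt (V i) 0 with h | h
      · exact hneg _ i (fun j => le_max_right _ _) (max_eq_right h)
      · have hi : i ∈ supportSet z := by
          by_contra hc
          exact h.ne' (hVJ i hc)
        have hsplit : (fun j => max (V j) 0) = V + fun j => max (-V j) 0 := by
          funext j
          simp only [Pi.add_apply]
          rcases le_total (V j) 0 with h' | h'
          · rw [max_eq_right h', max_eq_left (by linarith)]; ring
          · rw [max_eq_left h', max_eq_right (by linarith)]; ring
        rw [hsplit, Matrix.mulVec_add, Pi.add_apply, hMV i hi, zero_add]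
        exact hneg _ i (fun j => le_max_right _ _) (max_eq_right (by linarith))
    have hsmall : ∀ᶠ t : ℝ in 𝓝[>] 0, ∀ j, t * max (V j) 0 ≤ z j := by
      rw [eventually_all]
      intro j
      by_cases hj : z j = 0
      · simp [hVz j hj, hj]
      · have hpos : 0 < z j := lt_of_le_of_ne (hz0 j) (Ne.symm hj)
        have : Tendsto (fun t : ℝ => t * max (V j) 0) (𝓝 0) (𝓝 (0 * max (V j) 0)) :=
          tendsto_id.mul_const _
        rw [zero_mul] at this
        exact ((this.eventually (gt_mem_nhds hpos)).filter_mono nhdsWithin_le_nhds).mono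
          fun t ht => ht.le
    obtain ⟨t, ht, htpos⟩ := (hsmall.and self_mem_nhdsWithin).exists
    replace htpos : 0 < t := htpos
    have hp := key (t • fun j => max (V j) 0)
      (fun i => mul_nonneg htpos.le (le_max_right _ _)) ht (fun i => by
        rw [Matrix.mulVec_smul]
        exact (mul_nonpos_of_nonneg_of_nonpos htpos.le (hplus i)).trans (hzw i))
    have := congrFun hp i₀
    simp only [Pi.smul_apply, smul_eq_mul, Pi.zero_apply, mul_eq_zero, htpos.ne', false_or] at this
    rw [max_eq_left hi₀.le] at this
    exact hi₀.ne' this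

/-! ### Complementarity problems with adequate matrices -/

/-- Stiemke's alternative: if the range of `A` meets the nonnegative orthant only in `0`, then some
positive vector is annihilated by `Aᵀ`. -/
lemma exists_pos_transpose_mulVec_eq_zero {ι : Type*} [Fintype ι] [Nonempty ι]
    (A : Matrix ι ι ℝ) (h : ∀ x, (∀ i, 0 ≤ (A *ᵥ x) i) → A *ᵥ x = 0) :
    ∃ y : ι → ℝ, (∀ i, 0 < y i) ∧ Aᵀ *ᵥ y = 0 := by
  classical
  obtain ⟨f, u, v, hfu, huv, hfv⟩ := geometric_hahn_banach_compact_closed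
    (convex_stdSimplex ℝ ι) (isCompact_stdSimplex ℝ ι)
    (LinearMap.range A.mulVecLin).convex
    (Submodule.closed_of_finiteDimensional (LinearMap.range A.mulVecLin)) (by
      rw [Set.disjoint_left]
      rintro a ha ⟨x, hx⟩
      rw [Matrix.mulVecLin_apply] at hx
      have h0 := h x (fun i => by rw [hx]; exact ha.1 i)
      have h1 := ha.2
      rw [← hx, h0] at h1
      simp at h1)
  have hf0 : ∀ x, f (A *ᵥ x) = 0 := by
    intro x
    by_contra hne
    have := hfv ((v / f (A *ᵥ x)) • (A *ᵥ x)) ⟨(v / f (A *ᵥ x)) • x, by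
      rw [Matrix.mulVecLin_apply, Matrix.mulVec_smul]⟩
    rw [map_smul, smul_eq_mul, div_mul_cancel₀ _ hne] at this
    exact lt_irrefl _ this
  have hv0 : v < 0 := by simpa using hfv 0 (Submodule.zero_mem _)
  refine ⟨fun i => -f (Pi.single i 1), fun i => ?_, ?_⟩
  · have := hfu _ (single_mem_stdSimplex ℝ i)
    linarith
  · funext j
    have h1 := hf0 (Pi.single j 1)
    rw [Matrix.mulVec_single_one] at h1
    have h2 : A.col j = ∑ i, A i j • (Pi.single i 1 : ι → ℝ) := by
      funext k
      simp [Finset.sum_apply, Pi.single_apply]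
    rw [h2, map_sum] at h1
    simp only [map_smul, smul_eq_mul] at h1
    simp only [Matrix.mulVec, dotProduct, Matrix.transpose_apply, mul_neg, Finset.sum_neg_distrib,
      h1, neg_zero, Pi.zero_apply]

/-- A nonnegative kernel vector of an adequate matrix is matched by a nonnegative kernel vector of
the transpose with the same support. -/
lemma Adequate.exists_transpose_kernel {n : ℕ} {M : Matrix (Fin n) (Fin n) ℝ} (hM : Adequate M)
    {d : Fin n → ℝ} (hd : ∀ i, 0 ≤ d i) (hd0 : d ≠ 0) (hMd : M *ᵥ d = 0) :
    ∃ y : Fin n → ℝ, (∀ i, 0 ≤ y i) ∧ (∀ i, 0 < y i ↔ 0 < d i) ∧ Mᵀ *ᵥ y = 0 := by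
  classical
  set J := supportSet d with hJ
  have hdJ : ∀ i, i ∉ J → d i = 0 := fun i hi => by simpa [hJ, mem_supportSet] using hi
  have hdpos : ∀ i, i ∈ J ↔ 0 < d i := fun i => by
    rw [hJ, mem_supportSet]
    exact ⟨fun h => lt_of_le_of_ne (hd i) (Ne.symm h), fun h => h.ne'⟩
  obtain ⟨i₀, hi₀⟩ := Function.ne_iff.mp hd0
  have : Nonempty J := ⟨⟨i₀, mem_supportSet.mpr hi₀⟩⟩
  obtain ⟨y', hy', hMy'⟩ := exists_pos_transpose_mulVec_eq_zero (principalSub M J) (by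
    intro x' hx'
    obtain ⟨x, hxJ, rfl⟩ := exists_extend J x'
    -- Subtracting a large multiple of `d` makes `x` nonpositive on `J` and leaves `M x` unchanged.
    obtain ⟨s, hs⟩ : ∃ s : ℝ, ∀ i, x i - s * d i ≤ 0 := by
      have : ∀ᶠ s : ℝ in atTop, ∀ i, x i - s * d i ≤ 0 := by
        rw [eventually_all]
        intro i
        by_cases hi : i ∈ J
        · filter_upwards [eventually_ge_atTop (x i / d i)] with s hs
          rw [div_le_iff₀ ((hdpos i).mp hi)] at hs
          linarith
        · simp [hxJ i hi, hdJ i hi]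
      exact this.exists
    have hMz : M *ᵥ (x - s • d) = M *ᵥ x := by
      rw [Matrix.mulVec_sub, Matrix.mulVec_smul, hMd, smul_zero, sub_zero]
    have h0 := hM.1 (x - s • d) (fun i => by
      by_cases hi : i ∈ J
      · have h1 := hx' ⟨i, hi⟩
        rw [principalSub_mulVec M J hxJ] at h1
        rw [hMz]
        exact mul_nonpos_of_nonpos_of_nonneg (by simpa using hs i) h1
      · simp [hxJ i hi, hdJ i hi])
    rw [hMz] at h0
    funext i
    rw [principalSub_mulVec M J hxJ, h0]
    rfl)
  obtain ⟨y, hyJ, rfl⟩ := exists_extend J y'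
  have hypos : ∀ i, 0 < y i ↔ 0 < d i := fun i => by
    by_cases hi : i ∈ J
    · exact ⟨fun _ => (hdpos i).mp hi, fun _ => hy' ⟨i, hi⟩⟩
    · simp [hyJ i hi, hdJ i hi]
  refine ⟨y, fun i => ?_, hypos, hM.2 y fun i => ?_⟩
  · by_cases hi : i ∈ J
    · exact (hy' ⟨i, hi⟩).le
    · exact (hyJ i hi).ge
  · by_cases hi : i ∈ J
    · have h1 := congrFun hMy' ⟨i, hi⟩
      have h2 : (principalSub M J)ᵀ = principalSub Mᵀ J := rfl
      rw [h2, principalSub_mulVec Mᵀ J hyJ] at h1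
      rw [h1]
      simp
    · simp [hyJ i hi]

/-- For an adequate matrix and a strictly feasible problem, bounds on the products
`zᵢ (M z + q)ᵢ` bound the feasible points. -/
lemma Adequate.isBounded_of_products {n : ℕ} {M : Matrix (Fin n) (Fin n) ℝ} (hM : Adequate M)
    {q v : Fin n → ℝ} (hv : ∀ i, 0 < (M *ᵥ v + q) i) (b : ℝ) :
    Bornology.IsBounded {z : Fin n → ℝ | (∀ i, 0 ≤ z i) ∧ (∀ i, 0 ≤ (M *ᵥ z + q) i) ∧
      ∀ i, z i * (M *ᵥ z + q) i ≤ b} := by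
  by_contra hunb
  have hseq : ∀ k : ℕ, ∃ z : Fin n → ℝ, ((∀ i, 0 ≤ z i) ∧ (∀ i, 0 ≤ (M *ᵥ z + q) i) ∧
      ∀ i, z i * (M *ᵥ z + q) i ≤ b) ∧ (k : ℝ) + 1 < ‖z‖ := by
    intro k
    by_contra hno
    push Not at hno
    exact hunb (isBounded_iff_forall_norm_le.mpr ⟨(k : ℝ) + 1, fun z hz => hno z hz⟩)
  choose z hz hzk using hseq
  have hzpos : ∀ k, 0 < ‖z k‖ := fun k => lt_trans (by positivity) (hzk k)
  obtain ⟨d, hd1, φ, hφ, hd⟩ := (isCompact_sphere (0 : Fin n → ℝ) 1).tendsto_subseq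
    (x := fun k => ‖z k‖⁻¹ • z k) (fun k => by
      simp [norm_smul, (hzpos k).ne'])
  have hnorm : Tendsto (fun k => ‖z (φ k)‖) atTop atTop := by
    refine tendsto_atTop_mono (fun k => ?_) tendsto_natCast_atTop_atTop
    have h1 : (k : ℝ) ≤ φ k := by exact_mod_cast hφ.id_le k
    linarith [hzk (φ k)]
  have hinv : Tendsto (fun k => ‖z (φ k)‖⁻¹) atTop (𝓝 0) := tendsto_inv_atTop_zero.comp hnorm
  have hdi : ∀ i, Tendsto (fun k => ‖z (φ k)‖⁻¹ * z (φ k) i) atTop (𝓝 (d i)) := fun i =>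
    (tendsto_pi_nhds.mp hd) i
  have hd0 : ∀ i, 0 ≤ d i := fun i => ge_of_tendsto' (hdi i) fun k =>
    mul_nonneg (inv_nonneg.mpr (norm_nonneg _)) ((hz _).1 i)
  have hMd : ∀ i, Tendsto (fun k => ‖z (φ k)‖⁻¹ * (M *ᵥ z (φ k) + q) i) atTop
      (𝓝 ((M *ᵥ d) i)) := by
    intro i
    have hc : Continuous fun z : Fin n → ℝ => (M *ᵥ z) i :=
      (continuous_apply i).comp (by fun_prop : Continuous fun z : Fin n → ℝ => M *ᵥ z)
    have h1 := ((hc.tendsto d).comp hd).add (hinv.mul_const (q i))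
    rw [zero_mul, add_zero] at h1
    refine h1.congr fun k => ?_
    simp only [Function.comp_apply, Matrix.mulVec_smul, Pi.smul_apply, smul_eq_mul, Pi.add_apply]
    ring
  have hprod : ∀ i, d i * (M *ᵥ d) i ≤ 0 := by
    intro i
    have h1 := (hdi i).mul (hMd i)
    have h2 : Tendsto (fun k => ‖z (φ k)‖⁻¹ * ‖z (φ k)‖⁻¹ * b) atTop (𝓝 (0 * 0 * b)) :=
      (hinv.mul hinv).mul_const b
    rw [zero_mul, zero_mul] at h2
    refine le_of_tendsto_of_tendsto' h1 h2 fun k => ?_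
    have h3 := mul_le_mul_of_nonneg_left ((hz (φ k)).2.2 i)
      (mul_nonneg (inv_nonneg.mpr (norm_nonneg (z (φ k)))) (inv_nonneg.mpr (norm_nonneg (z (φ k)))))
    linarith
  have hne : d ≠ 0 := by
    rintro rfl
    simp at hd1
  obtain ⟨y, hy0, hyd, hMy⟩ := hM.exists_transpose_kernel hd0 hne (hM.1 d hprod)
  -- `yᵀ (M z + q)` does not depend on `z`.
  have hconst : ∀ x : Fin n → ℝ, ∑ i, y i * (M *ᵥ x + q) i = ∑ i, y i * q i := by
    intro x
    have h1 : y ⬝ᵥ (M *ᵥ x) = 0 := by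
      rw [Matrix.dotProduct_mulVec, ← Matrix.mulVec_transpose, hMy, zero_dotProduct]
    simp only [dotProduct] at h1
    simp [mul_add, Finset.sum_add_distrib, h1]
  have hpos : 0 < ∑ i, y i * q i := by
    rw [← hconst v]
    obtain ⟨i₀, hi₀⟩ := Function.ne_iff.mp hne
    refine Finset.sum_pos' (fun i _ => mul_nonneg (hy0 i) (hv i).le) ⟨i₀, Finset.mem_univ _, ?_⟩
    exact mul_pos ((hyd i₀).mpr (lt_of_le_of_ne (hd0 i₀) (Ne.symm hi₀))) (hv i₀)
  have hlim : Tendsto (fun k => ∑ i, y i * (M *ᵥ z (φ k) + q) i) atTop (𝓝 (∑ _i : Fin n, 0)) := by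
    refine tendsto_finsetSum _ fun i _ => ?_
    by_cases hi : 0 < d i
    · have hzi : Tendsto (fun k => z (φ k) i) atTop atTop := by
        refine (hnorm.atTop_mul_pos hi (hdi i)).congr fun k => ?_
        rw [← mul_assoc, mul_inv_cancel₀ (hzpos _).ne', one_mul]
      have hup : Tendsto (fun k => y i * (b * (z (φ k) i)⁻¹)) atTop (𝓝 (y i * (b * 0))) :=
        ((tendsto_inv_atTop_zero.comp hzi).const_mul b).const_mul (y i)
      rw [mul_zero, mul_zero] at hup
      refine squeeze_zero' (Eventually.of_forall fun k => mul_nonneg (hy0 i) ((hz _).2.1 i)) ?_ hup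
      filter_upwards [hzi.eventually_gt_atTop 0] with k hk
      refine mul_le_mul_of_nonneg_left ?_ (hy0 i)
      rw [← div_eq_mul_inv, le_div_iff₀ hk, mul_comm]
      exact (hz _).2.2 i
    · have : y i = 0 := le_antisymm (not_lt.mp fun h => hi ((hyd i).mp h)) (hy0 i)
      simp [this]
  simp only [hconst, Finset.sum_const_zero] at hlim
  exact hpos.ne' (tendsto_nhds_unique tendsto_const_nhds hlim)

lemma continuous_mulVec_add_apply {n : ℕ} (M : Matrix (Fin n) (Fin n) ℝ) (q : Fin n → ℝ)
    (i : Fin n) : Continuous fun z : Fin n → ℝ => (M *ᵥ z + q) i :=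
  (continuous_apply i).comp (by fun_prop : Continuous fun z : Fin n → ℝ => M *ᵥ z + q)

/-- The central path point of parameter `τ` of a strictly feasible problem with an adequate
matrix: it minimises the barrier `∑ᵢ (tᵢ + τ²/tᵢ)` with `tᵢ = zᵢ (M z + q)ᵢ`, whose only
stationary points have `tᵢ = τ` by row adequacy. -/
lemma Adequate.exists_central {n : ℕ} {M : Matrix (Fin n) (Fin n) ℝ} (hM : Adequate M)
    {q v : Fin n → ℝ} (hv0 : ∀ i, 0 < v i) (hv : ∀ i, 0 < (M *ᵥ v + q) i) {τ : ℝ} (hτ : 0 < τ) :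
    ∃ z : Fin n → ℝ, (∀ i, 0 ≤ z i) ∧ (∀ i, 0 ≤ (M *ᵥ z + q) i) ∧
      ∀ i, z i * (M *ᵥ z + q) i = τ := by
  classical
  set t : (Fin n → ℝ) → Fin n → ℝ := fun z i => z i * (M *ᵥ z + q) i with ht
  set h : (Fin n → ℝ) → ℝ := fun z => ∑ i, (t z i + τ ^ 2 * (t z i)⁻¹) with hh
  have htc : ∀ i, Continuous fun z => t z i := fun i =>
    (continuous_apply i).mul (continuous_mulVec_add_apply M q i)
  have hvt : ∀ i, 0 < t v i := fun i => mul_pos (hv0 i) (hv i)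
  set c := h v with hc
  rcases isEmpty_or_nonempty (Fin n) with hn | hn
  · exact ⟨v, fun i => isEmptyElim i, fun i => isEmptyElim i, fun i => isEmptyElim i⟩
  have hc0 : 0 < c := by
    refine Finset.sum_pos (fun i _ => ?_) Finset.univ_nonempty
    have := hvt i
    positivity
  -- The barrier is minimised over a compact set on which the products stay away from zero.
  set S : Set (Fin n → ℝ) := {z | (∀ i, 0 ≤ z i) ∧ (∀ i, 0 ≤ (M *ᵥ z + q) i) ∧
    (∀ i, t z i ≤ c) ∧ ∀ i, τ ^ 2 / c ≤ t z i} with hS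
  have hSpos : ∀ z ∈ S, ∀ i, 0 < t z i := fun z hz i => lt_of_lt_of_le (by positivity) (hz.2.2.2 i)
  have hmemS : ∀ z : Fin n → ℝ, (∀ i, 0 < z i) → (∀ i, 0 < (M *ᵥ z + q) i) → h z ≤ c → z ∈ S := by
    intro z h1 h2 h3
    have htz : ∀ i, 0 < t z i := fun i => mul_pos (h1 i) (h2 i)
    have hle : ∀ i, t z i + τ ^ 2 * (t z i)⁻¹ ≤ c := fun i => (Finset.single_le_sum
      (f := fun i => t z i + τ ^ 2 * (t z i)⁻¹)
      (fun j _ => add_nonneg (htz j).le (mul_nonneg (sq_nonneg _) (inv_nonneg.mpr (htz j).le)))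
      (Finset.mem_univ i)).trans h3
    refine ⟨fun i => (h1 i).le, fun i => (h2 i).le, fun i => ?_, fun i => ?_⟩
    · have : 0 ≤ τ ^ 2 * (t z i)⁻¹ := mul_nonneg (sq_nonneg _) (inv_nonneg.mpr (htz i).le)
      linarith [hle i]
    · have h4 : τ ^ 2 * (t z i)⁻¹ ≤ c := by linarith [hle i, htz i]
      rw [← div_eq_mul_inv, div_le_iff₀ (htz i)] at h4
      rw [div_le_iff₀ hc0]
      linarith
  have hScomp : IsCompact S := by
    refine Metric.isCompact_of_isClosed_isBounded ?_ ((hM.isBounded_of_products hv c).subset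
      fun z hz => ⟨hz.1, hz.2.1, hz.2.2.1⟩)
    have e1 : IsClosed {z : Fin n → ℝ | ∀ i, 0 ≤ z i} := by
      simp only [Set.ofPred_forall]
      exact isClosed_iInter fun i => isClosed_le continuous_const (continuous_apply i)
    have e2 : IsClosed {z : Fin n → ℝ | ∀ i, 0 ≤ (M *ᵥ z + q) i} := by
      simp only [Set.ofPred_forall]
      exact isClosed_iInter fun i =>
        isClosed_le continuous_const (continuous_mulVec_add_apply M q i)
    have e3 : IsClosed {z : Fin n → ℝ | ∀ i, t z i ≤ c} := by
      simp only [Set.ofPred_forall]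
      exact isClosed_iInter fun i => isClosed_le (htc i) continuous_const
    have e4 : IsClosed {z : Fin n → ℝ | ∀ i, τ ^ 2 / c ≤ t z i} := by
      simp only [Set.ofPred_forall]
      exact isClosed_iInter fun i => isClosed_le continuous_const (htc i)
    exact e1.inter (e2.inter (e3.inter e4))
  obtain ⟨z, hzS, hzmin⟩ := hScomp.exists_isMinOn ⟨v, hmemS v hv0 hv le_rfl⟩
    (f := h) (continuousOn_finsetSum _ fun i _ => (htc i).continuousOn.add
      (continuousOn_const.mul ((htc i).continuousOn.inv₀ fun z hz => (hSpos z hz i).ne')))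
  have hzt := hSpos z hzS
  have hzpos : ∀ i, 0 < z i := fun i => lt_of_le_of_ne (hzS.1 i) fun h0 => by
    have := hzt i
    simp [ht, ← h0] at this
  have hwpos : ∀ i, 0 < (M *ᵥ z + q) i := fun i => lt_of_le_of_ne (hzS.2.1 i) fun h0 => by
    have := hzt i
    simp only [ht, ← h0, mul_zero, lt_self_iff_false] at this
  -- Stationarity in every direction.
  set a : Fin n → ℝ := fun i => 1 - τ ^ 2 / (t z i) ^ 2 with ha
  have hstat : ∀ e : Fin n → ℝ, ∑ i, a i * (e i * (M *ᵥ z + q) i + z i * (M *ᵥ e) i) = 0 := by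
    intro e
    have hexp : ∀ (s : ℝ) i, (M *ᵥ (z + s • e) + q) i = (M *ᵥ z + q) i + s * (M *ᵥ e) i := by
      intro s i
      simp only [Matrix.mulVec_add, Matrix.mulVec_smul, Pi.add_apply, Pi.smul_apply, smul_eq_mul]
      ring
    have hderiv : HasDerivAt (fun s : ℝ => h (z + s • e))
        (∑ i, a i * (e i * (M *ᵥ z + q) i + z i * (M *ᵥ e) i)) 0 := by
      refine HasDerivAt.fun_sum fun i _ => ?_
      have h1 : HasDerivAt (fun s : ℝ => t (z + s • e) i)
          (e i * (M *ᵥ z + q) i + z i * (M *ᵥ e) i) 0 := by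
        have h2 : HasDerivAt (fun s : ℝ => (z i + s * e i) *
            ((M *ᵥ z + q) i + s * (M *ᵥ e) i)) (e i * (M *ᵥ z + q) i + z i * (M *ᵥ e) i) 0 := by
          have := (((hasDerivAt_id (0 : ℝ)).mul_const (e i)).const_add (z i)).mul
            (((hasDerivAt_id (0 : ℝ)).mul_const ((M *ᵥ e) i)).const_add ((M *ᵥ z + q) i))
          refine this.congr_deriv ?_
          simp
        refine h2.congr_of_eventuallyEq (Eventually.of_forall fun s => ?_)
        simp only [ht]
        rw [hexp]
        simp only [Pi.add_apply, Pi.smul_apply, smul_eq_mul]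
      have hz0 : t (z + (0 : ℝ) • e) i = t z i := by simp
      have h3 := h1.add ((h1.inv (by rw [hz0]; exact (hzt i).ne')).const_mul (τ ^ 2))
      refine h3.congr_deriv ?_
      simp only [hz0, ha]
      field_simp
      ring
    have hlocal : IsLocalMin (fun s : ℝ => h (z + s • e)) 0 := by
      have hcont : Continuous fun s : ℝ => z + s • e := by fun_prop
      have e1 : ∀ᶠ s : ℝ in 𝓝 0, ∀ i, 0 < (z + s • e) i := by
        rw [eventually_all]
        intro i
        have := ((continuous_apply i).comp hcont).tendsto (0 : ℝ)
        refine this.eventually (lt_mem_nhds ?_)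
        simpa using hzpos i
      have e2 : ∀ᶠ s : ℝ in 𝓝 0, ∀ i, 0 < (M *ᵥ (z + s • e) + q) i := by
        rw [eventually_all]
        intro i
        have := ((continuous_mulVec_add_apply M q i).comp hcont).tendsto (0 : ℝ)
        refine this.eventually (lt_mem_nhds ?_)
        simpa using hwpos i
      filter_upwards [e1, e2] with s hs1 hs2
      simp only [zero_smul, add_zero]
      by_cases hle : h (z + s • e) ≤ c
      · exact hzmin (hmemS _ hs1 hs2 hle)
      · exact (hzmin (hmemS v hv0 hv le_rfl) : h z ≤ h v).trans (le_of_not_ge hle)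
    exact hlocal.hasDerivAt_eq_zero hderiv
  have hrow : ∀ i, a i * (M *ᵥ z + q) i + (Mᵀ *ᵥ fun j => a j * z j) i = 0 := by
    intro i
    have h1 := hstat (Pi.single i 1)
    simp only [mul_add, Finset.sum_add_distrib] at h1
    rw [Finset.sum_eq_single i (by
      intro j _ hj
      simp [hj]) (by simp)] at h1
    rw [← h1]
    congr 1
    · simp
    · rw [Matrix.mulVec_single_one]
      simp only [Matrix.mulVec, dotProduct, Matrix.transpose_apply, Matrix.col_apply]
      exact Finset.sum_congr rfl fun j _ => by ring
  have hzero := hM.2 (fun j => a j * z j) (fun i => by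
    have h1 : (Mᵀ *ᵥ fun j => a j * z j) i = -(a i * (M *ᵥ z + q) i) := by linarith [hrow i]
    rw [h1]
    have h2 : 0 ≤ a i ^ 2 * t z i := mul_nonneg (sq_nonneg _) (hzt i).le
    simp only [ht] at h2
    nlinarith)
  refine ⟨z, hzS.1, hzS.2.1, fun i => ?_⟩
  have h1 := hrow i
  rw [hzero, Pi.zero_apply, add_zero] at h1
  have h2 : a i = 0 := (mul_eq_zero.mp h1).resolve_right (hwpos i).ne'
  have h3 : τ ^ 2 / (t z i) ^ 2 = 1 := by simp only [ha] at h2; linarith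
  rw [div_eq_one_iff_eq (pow_ne_zero 2 (hzt i).ne')] at h3
  exact ((pow_left_inj₀ hτ.le (hzt i).le two_ne_zero).mp h3).symm

/-- Under column adequacy a solution of smallest support is basic. -/
lemma ColumnAdequate.exists_basic {n : ℕ} {M : Matrix (Fin n) (Fin n) ℝ} (hM : ColumnAdequate M)
    {q z : Fin n → ℝ} (hz : IsLCPSolution M q z) : ∃ z, IsLCPSolution M q z ∧ IsBasic M z := by
  classical
  obtain ⟨z, hz, hmin⟩ : ∃ z, IsLCPSolution M q z ∧ ∀ z', IsLCPSolution M q z' →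
      (supportSet z).card ≤ (supportSet z').card := by
    obtain ⟨z, hz, h⟩ := Function.argminOn_mem (fun z => (supportSet z).card)
      {z | IsLCPSolution M q z} ⟨z, hz⟩ |> fun h => (⟨_, h, fun z' hz' =>
        Function.argminOn_le (fun z => (supportSet z).card) _ hz'⟩ : ∃ z, IsLCPSolution M q z ∧
          ∀ z', IsLCPSolution M q z' → (supportSet z).card ≤ (supportSet z').card)
    exact ⟨z, hz, h⟩
  refine ⟨z, hz, fun hdet => ?_⟩
  obtain ⟨V, hV0, hVJ, hMV⟩ := exists_kernel_of_det_eq_zero hdet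
  obtain ⟨V, ⟨i₀, hi₀⟩, hVJ, hMV⟩ : ∃ V : Fin n → ℝ, (∃ i, 0 < V i) ∧
      (∀ i, i ∉ supportSet z → V i = 0) ∧ ∀ i ∈ supportSet z, (M *ᵥ V) i = 0 := by
    obtain ⟨i, hi⟩ := Function.ne_iff.mp hV0
    rcases lt_or_gt_of_ne hi with h | h
    · exact ⟨-V, ⟨i, by simpa using h⟩, fun j hj => by simp [hVJ j hj], fun j hj => by
        simp [Matrix.mulVec_neg, hMV j hj]⟩
    · exact ⟨V, ⟨i, h⟩, hVJ, hMV⟩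
  have hMV0 : M *ᵥ V = 0 := hM V fun i => by
    by_cases hi : i ∈ supportSet z
    · simp [hMV i hi]
    · simp [hVJ i hi]
  -- Move along `-V` until the first coordinate vanishes.
  obtain ⟨i₁, hi₁, hratio⟩ := Finset.exists_min_image (Finset.univ.filter fun i => 0 < V i)
    (fun i => z i / V i) ⟨i₀, by simpa using hi₀⟩
  rw [Finset.mem_filter] at hi₁
  set t := z i₁ / V i₁ with ht
  have ht0 : 0 ≤ t := div_nonneg (hz.nonneg _) hi₁.2.le
  have hw : M *ᵥ (z - t • V) = M *ᵥ z := by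
    rw [Matrix.mulVec_sub, Matrix.mulVec_smul, hMV0, smul_zero, sub_zero]
  have hsol : IsLCPSolution M q (z - t • V) := by
    refine ⟨fun i => ?_, fun i => by rw [hw]; exact hz.slack_nonneg i, fun i => ?_⟩
    · simp only [Pi.sub_apply, Pi.smul_apply, smul_eq_mul, sub_nonneg]
      rcases le_or_gt (V i) 0 with h | h
      · exact (mul_nonpos_of_nonneg_of_nonpos ht0 h).trans (hz.nonneg i)
      · rw [← le_div_iff₀ h]
        exact hratio i (by simpa using h)
    · rw [hw]
      by_cases hi : i ∈ supportSet z
      · rw [(mul_eq_zero.mp (hz.compl i)).resolve_left (mem_supportSet.mp hi), mul_zero]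
      · have h1 : z i = 0 := by simpa [mem_supportSet] using hi
        simp [h1, hVJ i hi]
  refine absurd (hmin _ hsol) (not_le.mpr (Finset.card_lt_card ?_))
  rw [Finset.ssubset_iff_of_subset]
  · refine ⟨i₁, ?_, ?_⟩
    · by_contra hc
      exact hi₁.2.ne' (hVJ _ hc)
    · rw [mem_supportSet, not_not]
      simp [ht, hi₁.2.ne']
  · intro i hi
    rw [mem_supportSet] at hi
    by_contra hc
    have h1 : z i = 0 := by simpa [mem_supportSet] using hc
    exact hi (by simp [h1, hVJ i hc])

lemma IsLCPSolution.of_tendsto {n : ℕ} {M : Matrix (Fin n) (Fin n) ℝ} {q z : Fin n → ℝ}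
    {ι : Type*} {F : Filter ι} [F.NeBot] {qs zs : ι → Fin n → ℝ} {b : ι → Fin n → ℝ}
    (hq : Tendsto qs F (𝓝 q)) (hz : Tendsto zs F (𝓝 z)) (hb : Tendsto b F (𝓝 0))
    (h0 : ∀ k i, 0 ≤ zs k i) (h1 : ∀ k i, 0 ≤ (M *ᵥ zs k + qs k) i)
    (h2 : ∀ k i, zs k i * (M *ᵥ zs k + qs k) i = b k i) : IsLCPSolution M q z := by
  have hzi : ∀ i, Tendsto (fun k => zs k i) F (𝓝 (z i)) := tendsto_pi_nhds.mp hz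
  have hwi : ∀ i, Tendsto (fun k => (M *ᵥ zs k + qs k) i) F (𝓝 ((M *ᵥ z + q) i)) := by
    have hc : Continuous fun z : Fin n → ℝ => M *ᵥ z := by fun_prop
    exact tendsto_pi_nhds.mp (((hc.tendsto z).comp hz).add hq)
  refine ⟨fun i => ge_of_tendsto' (hzi i) fun k => h0 k i,
    fun i => ge_of_tendsto' (hwi i) fun k => h1 k i, fun i => ?_⟩
  refine tendsto_nhds_unique ((hzi i).mul (hwi i)) ?_
  simp only [h2]
  exact (tendsto_pi_nhds.mp hb) i

/-- A feasible linear complementarity problem with an adequate matrix has a basic solution. For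
strictly feasible problems it is a limit of central path points; in general `q` is approximated
by strictly feasible right-hand sides, and finitely many bases bound their basic solutions. -/
theorem Adequate.exists_basic_solution {n : ℕ} {M : Matrix (Fin n) (Fin n) ℝ} (hM : Adequate M)
    {q v : Fin n → ℝ} (hv : ∀ i, 0 ≤ v i) (hMv : ∀ i, 0 ≤ (M *ᵥ v + q) i) :
    ∃ z, IsLCPSolution M q z ∧ IsBasic M z := by
  suffices h : ∃ z, IsLCPSolution M q z by
    obtain ⟨z, hz⟩ := h
    exact hM.1.exists_basic hz
  have hrate : Tendsto (fun k : ℕ => 1 / ((k : ℝ) + 1)) atTop (𝓝 0) :=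
    tendsto_one_div_add_atTop_nhds_zero_nat
  have hratepos : ∀ k : ℕ, 0 < 1 / ((k : ℝ) + 1) := fun k => by positivity
  have hrate1 : ∀ k : ℕ, 1 / ((k : ℝ) + 1) ≤ 1 := fun k => by
    rw [div_le_one (by positivity)]
    linarith [k.cast_nonneg (α := ℝ)]
  have hstrict : ∀ (q' v' : Fin n → ℝ), (∀ i, 0 < v' i) → (∀ i, 0 < (M *ᵥ v' + q') i) →
      ∃ z, IsLCPSolution M q' z := by
    intro q' v' h1 h2
    choose z hz0 hzw hzt using fun k : ℕ => hM.exists_central h1 h2 (hratepos k)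
    obtain ⟨z', -, φ, hφ, hz'⟩ := tendsto_subseq_of_bounded
      (hM.isBounded_of_products h2 1) (x := z) (fun k => ⟨hz0 k, hzw k, fun i => by
        rw [hzt]
        exact hrate1 k⟩)
    refine ⟨z', IsLCPSolution.of_tendsto (qs := fun _ => q') (b := fun k _ =>
      1 / ((φ k : ℝ) + 1)) tendsto_const_nhds hz' ?_ (fun k => hz0 _) (fun k => hzw _)
      fun k => hzt _⟩
    exact tendsto_pi_nhds.mpr fun i => hrate.comp hφ.tendsto_atTop
  have hpert : ∀ t : ℝ, 0 < t → ∃ z, IsLCPSolution M (q + fun _ => t) z ∧ IsBasic M z := by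
    intro t ht
    obtain ⟨s, hs0, hs⟩ : ∃ s : ℝ, 0 < s ∧ ∀ i, -t < s * (M *ᵥ fun _ => 1) i := by
      have : ∀ᶠ s : ℝ in 𝓝[>] 0, ∀ i, -t < s * (M *ᵥ fun _ => 1) i := by
        rw [eventually_all]
        intro i
        have h1 : Tendsto (fun s : ℝ => s * (M *ᵥ fun _ => 1) i) (𝓝 0)
          (𝓝 (0 * (M *ᵥ fun _ => 1) i)) := tendsto_id.mul_const _
        rw [zero_mul] at h1
        exact (h1.eventually (lt_mem_nhds (by linarith))).filter_mono nhdsWithin_le_nhds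
      obtain ⟨s, hs, hs0⟩ := (this.and self_mem_nhdsWithin).exists
      exact ⟨s, hs0, hs⟩
    obtain ⟨z, hz⟩ := hstrict (q + fun _ => t) (v + s • fun _ => 1)
      (fun i => by simpa using add_pos_of_nonneg_of_pos (hv i) hs0) (fun i => by
        have h1 := hMv i
        have h2 := hs i
        simp only [Matrix.mulVec_add, Matrix.mulVec_smul, Pi.add_apply, Pi.smul_apply,
          smul_eq_mul] at h1 ⊢
        linarith)
    exact hM.1.exists_basic hz
  choose z hz hzb using fun k : ℕ => hpert _ (hratepos k)
  have hbdd : Bornology.IsBounded (Set.range z) := by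
    rw [isBounded_iff_forall_norm_le]
    refine ⟨betaConst M * (∑ i, (|q i| + 1)), ?_⟩
    rintro _ ⟨k, rfl⟩
    have hq : ∑ i, |(q + fun _ : Fin n => 1 / ((k : ℝ) + 1) : Fin n → ℝ) i| ≤ ∑ i, (|q i| + 1) := by
      refine Finset.sum_le_sum fun i _ => ?_
      refine (abs_add_le _ _).trans (by
        gcongr
        rw [abs_of_pos (hratepos k)]
        exact hrate1 k)
    have h0 : 0 ≤ betaConst M * (∑ i, (|q i| + 1)) :=
      mul_nonneg (betaConst_nonneg M) (Finset.sum_nonneg fun i _ => by positivity)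
    rw [pi_norm_le_iff_of_nonneg h0]
    intro i
    exact (Finset.single_le_sum (f := fun i => |z k i|) (fun j _ => abs_nonneg _)
      (Finset.mem_univ i)).trans (((hz k).sum_abs_le (hzb k)).trans
      (mul_le_mul_of_nonneg_left hq (betaConst_nonneg M)))
  obtain ⟨z', -, φ, hφ, hz'⟩ := tendsto_subseq_of_bounded hbdd (x := z) (fun k => ⟨k, rfl⟩)
  refine ⟨z', IsLCPSolution.of_tendsto (b := 0) (qs := fun k => q + fun _ =>
    1 / ((φ k : ℝ) + 1)) ?_ hz' tendsto_const_nhds (fun k => (hz _).nonneg)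
    (fun k => (hz _).slack_nonneg) fun k => (hz _).compl⟩
  have h1 : Tendsto (fun k => fun _ : Fin n => 1 / ((φ k : ℝ) + 1)) atTop (𝓝 0) :=
    tendsto_pi_nhds.mpr fun i => hrate.comp hφ.tendsto_atTop
  simpa using h1.const_add q

/-- A feasible problem with an adequate matrix or a Z-matrix has a solution whose `ℓ¹` norm is at
most `β ‖q‖₁`. -/
theorem exists_lcpSolution_sum_abs_le {n : ℕ} {M : Matrix (Fin n) (Fin n) ℝ}
    (hM : Adequate M ∨ IsZMatrix M) {q v : Fin n → ℝ} (hv : ∀ i, 0 ≤ v i)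
    (hMv : ∀ i, 0 ≤ (M *ᵥ v + q) i) :
    ∃ z, IsLCPSolution M q z ∧ ∑ i, |z i| ≤ betaConst M * ∑ i, |q i| := by
  obtain ⟨z, hz, hb⟩ : ∃ z, IsLCPSolution M q z ∧ IsBasic M z :=
    hM.elim (fun h => h.exists_basic_solution hv hMv) fun h => h.exists_basic_solution hv hMv
  exact ⟨z, hz, hz.sum_abs_le hb⟩

/-! ### Uniform law of large numbers -/

open ControlProblem in
/-- The strong law of large numbers for the sample average of one integrable function. -/
lemma tendsto_sampleAvg {Ξ Ω : Type*} [MeasurableSpace Ξ] [MeasurableSpace Ω]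
    {μ : Measure Ξ} {Pr : Measure Ω}
    {ξ : ℕ → Ω → Ξ} (hmeas : ∀ j, Measurable (ξ j)) (hlaw : ∀ j, Pr.map (ξ j) = μ)
    (hindep : iIndepFun ξ Pr) {E : Type*} [NormedAddCommGroup E] [NormedSpace ℝ E]
    [CompleteSpace E] [MeasurableSpace E] [BorelSpace E] {H : Ξ → E} (hH : Measurable H)
    (hint : Integrable H μ) :
    ∀ᵐ w ∂Pr, Tendsto (fun ν => sampleAvg ν (fun j => ξ j w) H) atTop (𝓝 (∫ s, H s ∂μ)) := by
  have hint0 : ∀ j, Integrable (fun w => H (ξ j w)) Pr := fun j => by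
    rw [← hlaw j] at hint
    exact hint.comp_measurable (hmeas j)
  have h := strong_law_ae (μ := Pr) (fun j w => H (ξ j w)) (hint0 0)
    (fun i j hij => (hindep.indepFun hij).comp hH hH)
    (fun j => ⟨(hint0 j).aemeasurable, (hint0 0).aemeasurable, by
      have e : ∀ j, Pr.map (fun w => H (ξ j w)) = μ.map H := fun j => by
        rw [← hlaw j, Measure.map_map hH (hmeas j)]
        rfl
      rw [e, e]⟩)
  have e : ∫ w, H (ξ 0 w) ∂Pr = ∫ s, H s ∂μ := by
    rw [← hlaw 0] at hint ⊢
    rw [integral_map (hmeas 0).aemeasurable hint.aestronglyMeasurable]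
  rw [e] at h
  exact h

/-- A random function `G(z, s)` that is measurable in `s`, almost surely continuous in `z`, and
dominated by an integrable function on each ball. -/
structure IsDominatedCaratheodory {Ξ X E : Type*} [MeasurableSpace Ξ] [NormedAddCommGroup X]
    [NormedAddCommGroup E] [MeasurableSpace E] (μ : Measure Ξ) (G : X → Ξ → E) : Prop where
  meas : ∀ z, Measurable (G z)
  cont : ∀ᵐ s ∂μ, Continuous fun z => G z s
  dominated : ∀ R : ℝ, ∃ κ : Ξ → ℝ, Integrable κ μ ∧ ∀ z, ‖z‖ ≤ R → ∀ᵐ s ∂μ, ‖G z s‖ ≤ κ s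

namespace IsDominatedCaratheodory

variable {Ξ X E : Type*} [MeasurableSpace Ξ] {μ : Measure Ξ} [NormedAddCommGroup X]
  [NormedAddCommGroup E] [MeasurableSpace E] [BorelSpace E]
  [SecondCountableTopology E] {G : X → Ξ → E}

lemma integrable (hG : IsDominatedCaratheodory μ G) (z : X) : Integrable (G z) μ := by
  obtain ⟨κ, hκ, hb⟩ := hG.dominated ‖z‖
  exact hκ.mono' (hG.meas z).aestronglyMeasurable (hb z le_rfl)

lemma continuous_integral [NormedSpace ℝ E] (hG : IsDominatedCaratheodory μ G) :
    Continuous fun z => ∫ s, G z s ∂μ := by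
  rw [continuous_iff_continuousAt]
  intro z₀
  obtain ⟨κ, hκ, hb⟩ := hG.dominated (‖z₀‖ + 1)
  refine continuousAt_of_dominated (bound := κ)
    (Eventually.of_forall fun z => (hG.meas z).aestronglyMeasurable) ?_ hκ
    (hG.cont.mono fun s hs => hs.continuousAt)
  filter_upwards [continuous_norm.continuousAt.eventually (gt_mem_nhds (lt_add_one ‖z₀‖))]
    with z hz using hb z hz.le

/-- Near each point the oscillation of `G` is dominated by a function of small expectation. -/
lemma exists_local_modulus [SecondCountableTopology X] (hG : IsDominatedCaratheodory μ G)
    (z₀ : X) {η : ℝ} (hη : 0 < η) :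
    ∃ r > 0, ∃ w : Ξ → ℝ, Measurable w ∧ Integrable w μ ∧ ∫ s, w s ∂μ ≤ η ∧
      ∀ᵐ s ∂μ, ∀ z ∈ Metric.ball z₀ r, ‖G z s - G z₀ s‖ ≤ w s := by
  obtain ⟨κ, hκ, hb⟩ := hG.dominated (‖z₀‖ + 1)
  set d := TopologicalSpace.denseSeq X with hd
  -- The supremum over a countable dense set, which makes the modulus measurable.
  set W : ℕ → Ξ → ℝ≥0∞ := fun j s => ⨆ i : ℕ, ⨆ _ : d i ∈ Metric.ball z₀ (1 / ((j : ℝ) + 1)),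
    ‖G (d i) s - G z₀ s‖ₑ with hW
  have hWm : ∀ j, Measurable (W j) := fun j =>
    Measurable.iSup fun i => Measurable.iSup fun _ => ((hG.meas _).sub (hG.meas _)).enorm
  have hr1 : ∀ j : ℕ, 1 / ((j : ℝ) + 1) ≤ 1 := fun j => by
    rw [div_le_one (by positivity)]
    linarith [j.cast_nonneg (α := ℝ)]
  have hdom : ∀ᵐ s ∂μ, ∀ i, ‖d i‖ ≤ ‖z₀‖ + 1 → ‖G (d i) s‖ ≤ κ s := by
    rw [ae_all_iff]
    intro i
    by_cases h : ‖d i‖ ≤ ‖z₀‖ + 1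
    · filter_upwards [hb _ h] with s hs _ using hs
    · exact Eventually.of_forall fun s h' => absurd h' h
  have hdom0 := hb z₀ (by linarith)
  have hWb : ∀ᵐ s ∂μ, ∀ j, W j s ≤ ENNReal.ofReal (2 * κ s) := by
    filter_upwards [hdom, hdom0] with s hs hs0 j
    refine iSup_le fun i => iSup_le fun hi => ?_
    rw [← ofReal_norm]
    refine ENNReal.ofReal_le_ofReal ((norm_sub_le _ _).trans ?_)
    have : ‖d i‖ ≤ ‖z₀‖ + 1 := by
      rw [mem_ball_iff_norm] at hi
      have := norm_le_norm_add_norm_sub' (d i) z₀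
      linarith [hr1 j]
    linarith [hs i this]
  have hκ0 : ∀ᵐ s ∂μ, 0 ≤ κ s := hdom0.mono fun s hs => (norm_nonneg _).trans hs
  have hWint : ∀ j, Integrable (fun s => (W j s).toReal) μ := fun j => by
    refine (hκ.const_mul 2).mono' (hWm j).ennreal_toReal.aestronglyMeasurable ?_
    filter_upwards [hWb, hκ0] with s hs h0
    rw [Real.norm_of_nonneg ENNReal.toReal_nonneg]
    exact ENNReal.toReal_le_of_le_ofReal (by linarith) (hs j)
  have hlim : Tendsto (fun j => ∫ s, (W j s).toReal ∂μ) atTop (𝓝 (∫ _, (0 : ℝ) ∂μ)) := by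
    refine tendsto_integral_of_dominated_convergence (fun s => 2 * κ s)
      (fun j => (hWint j).aestronglyMeasurable) (hκ.const_mul 2) (fun j => ?_) ?_
    · filter_upwards [hWb, hκ0] with s hs h0
      rw [Real.norm_of_nonneg ENNReal.toReal_nonneg]
      exact ENNReal.toReal_le_of_le_ofReal (by linarith) (hs j)
    · filter_upwards [hG.cont] with s hs
      rw [Metric.tendsto_atTop]
      intro e he
      obtain ⟨δ, hδ, hδe⟩ := Metric.continuousAt_iff.mp hs.continuousAt (e / 2) (half_pos he)
      obtain ⟨N, hN⟩ := exists_nat_one_div_lt hδ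
      refine ⟨N, fun j hj => ?_⟩
      rw [Real.dist_eq, sub_zero, abs_of_nonneg ENNReal.toReal_nonneg]
      refine lt_of_le_of_lt (ENNReal.toReal_le_of_le_ofReal (half_pos he).le
        (iSup_le fun i => iSup_le fun hi => ?_)) (half_lt_self he)
      rw [← ofReal_norm]
      refine ENNReal.ofReal_le_ofReal ?_
      rw [← dist_eq_norm]
      refine (hδe ?_).le
      refine (Metric.mem_ball.mp hi).trans_le (le_trans ?_ hN.le)
      exact one_div_le_one_div_of_le (by positivity) (by
        have : (N : ℝ) ≤ j := by exact_mod_cast hj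
        linarith)
  rw [integral_zero] at hlim
  obtain ⟨j, hj⟩ := (hlim.eventually (gt_mem_nhds hη)).exists
  refine ⟨1 / ((j : ℝ) + 1), by positivity, fun s => (W j s).toReal, (hWm j).ennreal_toReal,
    hWint j, hj.le, ?_⟩
  filter_upwards [hG.cont, hWb] with s hs hsb z hz
  have hne : W j s ≠ ⊤ := ne_top_of_le_ne_top ENNReal.ofReal_ne_top (hsb j)
  have hcl : z ∈ closure (Metric.ball z₀ (1 / ((j : ℝ) + 1)) ∩ Set.range d) :=
    (TopologicalSpace.denseRange_denseSeq X).open_subset_closure_inter Metric.isOpen_ball hz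
  refine closure_minimal (s := Metric.ball z₀ (1 / ((j : ℝ) + 1)) ∩ Set.range d)
    (t := {z | ‖G z s - G z₀ s‖ ≤ (W j s).toReal}) ?_
    (isClosed_le (hs.sub continuous_const).norm continuous_const) hcl
  rintro _ ⟨hi, i, rfl⟩
  change ‖G (d i) s - G z₀ s‖ ≤ (W j s).toReal
  have h1 : ‖G (d i) s - G z₀ s‖ₑ ≤ W j s := le_iSup₂_of_le i hi le_rfl
  have h2 := ENNReal.toReal_mono hne h1
  rwa [toReal_enorm] at h2

open ControlProblem in
/-- The uniform law of large numbers on bounded sets. -/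
theorem uniform_sampleAvg [NormedSpace ℝ E] [NormedSpace ℝ X] [FiniteDimensional ℝ X]
    [CompleteSpace E]
    (hG : IsDominatedCaratheodory μ G) {Ω : Type*} [MeasurableSpace Ω] {Pr : Measure Ω}
    {ξ : ℕ → Ω → Ξ} (hmeas : ∀ j, Measurable (ξ j)) (hlaw : ∀ j, Pr.map (ξ j) = μ)
    (hindep : iIndepFun ξ Pr) :
    ∀ᵐ w ∂Pr, ∀ R η : ℝ, 0 < η → ∀ᶠ ν : ℕ in atTop, ∀ z, ‖z‖ ≤ R →
      ‖sampleAvg ν (fun j => ξ j w) (G z) - ∫ s, G z s ∂μ‖ ≤ η := by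
  have : ProperSpace X := FiniteDimensional.proper_real X
  have hsamp : ∀ {p : Ξ → Prop}, (∀ᵐ s ∂μ, p s) → ∀ᵐ w ∂Pr, ∀ j, p (ξ j w) := by
    intro p hp
    rw [ae_all_iff]
    intro j
    rw [← hlaw j] at hp
    exact ae_of_ae_map (hmeas j).aemeasurable hp
  have key : ∀ (R η : ℝ), 0 < η → ∀ᵐ w ∂Pr, ∀ᶠ ν : ℕ in atTop, ∀ z, ‖z‖ ≤ R →
      ‖sampleAvg ν (fun j => ξ j w) (G z) - ∫ s, G z s ∂μ‖ ≤ 4 * η := by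
    intro R η hη
    choose r hr W hWm hWi hWη hW using fun z₀ => hG.exists_local_modulus z₀ hη
    obtain ⟨t, -, ht⟩ := (isCompact_closedBall (0 : X) R).elim_nhds_subcover
      (fun z => Metric.ball z (r z)) (fun z _ => Metric.ball_mem_nhds z (hr z))
    have h1 : ∀ᵐ w ∂Pr, ∀ z₀ ∈ t, Tendsto (fun ν => sampleAvg ν (fun j => ξ j w) (G z₀)) atTop
        (𝓝 (∫ s, G z₀ s ∂μ)) := by
      rw [eventually_all_finset]
      exact fun z₀ _ => tendsto_sampleAvg hmeas hlaw hindep (hG.meas z₀) (hG.integrable z₀)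
    have h2 : ∀ᵐ w ∂Pr, ∀ z₀ ∈ t, Tendsto (fun ν => sampleAvg ν (fun j => ξ j w) (W z₀)) atTop
        (𝓝 (∫ s, W z₀ s ∂μ)) := by
      rw [eventually_all_finset]
      exact fun z₀ _ => tendsto_sampleAvg hmeas hlaw hindep (hWm z₀) (hWi z₀)
    have h3 : ∀ᵐ w ∂Pr, ∀ z₀ ∈ t, ∀ j, ∀ z ∈ Metric.ball z₀ (r z₀),
        ‖G z (ξ j w) - G z₀ (ξ j w)‖ ≤ W z₀ (ξ j w) := by
      rw [eventually_all_finset]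
      exact fun z₀ _ => hsamp (hW z₀)
    filter_upwards [h1, h2, h3] with w hw1 hw2 hw3
    have e1 : ∀ᶠ ν : ℕ in atTop, ∀ z₀ ∈ t,
        ‖sampleAvg ν (fun j => ξ j w) (G z₀) - ∫ s, G z₀ s ∂μ‖ ≤ η := by
      rw [eventually_all_finset]
      intro z₀ hz₀
      have := (hw1 z₀ hz₀).eventually (Metric.closedBall_mem_nhds _ hη)
      filter_upwards [this] with ν hν
      rwa [← dist_eq_norm]
    have e2 : ∀ᶠ ν : ℕ in atTop, ∀ z₀ ∈ t, sampleAvg ν (fun j => ξ j w) (W z₀) ≤ 2 * η := by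
      rw [eventually_all_finset]
      intro z₀ hz₀
      refine ((hw2 z₀ hz₀).eventually (gt_mem_nhds ?_)).mono fun _ h => h.le
      linarith [hWη z₀]
    filter_upwards [e1, e2] with ν hν1 hν2 z hz
    obtain ⟨z₀, hz₀, hzb⟩ : ∃ z₀ ∈ t, z ∈ Metric.ball z₀ (r z₀) := by
      simpa using ht (by simpa using hz : z ∈ Metric.closedBall (0 : X) R)
    have d1 : ‖sampleAvg ν (fun j => ξ j w) (G z) - sampleAvg ν (fun j => ξ j w) (G z₀)‖ ≤
        2 * η := by
      refine le_trans ?_ (hν2 z₀ hz₀)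
      simp only [sampleAvg]
      rw [← smul_sub, ← Finset.sum_sub_distrib, norm_smul, smul_eq_mul, Real.norm_of_nonneg
        (by positivity)]
      refine mul_le_mul_of_nonneg_left ?_ (by positivity)
      exact (norm_sum_le _ _).trans (Finset.sum_le_sum fun j _ => hw3 z₀ hz₀ j z hzb)
    have d2 : ‖(∫ s, G z₀ s ∂μ) - ∫ s, G z s ∂μ‖ ≤ η := by
      rw [← integral_sub (hG.integrable _) (hG.integrable _)]
      refine le_trans (norm_integral_le_of_norm_le (hWi z₀) ?_) (hWη z₀)
      filter_upwards [hW z₀] with s hs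
      rw [norm_sub_rev]
      exact hs z hzb
    have d3 := hν1 z₀ hz₀
    calc ‖sampleAvg ν (fun j => ξ j w) (G z) - ∫ s, G z s ∂μ‖
        = ‖(sampleAvg ν (fun j => ξ j w) (G z) - sampleAvg ν (fun j => ξ j w) (G z₀)) +
          (sampleAvg ν (fun j => ξ j w) (G z₀) - ∫ s, G z₀ s ∂μ) +
          ((∫ s, G z₀ s ∂μ) - ∫ s, G z s ∂μ)‖ := by congr 1; abel
      _ ≤ _ := norm_add₃_le
      _ ≤ 4 * η := by linarith
  have hall : ∀ᵐ w ∂Pr, ∀ k : ℕ, ∀ᶠ ν : ℕ in atTop, ∀ z, ‖z‖ ≤ (k : ℝ) →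
      ‖sampleAvg ν (fun j => ξ j w) (G z) - ∫ s, G z s ∂μ‖ ≤ 4 * (1 / ((k : ℝ) + 1)) := by
    rw [ae_all_iff]
    exact fun k => key k _ (by positivity)
  filter_upwards [hall] with w hw R η hη
  obtain ⟨k₁, hk₁⟩ := exists_nat_ge R
  obtain ⟨k₂, hk₂⟩ := exists_nat_one_div_lt (show 0 < η / 4 by linarith)
  filter_upwards [hw (max k₁ k₂)] with ν hν z hz
  refine (hν z (hz.trans (hk₁.trans (by exact_mod_cast le_max_left k₁ k₂)))).trans ?_
  have : 1 / (((max k₁ k₂ : ℕ) : ℝ) + 1) ≤ 1 / ((k₂ : ℝ) + 1) :=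
    one_div_le_one_div_of_le (by positivity) (by
      have : (k₂ : ℝ) ≤ (max k₁ k₂ : ℕ) := by exact_mod_cast le_max_right k₁ k₂
      linarith)
  linarith

end IsDominatedCaratheodory

/-! ### Parametric constrained least squares -/

/-- The data of the least squares problem: minimise `‖G y - b‖` over the `y` in a given convex set
with `L y + c = z`. The right-hand side `z` is a parameter. -/
structure LeastSquares (Y H Z : Type*) [NormedAddCommGroup Y] [NormedSpace ℝ Y]
    [NormedAddCommGroup H] [InnerProductSpace ℝ H] [NormedAddCommGroup Z] [NormedSpace ℝ Z] where
  L : Y →L[ℝ] Z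
  c : Z
  G : Y →L[ℝ] H
  b : H

namespace LeastSquares

variable {Y H Z : Type*} [NormedAddCommGroup Y] [NormedSpace ℝ Y] [NormedAddCommGroup H]
  [InnerProductSpace ℝ H] [NormedAddCommGroup Z] [NormedSpace ℝ Z]

/-- The residual `G y - b`, whose norm is minimised. -/
def res (P : LeastSquares Y H Z) (y : Y) : H := P.G y - P.b

/-- `y` is a minimiser of the residual over the points of `Q` with `L y + c = z`. -/
structure IsMinimizer (P : LeastSquares Y H Z) (Q : Set Y) (z : Z) (y : Y) : Prop where
  mem : y ∈ Q
  eq : P.L y + P.c = z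
  le : ∀ y' ∈ Q, P.L y' + P.c = z → ‖P.res y‖ ≤ ‖P.res y'‖

open Classical in
/-- A minimiser, if there is one. -/
def argmin (P : LeastSquares Y H Z) (Q : Set Y) (z : Z) : Y :=
  if h : ∃ y, P.IsMinimizer Q z y then h.choose else 0

/-- The optimal value `½ ‖G y - b‖²`. -/
def value (P : LeastSquares Y H Z) (Q : Set Y) (z : Z) : ℝ := 1 / 2 * ‖P.res (P.argmin Q z)‖ ^ 2

/-- The conditions under which the problem is uniquely solvable for all `z`: `G` is bounded below
by `γ`, and `R` is a right inverse of `L` with values in directions that leave `Q` invariant. -/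
structure Regular (P : LeastSquares Y H Z) (Q : Set Y) (γ : ℝ) (R : Z →L[ℝ] Y) : Prop where
  pos : 0 < γ
  bound : ∀ y, γ * ‖y‖ ≤ ‖P.G y‖
  right_inv : ∀ z, P.L (R z) = z
  invariant : ∀ y ∈ Q, ∀ z, y + R z ∈ Q

/-- The right inverse moves a point of `Q` to the constraint set without leaving `Q`. -/
lemma Regular.correct_mem {P : LeastSquares Y H Z} {Q : Set Y} {γ : ℝ} {R : Z →L[ℝ] Y}
    (hP : P.Regular Q γ R) {y : Y} (hy : y ∈ Q) (z : Z) :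
    y + R (z - (P.L y + P.c)) ∈ Q ∧ P.L (y + R (z - (P.L y + P.c))) + P.c = z := by
  refine ⟨hP.invariant y hy _, ?_⟩
  rw [map_add, hP.right_inv]
  abel

/-- The residuals of the admissible points form a nonempty closed convex set, which contains a
point of minimal norm. -/
theorem Regular.exists_isMinimizer [CompleteSpace Y] [CompleteSpace H] {P : LeastSquares Y H Z}
    {Q : Set Y} {γ : ℝ} {R : Z →L[ℝ] Y} (hP : P.Regular Q γ R) (hconv : Convex ℝ Q)
    (hclosed : IsClosed Q) (h0 : (0 : Y) ∈ Q) (z : Z) : ∃ y, P.IsMinimizer Q z y := by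
  set S : Set Y := Q ∩ {y | P.L y + P.c = z} with hS
  have hSne : S.Nonempty := ⟨_, hP.correct_mem h0 z⟩
  have hSc : IsClosed S := hclosed.inter (isClosed_eq (by fun_prop) continuous_const)
  have hSconv : Convex ℝ S := by
    refine hconv.inter ?_
    intro y hy y' hy' a a' ha ha' haa
    change P.L y + P.c = z at hy
    change P.L y' + P.c = z at hy'
    change P.L (a • y + a' • y') + P.c = z
    have e1 : P.L y = z - P.c := eq_sub_of_add_eq hy
    have e2 : P.L y' = z - P.c := eq_sub_of_add_eq hy'
    rw [map_add, map_smul, map_smul, e1, e2, ← add_smul, haa, one_smul, sub_add_cancel]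
  have hanti : AntilipschitzWith (Real.toNNReal γ⁻¹) P.G := by
    refine P.G.antilipschitz_of_bound fun y => ?_
    rw [Real.coe_toNNReal _ (inv_nonneg.mpr hP.pos.le), ← div_eq_inv_mul, le_div_iff₀ hP.pos,
      mul_comm]
    exact hP.bound y
  have hcomp : IsComplete (P.G '' S) :=
    (isComplete_image_iff (hanti.isUniformInducing P.G.uniformContinuous)).mpr
      hSc.isComplete
  obtain ⟨_, ⟨y, hyS, rfl⟩, hy⟩ := exists_norm_eq_iInf_of_complete_convex (hSne.image P.G) hcomp
    (hSconv.linear_image P.G.toLinearMap) P.b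
  refine ⟨y, hyS.1, hyS.2, fun y' hy' hz' => ?_⟩
  have hb : BddBelow (Set.range fun w : P.G '' S => ‖P.b - w‖) :=
    ⟨0, by rintro _ ⟨w, rfl⟩; exact norm_nonneg _⟩
  have h1 := ciInf_le hb ⟨P.G y', y', ⟨hy', hz'⟩, rfl⟩
  rw [← hy] at h1
  simp only [res]
  rw [norm_sub_rev, norm_sub_rev (P.G y')]
  exact h1

lemma argmin_spec {P : LeastSquares Y H Z} {Q : Set Y} {z : Z} (h : ∃ y, P.IsMinimizer Q z y) :
    P.IsMinimizer Q z (P.argmin Q z) := by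
  unfold argmin
  rw [dif_pos h]
  exact h.choose_spec

/-- The distance to a minimiser is controlled by the excess of the residual (parallelogram
identity). -/
lemma IsMinimizer.norm_sub_sq_le {P : LeastSquares Y H Z} {Q : Set Y} (hconv : Convex ℝ Q) {z : Z}
    {y y' : Y} (hy : P.IsMinimizer Q z y) (hy' : y' ∈ Q) (hz' : P.L y' + P.c = z) :
    ‖P.G (y' - y)‖ ^ 2 ≤ 2 * (‖P.res y'‖ ^ 2 - ‖P.res y‖ ^ 2) := by
  set m : Y := (1 / 2 : ℝ) • y + (1 / 2 : ℝ) • y' with hm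
  have hmQ : m ∈ Q := hconv hy.mem hy' (by norm_num) (by norm_num) (by norm_num)
  have hmz : P.L m + P.c = z := by
    have e1 : P.L y = z - P.c := eq_sub_of_add_eq hy.eq
    have e2 : P.L y' = z - P.c := eq_sub_of_add_eq hz'
    rw [hm, map_add, map_smul, map_smul, e1, e2, ← add_smul]
    norm_num
  have h1 := hy.le m hmQ hmz
  have h2 : P.res y' + P.res y = (2 : ℝ) • P.res m := by
    simp only [res, hm, map_add, map_smul, smul_sub, smul_add, smul_smul]
    rw [two_smul ℝ P.b]
    norm_num
    abel
  have h3 : P.res y' - P.res y = P.G (y' - y) := by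
    simp only [res, map_sub]
    abel
  have h4 := parallelogram_law_with_norm ℝ (P.res y') (P.res y)
  rw [h2, h3, norm_smul, Real.norm_of_nonneg (by norm_num : (0 : ℝ) ≤ 2)] at h4
  have h5 : ‖P.res y‖ * ‖P.res y‖ ≤ ‖P.res m‖ * ‖P.res m‖ :=
    mul_self_le_mul_self (norm_nonneg _) h1
  nlinarith

lemma Regular.eq_of_isMinimizer {P : LeastSquares Y H Z} {Q : Set Y} {γ : ℝ} {R : Z →L[ℝ] Y}
    (hP : P.Regular Q γ R) (hconv : Convex ℝ Q) {z : Z} {y y' : Y} (hy : P.IsMinimizer Q z y)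
    (hy' : P.IsMinimizer Q z y') : y' = y := by
  have h1 := hy.norm_sub_sq_le hconv hy'.mem hy'.eq
  rw [le_antisymm (hy.le _ hy'.mem hy'.eq) (hy'.le _ hy.mem hy.eq), sub_self, mul_zero] at h1
  have h2 : ‖P.G (y' - y)‖ = 0 := by nlinarith [norm_nonneg (P.G (y' - y))]
  have h3 := hP.bound (y' - y)
  rw [h2] at h3
  have h4 : ‖y' - y‖ ≤ 0 := by
    by_contra hc
    exact absurd h3 (not_le.mpr (mul_pos hP.pos (not_le.mp hc)))
  exact sub_eq_zero.mp (norm_le_zero_iff.mp h4)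

open Asymptotics

lemma isBigO_clm_apply {ι A B : Type*} [NormedAddCommGroup A] [NormedSpace ℝ A]
    [NormedAddCommGroup B] [NormedSpace ℝ B] {F : Filter ι} {T : ι → A →L[ℝ] B} {x : ι → A}
    (hT : T =O[F] fun _ => (1 : ℝ)) (hx : x =O[F] fun _ => (1 : ℝ)) :
    (fun i => T i (x i)) =O[F] fun _ => (1 : ℝ) := by
  have h := hT.norm_left.mul hx.norm_left
  simp only [mul_one] at h
  refine IsBigO.trans (IsBigO.of_norm_le fun i => ?_) h
  simpa using (T i).le_opNorm (x i)

lemma isLittleO_clm_apply {ι A B : Type*} [NormedAddCommGroup A] [NormedSpace ℝ A]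
    [NormedAddCommGroup B] [NormedSpace ℝ B] {F : Filter ι} {T : ι → A →L[ℝ] B} {x : ι → A}
    (hT : T =O[F] fun _ => (1 : ℝ)) (hx : x =o[F] fun _ => (1 : ℝ)) :
    (fun i => T i (x i)) =o[F] fun _ => (1 : ℝ) := by
  have h := hT.norm_left.mul_isLittleO hx.norm_left
  simp only [mul_one] at h
  refine IsBigO.trans_isLittleO (IsBigO.of_norm_le fun i => ?_) h
  simpa using (T i).le_opNorm (x i)

lemma isLittleO_clm_apply' {ι A B : Type*} [NormedAddCommGroup A] [NormedSpace ℝ A]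
    [NormedAddCommGroup B] [NormedSpace ℝ B] {F : Filter ι} {T : ι → A →L[ℝ] B} {x : ι → A}
    (hT : T =o[F] fun _ => (1 : ℝ)) (hx : x =O[F] fun _ => (1 : ℝ)) :
    (fun i => T i (x i)) =o[F] fun _ => (1 : ℝ) := by
  have h := hT.norm_left.mul_isBigO hx.norm_left
  simp only [mul_one] at h
  refine IsBigO.trans_isLittleO (IsBigO.of_norm_le fun i => ?_) h
  simpa using (T i).le_opNorm (x i)

lemma isLittleO_sub_of_tendsto {ι E : Type*} [NormedAddCommGroup E] {F : Filter ι} {f : ι → E}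
    {e : E} (h : Tendsto f F (𝓝 e)) : (fun i => f i - e) =o[F] fun _ => (1 : ℝ) := by
  rw [isLittleO_one_iff, ← sub_self e]
  exact h.sub_const e

/-- Minimisers have bounded norm when the data, the right inverses and the parameters are
bounded. -/
lemma isBigO_minimizer {ι : Type*} {F : Filter ι} {P : ι → LeastSquares Y H Z} {Q : Set Y} {γ : ℝ}
    {R : ι → Z →L[ℝ] Y} {z : ι → Z} {y : ι → Y} (h0 : (0 : Y) ∈ Q)
    (hP : ∀ᶠ i in F, (P i).Regular Q γ (R i))
    (hc : (fun i => (P i).c) =O[F] fun _ => (1 : ℝ))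
    (hG : (fun i => (P i).G) =O[F] fun _ => (1 : ℝ))
    (hb : (fun i => (P i).b) =O[F] fun _ => (1 : ℝ)) (hR : R =O[F] fun _ => (1 : ℝ))
    (hz : z =O[F] fun _ => (1 : ℝ)) (hy : ∀ᶠ i in F, (P i).IsMinimizer Q (z i) (y i)) :
    y =O[F] fun _ => (1 : ℝ) := by
  have h1 : (fun i => (P i).G (R i (z i - (P i).c)) - (P i).b) =O[F] fun _ => (1 : ℝ) :=
    (isBigO_clm_apply hG (isBigO_clm_apply hR (hz.sub hc))).sub hb
  have h2 : (fun i => γ⁻¹ * (‖(P i).G (R i (z i - (P i).c)) - (P i).b‖ + ‖(P i).b‖)) =O[F]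
      fun _ => (1 : ℝ) := (h1.norm_left.add hb.norm_left).const_mul_left _
  refine IsBigO.trans (IsBigO.of_bound 1 ?_) h2
  filter_upwards [hP, hy] with i hi hyi
  have hγ := hi.pos
  rw [one_mul, Real.norm_of_nonneg (by positivity), ← div_eq_inv_mul, le_div_iff₀ hγ, mul_comm]
  have hm := hi.correct_mem h0 (z i)
  rw [map_zero, zero_add, zero_add] at hm
  have h3 := hyi.le _ hm.1 hm.2
  simp only [res] at h3
  have h4 : ‖(P i).G (y i)‖ ≤ ‖(P i).G (y i) - (P i).b‖ + ‖(P i).b‖ := by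
    simpa using norm_add_le ((P i).G (y i) - (P i).b) (P i).b
  linarith [hi.bound (y i)]

/-- Stability: minimisers of converging problems for parameters that approach each other approach
each other, and so do their residuals. -/
theorem tendsto_minimizer {ι : Type*} {F : Filter ι} {P : ι → LeastSquares Y H Z}
    {P₀ : LeastSquares Y H Z} {Q : Set Y} {γ : ℝ} {R : ι → Z →L[ℝ] Y} {R₀ : Z →L[ℝ] Y}
    (hconv : Convex ℝ Q) (h0 : (0 : Y) ∈ Q) (hP : ∀ᶠ i in F, (P i).Regular Q γ (R i))
    (hP₀ : P₀.Regular Q γ R₀) (hL : Tendsto (fun i => (P i).L) F (𝓝 P₀.L))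
    (hc : Tendsto (fun i => (P i).c) F (𝓝 P₀.c)) (hG : Tendsto (fun i => (P i).G) F (𝓝 P₀.G))
    (hb : Tendsto (fun i => (P i).b) F (𝓝 P₀.b)) (hR : R =O[F] fun _ => (1 : ℝ))
    {z z' : ι → Z} {y y' : ι → Y} (hz : z =O[F] fun _ => (1 : ℝ))
    (hzz : Tendsto (fun i => z i - z' i) F (𝓝 0))
    (hy : ∀ᶠ i in F, (P i).IsMinimizer Q (z i) (y i))
    (hy' : ∀ᶠ i in F, P₀.IsMinimizer Q (z' i) (y' i)) :
    Tendsto (fun i => y i - y' i) F (𝓝 0) ∧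
      Tendsto (fun i => ‖(P i).res (y i)‖ ^ 2 - ‖P₀.res (y' i)‖ ^ 2) F (𝓝 0) := by
  have hzz' : (fun i => z i - z' i) =o[F] fun _ => (1 : ℝ) := (isLittleO_one_iff ℝ).mpr hzz
  have hz' : z' =O[F] fun _ => (1 : ℝ) := by
    simpa using hz.sub hzz'.isBigO
  have hyO : y =O[F] fun _ => (1 : ℝ) :=
    isBigO_minimizer h0 hP (hc.isBigO_one ℝ) (hG.isBigO_one ℝ) (hb.isBigO_one ℝ) hR hz hy
  have hyO' : y' =O[F] fun _ => (1 : ℝ) :=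
    isBigO_minimizer (P := fun _ => P₀) (R := fun _ => R₀) h0 (Eventually.of_forall fun _ => hP₀)
      (tendsto_const_nhds.isBigO_one ℝ) (tendsto_const_nhds.isBigO_one ℝ) (tendsto_const_nhds.isBigO_one ℝ)
      (tendsto_const_nhds.isBigO_one ℝ) hz' hy'
  -- The points obtained by moving each minimiser to the other constraint set.
  set p : ι → Y := fun i => y' i + R i (z i - ((P i).L (y' i) + (P i).c)) with hp
  set p' : ι → Y := fun i => y i + R₀ (z' i - (P₀.L (y i) + P₀.c)) with hp'
  have hpy : (fun i => p i - y' i) =o[F] fun _ => (1 : ℝ) := by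
    have h1 : (fun i => R i ((z i - z' i) - ((P i).L - P₀.L) (y' i) - ((P i).c - P₀.c))) =o[F]
        fun _ => (1 : ℝ) :=
      isLittleO_clm_apply hR ((hzz'.sub (isLittleO_clm_apply' (isLittleO_sub_of_tendsto hL) hyO')).sub (isLittleO_sub_of_tendsto hc))
    refine h1.congr' ?_ EventuallyEq.rfl
    filter_upwards [hy'] with i hi
    simp only [hp, add_sub_cancel_left, sub_apply]
    congr 1
    rw [← hi.eq]
    abel
  have hpy' : (fun i => p' i - y i) =o[F] fun _ => (1 : ℝ) := by
    have h1 : (fun i => R₀ (((P i).L - P₀.L) (y i) + ((P i).c - P₀.c) - (z i - z' i))) =o[F]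
        fun _ => (1 : ℝ) :=
      isLittleO_clm_apply (T := fun _ => R₀) (tendsto_const_nhds.isBigO_one ℝ)
        (((isLittleO_clm_apply' (isLittleO_sub_of_tendsto hL) hyO).add (isLittleO_sub_of_tendsto hc)).sub hzz')
    refine h1.congr' ?_ EventuallyEq.rfl
    filter_upwards [hy] with i hi
    simp only [hp', add_sub_cancel_left, sub_apply]
    congr 1
    rw [← hi.eq]
    abel
  have hres : (fun i => (P i).res (p i) - P₀.res (y' i)) =o[F] fun _ => (1 : ℝ) := by
    have h1 : (fun i => (P i).G (p i - y' i) + ((P i).G - P₀.G) (y' i) - ((P i).b - P₀.b)) =o[F]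
        fun _ => (1 : ℝ) :=
      ((isLittleO_clm_apply (hG.isBigO_one ℝ) hpy).add (isLittleO_clm_apply' (isLittleO_sub_of_tendsto hG) hyO')).sub (isLittleO_sub_of_tendsto hb)
    refine h1.congr_left fun i => ?_
    simp only [res, map_sub, sub_apply]
    abel
  have hres' : (fun i => P₀.res (p' i) - (P i).res (y i)) =o[F] fun _ => (1 : ℝ) := by
    have h1 : (fun i => P₀.G (p' i - y i) - ((P i).G - P₀.G) (y i) + ((P i).b - P₀.b)) =o[F]
        fun _ => (1 : ℝ) :=
      ((isLittleO_clm_apply (T := fun _ => P₀.G) (tendsto_const_nhds.isBigO_one ℝ) hpy').sub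
        (isLittleO_clm_apply' (isLittleO_sub_of_tendsto hG) hyO)).add (isLittleO_sub_of_tendsto hb)
    refine h1.congr_left fun i => ?_
    simp only [res, map_sub, sub_apply]
    abel
  have hr0 : (fun i => P₀.res (y' i)) =O[F] fun _ => (1 : ℝ) :=
    (isBigO_clm_apply (T := fun _ => P₀.G) (tendsto_const_nhds.isBigO_one ℝ) hyO').sub
      (tendsto_const_nhds.isBigO_one ℝ)
  have hr1 : (fun i => P₀.res (p' i)) =O[F] fun _ => (1 : ℝ) := by
    have : p' =O[F] fun _ => (1 : ℝ) := by simpa using hpy'.isBigO.add hyO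
    exact (isBigO_clm_apply (T := fun _ => P₀.G) (tendsto_const_nhds.isBigO_one ℝ) this).sub
      (tendsto_const_nhds.isBigO_one ℝ)
  have hexcess : ∀ᶠ i in F, ‖P₀.res (p' i)‖ - ‖P₀.res (y' i)‖ ≤
      ‖P₀.res (p' i) - (P i).res (y i)‖ + ‖(P i).res (p i) - P₀.res (y' i)‖ := by
    filter_upwards [hP, hy, hy'] with i hi hyi hyi'
    have h1 := hi.correct_mem hyi'.mem (z i)
    have h2 := hyi.le _ h1.1 h1.2
    have h3 := norm_sub_norm_le (P₀.res (p' i)) ((P i).res (y i))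
    have h4 := norm_sub_norm_le ((P i).res (p i)) (P₀.res (y' i))
    linarith
  have hGo : (fun i => P₀.G (p' i - y' i)) =o[F] fun _ => (1 : ℝ) := by
    have hbd : (fun i => 2 * ((‖P₀.res (p' i) - (P i).res (y i)‖ +
        ‖(P i).res (p i) - P₀.res (y' i)‖) * (‖P₀.res (p' i)‖ + ‖P₀.res (y' i)‖))) =o[F]
        fun _ => (1 : ℝ) := by
      have := (hres'.norm_left.add hres.norm_left).mul_isBigO (hr1.norm_left.add hr0.norm_left)
      simp only [mul_one] at this
      exact this.const_mul_left 2
    have hsq : (fun i => ‖P₀.G (p' i - y' i)‖ ^ 2) =o[F] fun _ => (1 : ℝ) := by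
      refine IsBigO.trans_isLittleO (IsBigO.of_bound 1 ?_) hbd
      filter_upwards [hexcess, hy, hy'] with i hi hyi hyi'
      have h1 := hP₀.correct_mem hyi.mem (z' i)
      have h2 := hyi'.norm_sub_sq_le hconv h1.1 h1.2
      rw [one_mul, Real.norm_of_nonneg (by positivity), Real.norm_of_nonneg (by positivity)]
      refine h2.trans (mul_le_mul_of_nonneg_left ?_ (by norm_num))
      rw [sq_sub_sq, mul_comm]
      exact mul_le_mul_of_nonneg_right hi (by positivity)
    rw [isLittleO_one_iff] at hsq ⊢
    rw [tendsto_zero_iff_norm_tendsto_zero]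
    have := hsq.sqrt
    simpa [Real.sqrt_sq (norm_nonneg _)] using this
  have hpp : (fun i => p' i - y' i) =o[F] fun _ => (1 : ℝ) := by
    refine IsBigO.trans_isLittleO (IsBigO.of_bound γ⁻¹ (Eventually.of_forall fun i => ?_)) hGo
    rw [← div_eq_inv_mul, le_div_iff₀ hP₀.pos, mul_comm]
    exact hP₀.bound _
  have hyy : (fun i => y i - y' i) =o[F] fun _ => (1 : ℝ) := by
    refine (hpp.sub hpy').congr_left fun i => ?_
    abel
  refine ⟨(isLittleO_one_iff ℝ).mp hyy, (isLittleO_one_iff ℝ).mp ?_⟩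
  have hd : (fun i => (P i).res (y i) - P₀.res (y' i)) =o[F] fun _ => (1 : ℝ) := by
    have h1 : (fun i => P₀.G (p' i - y' i) - (P₀.res (p' i) - (P i).res (y i))) =o[F]
        fun _ => (1 : ℝ) := hGo.sub hres'
    refine h1.congr_left fun i => ?_
    simp only [res, map_sub]
    abel
  have hr2 : (fun i => (P i).res (y i)) =O[F] fun _ => (1 : ℝ) := by
    simpa using hd.isBigO.add hr0
  have h1 := (hr2.norm_left.add hr0.norm_left).mul_isLittleO hd.norm_left
  simp only [mul_one] at h1
  refine IsBigO.trans_isLittleO (IsBigO.of_bound 1 (Eventually.of_forall fun i => ?_)) h1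
  rw [one_mul, sq_sub_sq, norm_mul, Real.norm_of_nonneg (by positivity :
    0 ≤ ‖(P i).res (y i)‖ + ‖P₀.res (y' i)‖), norm_mul, Real.norm_of_nonneg (by positivity :
    0 ≤ ‖(P i).res (y i)‖ + ‖P₀.res (y' i)‖), norm_norm]
  exact mul_le_mul_of_nonneg_left (abs_norm_sub_norm_le _ _) (by positivity)

/-- The optimal value depends continuously on the parameter. -/
theorem Regular.continuous_value [CompleteSpace Y] [CompleteSpace H] {P : LeastSquares Y H Z}
    {Q : Set Y} {γ : ℝ} {R : Z →L[ℝ] Y} (hP : P.Regular Q γ R) (hconv : Convex ℝ Q)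
    (hclosed : IsClosed Q) (h0 : (0 : Y) ∈ Q) : Continuous (P.value Q) := by
  rw [continuous_iff_continuousAt]
  intro z₀
  have hex := fun z => argmin_spec (hP.exists_isMinimizer hconv hclosed h0 z)
  have h := (tendsto_minimizer (F := 𝓝 z₀) (P := fun _ => P) (P₀ := P) (R := fun _ => R)
    (z := fun z => z) (z' := fun _ => z₀) (y := fun z => P.argmin Q z)
    (y' := fun _ => P.argmin Q z₀) hconv h0 (Eventually.of_forall fun _ => hP) hP
    tendsto_const_nhds tendsto_const_nhds tendsto_const_nhds tendsto_const_nhds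
    (tendsto_const_nhds.isBigO_one ℝ) (tendsto_id.isBigO_one ℝ)
    (by simpa using (tendsto_id (x := 𝓝 z₀)).sub_const z₀)
    (Eventually.of_forall fun z => hex z) (Eventually.of_forall fun _ => hex z₀)).2
  have h2 := (h.add_const (‖P.res (P.argmin Q z₀)‖ ^ 2)).const_mul (1 / 2 : ℝ)
  simp only [sub_add_cancel, zero_add] at h2
  exact h2

/-- Uniform stability on bounded sets of parameters. -/
theorem eventually_argmin_close [CompleteSpace Y] [CompleteSpace H] {P : ℕ → LeastSquares Y H Z}
    {P₀ : LeastSquares Y H Z} {Q : Set Y} {γ : ℝ} {R : ℕ → Z →L[ℝ] Y} {R₀ : Z →L[ℝ] Y}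
    (hconv : Convex ℝ Q) (hclosed : IsClosed Q) (h0 : (0 : Y) ∈ Q)
    (hP : ∀ᶠ i in atTop, (P i).Regular Q γ (R i))
    (hP₀ : P₀.Regular Q γ R₀) (hL : Tendsto (fun i => (P i).L) atTop (𝓝 P₀.L))
    (hc : Tendsto (fun i => (P i).c) atTop (𝓝 P₀.c))
    (hG : Tendsto (fun i => (P i).G) atTop (𝓝 P₀.G))
    (hb : Tendsto (fun i => (P i).b) atTop (𝓝 P₀.b)) (hR : R =O[atTop] fun _ => (1 : ℝ))
    (ρ : ℝ) {η : ℝ} (hη : 0 < η) :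
    ∃ r > 0, ∀ᶠ N in atTop, ∀ z z' : Z, ‖z‖ ≤ ρ → ‖z - z'‖ ≤ r →
      ‖(P N).argmin Q z - P₀.argmin Q z'‖ ≤ η ∧ |(P N).value Q z - P₀.value Q z'| ≤ η := by
  by_contra hno
  push Not at hno
  have hbad : ∀ k : ℕ, ∃ N ≥ k, ∃ z z' : Z, ‖z‖ ≤ ρ ∧ ‖z - z'‖ ≤ 1 / ((k : ℝ) + 1) ∧
      ¬ (‖(P N).argmin Q z - P₀.argmin Q z'‖ ≤ η ∧ |(P N).value Q z - P₀.value Q z'| ≤ η) := by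
    intro k
    have h := hno (1 / ((k : ℝ) + 1)) (by positivity)
    rw [Filter.frequently_atTop] at h
    obtain ⟨N, hN, z, z', h1, h2, h3⟩ := h k
    exact ⟨N, hN, z, z', h1, h2, fun h4 => absurd (h3 h4.1) (not_lt.mpr h4.2)⟩
  choose N hN z z' hz hzz hneg using hbad
  have hNt : Tendsto N atTop atTop := tendsto_atTop_mono hN tendsto_id
  have hmin : ∀ᶠ k in atTop, (P (N k)).IsMinimizer Q (z k) ((P (N k)).argmin Q (z k)) :=
    (hNt.eventually hP).mono fun k hk =>
      argmin_spec (hk.exists_isMinimizer hconv hclosed h0 (z k))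
  have h := tendsto_minimizer (F := atTop) (P := fun k => P (N k)) (P₀ := P₀)
    (R := fun k => R (N k)) (R₀ := R₀) (z := z) (z' := z') hconv h0 (hNt.eventually hP) hP₀
    (hL.comp hNt) (hc.comp hNt) (hG.comp hNt) (hb.comp hNt) (hR.comp_tendsto hNt)
    (IsBigO.of_bound ρ (Eventually.of_forall fun k => by simpa using hz k))
    (squeeze_zero_norm hzz tendsto_one_div_add_atTop_nhds_zero_nat) hmin
    (Eventually.of_forall fun k =>
      argmin_spec (hP₀.exists_isMinimizer hconv hclosed h0 (z' k)))
  have e1 : ∀ᶠ k in atTop, ‖(P (N k)).argmin Q (z k) - P₀.argmin Q (z' k)‖ ≤ η :=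
    ((tendsto_zero_iff_norm_tendsto_zero.mp h.1).eventually (gt_mem_nhds hη)).mono
      fun _ h => h.le
  have e2 : ∀ᶠ k in atTop, |(P (N k)).value Q (z k) - P₀.value Q (z' k)| ≤ η := by
    refine ((tendsto_zero_iff_norm_tendsto_zero.mp h.2).eventually (gt_mem_nhds hη)).mono
      fun k hk => ?_
    simp only [value]
    rw [← mul_sub, abs_mul, abs_of_pos (by norm_num : (0 : ℝ) < 1 / 2)]
    rw [Real.norm_eq_abs] at hk
    linarith [abs_nonneg (‖(P (N k)).res ((P (N k)).argmin Q (z k))‖ ^ 2 -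
      ‖P₀.res (P₀.argmin Q (z' k))‖ ^ 2)]
  obtain ⟨k, h1, h2⟩ := (e1.and e2).exists
  exact hneg k ⟨h1, h2⟩

/-- Right inverses of `L` survive small perturbations of `L`. -/
lemma exists_perturbed_right_inverse {Z : Type*} [NormedAddCommGroup Z] [NormedSpace ℝ Z]
    [CompleteSpace Z] {L : ℕ → Y →L[ℝ] Z} {L₀ : Y →L[ℝ] Z}
    {R₀ : Z →L[ℝ] Y} (hR₀ : ∀ z, L₀ (R₀ z) = z) (hL : Tendsto L atTop (𝓝 L₀)) :
    ∃ S : ℕ → Z →L[ℝ] Z, Tendsto S atTop (𝓝 1) ∧ ∀ᶠ N in atTop, ∀ z, L N (R₀ (S N z)) = z := by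
  have hLR : Tendsto (fun N => (L N).comp R₀) atTop (𝓝 1) := by
    have h1 : L₀.comp R₀ = 1 := ContinuousLinearMap.ext hR₀
    rw [← h1]
    exact ((ContinuousLinearMap.compL ℝ Z Y Z).flip R₀).continuous.tendsto L₀ |>.comp hL
  refine ⟨fun N => Ring.inverse ((L N).comp R₀), ?_, ?_⟩
  · have h1 := (NormedRing.inverse_continuousAt (1 : (Z →L[ℝ] Z)ˣ)).tendsto
    rw [Units.val_one, Ring.inverse_one] at h1
    exact h1.comp hLR
  · have h1 : ∀ᶠ A in 𝓝 (1 : Z →L[ℝ] Z), IsUnit A := Units.isOpen.mem_nhds isUnit_one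
    filter_upwards [hLR.eventually h1] with N hN z
    have h2 := Ring.mul_inverse_cancel _ hN
    exact DFunLike.congr_fun h2 z

/-- Coercivity: for convergent problems, the parameter is bounded by the residual. -/
lemma exists_norm_le_residual {P : ℕ → LeastSquares Y H Z} {P₀ : LeastSquares Y H Z} {γ : ℝ}
    (hγ : 0 < γ) (hbd : ∀ᶠ i in atTop, ∀ y, γ * ‖y‖ ≤ ‖(P i).G y‖)
    (hL : Tendsto (fun i => (P i).L) atTop (𝓝 P₀.L))
    (hc : Tendsto (fun i => (P i).c) atTop (𝓝 P₀.c))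
    (hb : Tendsto (fun i => (P i).b) atTop (𝓝 P₀.b)) :
    ∃ C : ℝ, 0 < C ∧ ∀ᶠ i in atTop, ∀ y, ‖(P i).L y + (P i).c‖ ≤ C * (1 + ‖(P i).res y‖) := by
  set ℓ := ‖P₀.L‖ + 1 with hℓ
  set c := ‖P₀.c‖ + 1 with hcdef
  set b := ‖P₀.b‖ + 1 with hbdef
  have hℓ0 : 0 < ℓ := by positivity
  have hc0 : 0 < c := by positivity
  have hb0 : 0 < b := by positivity
  refine ⟨ℓ * γ⁻¹ * (1 + b) + c, by positivity, ?_⟩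
  filter_upwards [hbd, hL.norm.eventually (gt_mem_nhds (lt_add_one _)),
    hc.norm.eventually (gt_mem_nhds (lt_add_one _)),
    hb.norm.eventually (gt_mem_nhds (lt_add_one _))] with i h1 h2 h3 h4 y
  have h5 : ‖(P i).G y‖ ≤ ‖(P i).res y‖ + ‖(P i).b‖ := by
    simpa [res] using norm_add_le ((P i).G y - (P i).b) (P i).b
  have h6 : ‖y‖ ≤ γ⁻¹ * (‖(P i).res y‖ + b) := by
    rw [← div_eq_inv_mul, le_div_iff₀ hγ, mul_comm]
    linarith [h1 y]
  have h7 : ‖(P i).L y‖ ≤ ℓ * (γ⁻¹ * (‖(P i).res y‖ + b)) :=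
    ((P i).L.le_opNorm y).trans (mul_le_mul h2.le h6 (norm_nonneg _) hℓ0.le)
  have h8 : ‖(P i).L y + (P i).c‖ ≤ ℓ * (γ⁻¹ * (‖(P i).res y‖ + b)) + c :=
    (norm_add_le _ _).trans (add_le_add h7 h3.le)
  refine h8.trans ?_
  have hr := norm_nonneg ((P i).res y)
  have h9 : ℓ * (γ⁻¹ * (‖(P i).res y‖ + b)) ≤ ℓ * γ⁻¹ * (1 + b) * (1 + ‖(P i).res y‖) := by
    rw [mul_assoc, mul_assoc]
    refine mul_le_mul_of_nonneg_left (mul_le_mul_of_nonneg_left ?_ (inv_nonneg.mpr hγ.le)) hℓ0.le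
    nlinarith
  nlinarith [mul_nonneg hc0.le hr]

end LeastSquares

/-! ### Stability of global minimisers -/

/-- The minimisers of `f` over `S`. -/
def argminOn {X : Type*} (S : Set X) (f : X → ℝ) : Set X := {z | z ∈ S ∧ ∀ z' ∈ S, f z ≤ f z'}

lemma argminOn_nonempty {X : Type*} [NormedAddCommGroup X] [ProperSpace X] {S : Set X}
    {f : X → ℝ} (hS : IsClosed S) (hne : S.Nonempty) (hf : Continuous f)
    (hbd : ∀ m : ℝ, ∃ R : ℝ, ∀ z, f z ≤ m → ‖z‖ ≤ R) : (argminOn S f).Nonempty := by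
  obtain ⟨z₀, hz₀⟩ := hne
  obtain ⟨R, hR⟩ := hbd (f z₀)
  have hcomp : IsCompact (S ∩ {z | f z ≤ f z₀}) :=
    Metric.isCompact_of_isClosed_isBounded (hS.inter (isClosed_le hf continuous_const))
      (isBounded_iff_forall_norm_le.mpr ⟨R, fun z hz => hR z hz.2⟩)
  have hmem : z₀ ∈ S ∩ {z | f z ≤ f z₀} := ⟨hz₀, le_refl (f z₀)⟩
  obtain ⟨z, hz, hmin⟩ := hcomp.exists_isMinOn ⟨z₀, hmem⟩ hf.continuousOn
  refine ⟨z, hz.1, fun z' hz' => ?_⟩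
  by_cases h : f z' ≤ f z₀
  · exact hmin ⟨hz', h⟩
  · exact (hmin hmem : f z ≤ f z₀).trans (le_of_not_ge h)

/-- A cost that decreases at most linearly plus half the square of a quantity that bounds the norm
has bounded sublevel sets; the bound depends only on the constants. -/
lemma exists_sublevel_bound (a b C m : ℝ) (hb : 0 ≤ b) (hC : 0 < C) :
    ∃ R : ℝ, ∀ x φ r : ℝ, 0 ≤ r → -(a + b * x) ≤ φ → x ≤ C * (1 + r) → φ + 1 / 2 * r ^ 2 ≤ m →
      x ≤ R := by
  set k := 2 * (m + a + b * C) with hk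
  refine ⟨C * (1 + (1 + |k| + 2 * b * C)), fun x φ r hr hφ hx hm => hx.trans ?_⟩
  refine mul_le_mul_of_nonneg_left (by
    have h1 : r ^ 2 ≤ k + 2 * b * C * r := by nlinarith [mul_le_mul_of_nonneg_left hx hb]
    by_contra hc
    push Not at hc
    have hbC : 0 ≤ 2 * b * C := by positivity
    nlinarith [le_abs_self k, abs_nonneg k, mul_nonneg hbC hr]) hC.le

/-- Costs `Φ + v` under the constraint `ρ = 0`, approximated by costs `Φs ν + vs N` under the
constraint `ρs ν ≤ ε`. All convergence is uniform on bounded sets; the functions `v` are half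
the squares of functions of linear growth, while `Φ` decreases at most linearly. -/
structure StableMinimization {X : Type*} [NormedAddCommGroup X] (Φ ρ v : X → ℝ)
    (Φs ρs vs : ℕ → X → ℝ) : Prop where
  cont : Continuous Φ
  cont_constraint : Continuous ρ
  cont_value : Continuous v
  nonneg : ∀ z, 0 ≤ ρ z
  feasible : ∃ z, ρ z = 0
  cont_seq : ∀ ν, Continuous (Φs ν)
  cont_constraint_seq : ∀ ν, Continuous (ρs ν)
  cont_value_seq : ∀ᶠ N in atTop, Continuous (vs N)
  tendsto : ∀ R η : ℝ, 0 < η → ∀ᶠ ν in atTop, ∀ z, ‖z‖ ≤ R → |Φs ν z - Φ z| ≤ η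
  tendsto_constraint : ∀ R η : ℝ, 0 < η → ∀ᶠ ν in atTop, ∀ z, ‖z‖ ≤ R → |ρs ν z - ρ z| ≤ η
  tendsto_value : ∀ R η : ℝ, 0 < η → ∀ᶠ N in atTop, ∀ z, ‖z‖ ≤ R → |vs N z - v z| ≤ η
  lower : ∃ a b : ℝ, 0 ≤ b ∧ (∀ z, -(a + b * ‖z‖) ≤ Φ z) ∧
    ∀ᶠ ν in atTop, ∀ z, -(a + b * ‖z‖) ≤ Φs ν z
  coercive : ∃ C : ℝ, 0 < C ∧ (∀ z, ∃ r, 0 ≤ r ∧ v z = 1 / 2 * r ^ 2 ∧ ‖z‖ ≤ C * (1 + r)) ∧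
    ∀ᶠ N in atTop, ∀ z, ∃ r, 0 ≤ r ∧ vs N z = 1 / 2 * r ^ 2 ∧ ‖z‖ ≤ C * (1 + r)

namespace StableMinimization

variable {X : Type*} [NormedAddCommGroup X] {Φ ρ v : X → ℝ} {Φs ρs vs : ℕ → X → ℝ}

lemma exists_bound (h : StableMinimization Φ ρ v Φs ρs vs) (m : ℝ) :
    ∃ R : ℝ, (∀ z, Φ z + v z ≤ m → ‖z‖ ≤ R) ∧
      ∀ᶠ ν in atTop, ∀ᶠ N in atTop, ∀ z, Φs ν z + vs N z ≤ m → ‖z‖ ≤ R := by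
  obtain ⟨a, b, hb, h1, h2⟩ := h.lower
  obtain ⟨C, hC, h3, h4⟩ := h.coercive
  obtain ⟨R, hR⟩ := exists_sublevel_bound a b C m hb hC
  refine ⟨R, fun z hz => ?_, ?_⟩
  · obtain ⟨r, hr, hv, hzr⟩ := h3 z
    rw [hv] at hz
    exact hR _ _ _ hr (h1 z) hzr hz
  · filter_upwards [h2] with ν hν
    filter_upwards [h4] with N hN z hz
    obtain ⟨r, hr, hv, hzr⟩ := hN z
    rw [hv] at hz
    exact hR _ _ _ hr (hν z) hzr hz

variable [ProperSpace X]

theorem argmin_nonempty (h : StableMinimization Φ ρ v Φs ρs vs) :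
    (argminOn {z | ρ z = 0} fun z => Φ z + v z).Nonempty :=
  argminOn_nonempty (isClosed_eq h.cont_constraint continuous_const) h.feasible
    (h.cont.add h.cont_value) fun m => (h.exists_bound m).imp fun _ hR => hR.1

theorem argmin_seq_nonempty (h : StableMinimization Φ ρ v Φs ρs vs) {ε : ℝ} (hε : 0 < ε) :
    ∀ᶠ ν in atTop, ∀ᶠ N in atTop,
      (argminOn {z | ρs ν z ≤ ε} fun z => Φs ν z + vs N z).Nonempty := by
  obtain ⟨z₀, hz₀⟩ := h.feasible
  obtain ⟨a, b, hb, -, h2⟩ := h.lower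
  obtain ⟨C, hC, -, h4⟩ := h.coercive
  filter_upwards [h.tendsto_constraint ‖z₀‖ ε hε, h2] with ν hν hlow
  filter_upwards [h.cont_value_seq, h4] with N hN hN4
  refine argminOn_nonempty (isClosed_le (h.cont_constraint_seq ν) continuous_const) ⟨z₀, ?_⟩
    ((h.cont_seq ν).add hN) fun m => ?_
  · have h5 := hν z₀ le_rfl
    rw [hz₀, sub_zero] at h5
    exact (le_abs_self _).trans h5
  · obtain ⟨R, hR⟩ := exists_sublevel_bound a b C m hb hC
    refine ⟨R, fun z hz => ?_⟩
    obtain ⟨r, hr, hv, hzr⟩ := hN4 z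
    rw [hv] at hz
    exact hR _ _ _ hr (hlow z) hzr hz

/-- Near-feasible and near-optimal points are close to the set of minimisers. -/
lemma exists_near_argmin (h : StableMinimization Φ ρ v Φs ρs vs) {z₀ : X}
    (hz₀ : z₀ ∈ argminOn {z | ρ z = 0} fun z => Φ z + v z) {η : ℝ} (hη : 0 < η) :
    ∃ ε₀ : ℝ, 0 < ε₀ ∧ ε₀ ≤ 1 ∧ ∀ z, ρ z ≤ 2 * ε₀ → Φ z + v z ≤ Φ z₀ + v z₀ + ε₀ →
      ∃ z' ∈ argminOn {z | ρ z = 0} (fun z => Φ z + v z), ‖z - z'‖ ≤ η := by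
  by_contra hno
  push Not at hno
  have hrate : Tendsto (fun k : ℕ => 1 / ((k : ℝ) + 1)) atTop (𝓝 0) :=
    tendsto_one_div_add_atTop_nhds_zero_nat
  have hrate1 : ∀ k : ℕ, 1 / ((k : ℝ) + 1) ≤ 1 := fun k => by
    rw [div_le_one (by positivity)]
    linarith [k.cast_nonneg (α := ℝ)]
  choose z hz1 hz2 hz3 using fun k : ℕ => hno (1 / ((k : ℝ) + 1)) (by positivity) (hrate1 k)
  obtain ⟨R, hR, -⟩ := h.exists_bound (Φ z₀ + v z₀ + 1)
  obtain ⟨z', -, φ, hφ, hlim⟩ := tendsto_subseq_of_bounded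
    (isBounded_iff_forall_norm_le.mpr ⟨R, by
      rintro _ ⟨k, rfl⟩
      exact hR (z k) ((hz2 k).trans (by linarith [hrate1 k]))⟩ :
      Bornology.IsBounded (Set.range z)) (x := z) (fun k => ⟨k, rfl⟩)
  have hrate' := hrate.comp hφ.tendsto_atTop
  have e1 : ρ z' ≤ 0 := by
    have h1 := hrate'.const_mul 2
    rw [mul_zero] at h1
    exact le_of_tendsto_of_tendsto' ((h.cont_constraint.tendsto z').comp hlim) h1
      fun k => hz1 (φ k)
  have e2 : Φ z' + v z' ≤ Φ z₀ + v z₀ := by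
    have h1 := hrate'.const_add (Φ z₀ + v z₀)
    rw [add_zero] at h1
    exact le_of_tendsto_of_tendsto' (((h.cont.add h.cont_value).tendsto z').comp hlim) h1
      fun k => hz2 (φ k)
  have hmem : z' ∈ argminOn {z | ρ z = 0} fun z => Φ z + v z :=
    ⟨le_antisymm e1 (h.nonneg z'), fun y hy => e2.trans (hz₀.2 y hy)⟩
  have h2 : Tendsto (fun k => ‖z (φ k) - z'‖) atTop (𝓝 0) :=
    tendsto_iff_norm_sub_tendsto_zero.mp hlim
  obtain ⟨k, hk⟩ := (h2.eventually (gt_mem_nhds hη)).exists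
  exact absurd hk (not_lt.mpr (hz3 (φ k) z' hmem).le)

theorem argmin_close (h : StableMinimization Φ ρ v Φs ρs vs) :
    ∃ R : ℝ, ∀ η : ℝ, 0 < η → ∃ ε₀ : ℝ, 0 < ε₀ ∧ ∀ ε : ℝ, 0 < ε → ε ≤ ε₀ →
      ∀ᶠ ν in atTop, ∀ᶠ N in atTop,
        ∀ z ∈ argminOn {z | ρs ν z ≤ ε} (fun z => Φs ν z + vs N z), ‖z‖ ≤ R ∧
          ∃ z' ∈ argminOn {z | ρ z = 0} (fun z => Φ z + v z), ‖z - z'‖ ≤ η := by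
  obtain ⟨z₀, hz₀⟩ := h.argmin_nonempty
  obtain ⟨R, hR, hRs⟩ := h.exists_bound (Φ z₀ + v z₀ + 1)
  have hz₀R : ‖z₀‖ ≤ R := hR z₀ (by linarith)
  refine ⟨R, fun η hη => ?_⟩
  obtain ⟨ε₀, hε₀, hε₁, hnear⟩ := h.exists_near_argmin hz₀ hη
  refine ⟨ε₀, hε₀, fun ε hε hle => ?_⟩
  filter_upwards [hRs, h.tendsto R (ε₀ / 4) (by linarith), h.tendsto_constraint R ε hε]
    with ν hν1 hν2 hν3
  filter_upwards [hν1, h.tendsto_value R (ε₀ / 4) (by linarith)] with N hN1 hN2 z hz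
  have hzz₀ : Φs ν z + vs N z ≤ Φs ν z₀ + vs N z₀ := hz.2 z₀ (by
    have h1 := hν3 z₀ hz₀R
    have h2 : ρ z₀ = 0 := hz₀.1
    rw [h2, sub_zero] at h1
    exact (le_abs_self _).trans h1)
  have a1 := abs_le.mp (hν2 z₀ hz₀R)
  have a2 := abs_le.mp (hN2 z₀ hz₀R)
  have hzR : ‖z‖ ≤ R := hN1 z (by linarith)
  have a3 := abs_le.mp (hν2 z hzR)
  have a4 := abs_le.mp (hN2 z hzR)
  have a5 := abs_le.mp (hν3 z hzR)
  have hzε : ρs ν z ≤ ε := hz.1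
  exact ⟨hzR, hnear z (by linarith) (by linarith)⟩

end StableMinimization

/-! ### Operators on `L²(0,T)` -/

/-- Multiplication by a matrix, as a continuous linear map. -/
def mulVL {a b : ℕ} (A : Matrix (Fin a) (Fin b) ℝ) : Vec b →L[ℝ] Vec a :=
  LinearMap.toContinuousLinearMap (Matrix.toLpLin 2 2 A)

lemma mulVL_apply {a b : ℕ} (A : Matrix (Fin a) (Fin b) ℝ) (v : Vec b) : mulVL A v = mulV A v :=
  rfl

/-- Pointwise multiplication by a matrix on `L²(0,T)`. -/
def matL (T : ℝ) {a b : ℕ} (A : Matrix (Fin a) (Fin b) ℝ) : L2 T b →L[ℝ] L2 T a :=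
  (mulVL A).compLpL 2 (timeMeasure T)

lemma coeFn_matL {T : ℝ} {a b : ℕ} (A : Matrix (Fin a) (Fin b) ℝ) (v : L2 T b) :
    ∀ᵐ t ∂timeMeasure T, matL T A v t = mulV A (v t) :=
  (mulVL A).coeFn_compLpL v

lemma mulV_mul {a b c : ℕ} (A : Matrix (Fin a) (Fin b) ℝ) (B : Matrix (Fin b) (Fin c) ℝ)
    (v : Vec c) : mulV (A * B) v = mulV A (mulV B v) := by
  simp [mulV, Matrix.mulVec_mulVec]

lemma mulV_one {a : ℕ} (v : Vec a) : mulV (1 : Matrix (Fin a) (Fin a) ℝ) v = v := by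
  simp [mulV]

lemma matL_mul {T : ℝ} {a b c : ℕ} (A : Matrix (Fin a) (Fin b) ℝ) (B : Matrix (Fin b) (Fin c) ℝ)
    (v : L2 T c) : matL T (A * B) v = matL T A (matL T B v) := by
  refine Lp.ext ?_
  filter_upwards [coeFn_matL (A * B) v, coeFn_matL B v, coeFn_matL A (matL T B v)]
    with t h1 h2 h3
  rw [h1, h3, h2, mulV_mul]

lemma matL_one {T : ℝ} {a : ℕ} (v : L2 T a) : matL T (1 : Matrix (Fin a) (Fin a) ℝ) v = v := by
  refine Lp.ext ?_
  filter_upwards [coeFn_matL (1 : Matrix (Fin a) (Fin a) ℝ) v] with t h1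
  rw [h1, mulV_one]

lemma matL_add {T : ℝ} {a b : ℕ} (A B : Matrix (Fin a) (Fin b) ℝ) (v : L2 T b) :
    matL T (A + B) v = matL T A v + matL T B v := by
  refine Lp.ext ?_
  filter_upwards [coeFn_matL (A + B) v, coeFn_matL A v, coeFn_matL B v,
    Lp.coeFn_add (matL T A v) (matL T B v)] with t h1 h2 h3 h4
  rw [h1, h4, Pi.add_apply, h2, h3]
  simp [mulV, Matrix.add_mulVec]

lemma matL_zero {T : ℝ} {a b : ℕ} (v : L2 T b) :
    matL T (0 : Matrix (Fin a) (Fin b) ℝ) v = 0 := by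
  refine Lp.ext ?_
  filter_upwards [coeFn_matL (0 : Matrix (Fin a) (Fin b) ℝ) v,
    Lp.coeFn_zero (Vec a) 2 (timeMeasure T)] with t h1 h2
  rw [h1, h2]
  simp [mulV]

instance isFiniteMeasure_timeMeasure (T : ℝ) : IsFiniteMeasure (timeMeasure T) :=
  ⟨by simp [timeMeasure, Real.volume_Ioo]⟩

lemma integrable_L2 {T : ℝ} {k : ℕ} (v : L2 T k) : Integrable v (timeMeasure T) :=
  (Lp.memLp v).integrable one_le_two

lemma norm_setIntegral_L2_le {T : ℝ} {k : ℕ} {S : Set ℝ} (hS : MeasurableSet S) (v : L2 T k) :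
    ‖∫ t in S, v t ∂timeMeasure T‖ ≤ √((timeMeasure T).real S) * ‖v‖ := by
  set c := ∫ t in S, v t ∂timeMeasure T with hc
  have h1 := L2.inner_indicatorConstLp_eq_inner_setIntegral ℝ hS
    (measure_ne_top (timeMeasure T) S) c v
  rw [← hc, real_inner_self_eq_norm_sq] at h1
  have h2 := (le_abs_self _).trans (abs_real_inner_le_norm
    (indicatorConstLp 2 hS (measure_ne_top (timeMeasure T) S) c) v)
  rw [h1, norm_indicatorConstLp (by norm_num) (by norm_num)] at h2
  have h3 : (timeMeasure T).real S ^ (1 / (2 : ℝ≥0∞).toReal) = √((timeMeasure T).real S) := by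
    rw [Real.sqrt_eq_rpow]
    norm_num
  rw [h3] at h2
  by_cases h0 : ‖c‖ = 0
  · rw [h0]
    positivity
  · have hpos : 0 < ‖c‖ := lt_of_le_of_ne (norm_nonneg _) (Ne.symm h0)
    refine le_of_mul_le_mul_left ?_ hpos
    linarith

/-- Integration over a measurable set. -/
def setIntL (T : ℝ) {k : ℕ} (S : Set ℝ) (hS : MeasurableSet S) : L2 T k →L[ℝ] Vec k :=
  LinearMap.mkContinuous
    { toFun := fun v => ∫ t in S, v t ∂timeMeasure T
      map_add' := fun v w => by
        rw [← integral_add (integrable_L2 v).integrableOn (integrable_L2 w).integrableOn]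
        exact integral_congr_ae (ae_restrict_of_ae (Lp.coeFn_add v w))
      map_smul' := fun c v => by
        rw [RingHom.id_apply, ← integral_smul]
        exact integral_congr_ae (ae_restrict_of_ae (Lp.coeFn_smul c v)) }
    (√((timeMeasure T).real S)) fun v => norm_setIntegral_L2_le hS v

lemma setIntL_apply {T : ℝ} {k : ℕ} {S : Set ℝ} (hS : MeasurableSet S) (v : L2 T k) :
    setIntL T S hS v = ∫ t in S, v t ∂timeMeasure T := rfl

lemma setIntL_matL {T : ℝ} {a b : ℕ} {S : Set ℝ} (hS : MeasurableSet S)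
    (A : Matrix (Fin a) (Fin b) ℝ) (v : L2 T b) :
    setIntL T S hS (matL T A v) = mulV A (setIntL T S hS v) := by
  rw [setIntL_apply, setIntL_apply, ← mulVL_apply,
    ← (mulVL A).integral_comp_comm (integrable_L2 v).integrableOn]
  exact integral_congr_ae (ae_restrict_of_ae (coeFn_matL A v))

/-- The integral over `(0,T)`. -/
def intL (T : ℝ) {k : ℕ} : L2 T k →L[ℝ] Vec k := setIntL T univ MeasurableSet.univ

/-- The primitive `t ↦ ∫₀ᵗ v` of a square integrable function (constant outside `[0,T]`). -/
def prim {T : ℝ} {k : ℕ} (v : L2 T k) (t : ℝ) : Vec k := setIntL T (Iic t) measurableSet_Iic v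

lemma timeMeasure_real_le (T : ℝ) (hT : 0 ≤ T) (S : Set ℝ) : (timeMeasure T).real S ≤ T := by
  refine (measureReal_mono (subset_univ S)).trans_eq ?_
  simp [measureReal_def, timeMeasure, Real.volume_Ioo, hT]

lemma norm_prim_le {T : ℝ} (hT : 0 ≤ T) {k : ℕ} (v : L2 T k) (t : ℝ) : ‖prim v t‖ ≤ √T * ‖v‖ :=
  (norm_setIntegral_L2_le measurableSet_Iic v).trans
    (mul_le_mul_of_nonneg_right (Real.sqrt_le_sqrt (timeMeasure_real_le T hT _)) (norm_nonneg _))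

lemma prim_sub_prim {T : ℝ} {k : ℕ} (v : L2 T k) {s t : ℝ} (h : s ≤ t) :
    prim v t - prim v s = setIntL T (Ioc s t) measurableSet_Ioc v := by
  have h1 := setIntegral_union (μ := timeMeasure T) (f := fun t => v t) (s := Iic s) (t := Ioc s t)
    (Set.disjoint_left.mpr fun x hx hx' => not_lt.mpr hx hx'.1) measurableSet_Ioc
    (integrable_L2 v).integrableOn (integrable_L2 v).integrableOn
  rw [Iic_union_Ioc_eq_Iic h] at h1
  simp only [prim, setIntL_apply, h1, add_sub_cancel_left]

lemma norm_prim_sub_le_of_le {T : ℝ} {k : ℕ} (v : L2 T k) {s t : ℝ} (h : s ≤ t) :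
    ‖prim v t - prim v s‖ ≤ √(t - s) * ‖v‖ := by
  rw [prim_sub_prim v h]
  refine (norm_setIntegral_L2_le measurableSet_Ioc v).trans
    (mul_le_mul_of_nonneg_right (Real.sqrt_le_sqrt ?_) (norm_nonneg _))
  rw [measureReal_def, timeMeasure, Measure.restrict_apply measurableSet_Ioc]
  refine ENNReal.toReal_le_of_le_ofReal (by linarith) ((measure_mono inter_subset_left).trans ?_)
  rw [Real.volume_Ioc]

lemma norm_prim_sub_le {T : ℝ} {k : ℕ} (v : L2 T k) (s t : ℝ) :
    ‖prim v t - prim v s‖ ≤ √|t - s| * ‖v‖ := by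
  rcases le_total s t with h | h
  · rw [abs_of_nonneg (by linarith)]
    exact norm_prim_sub_le_of_le v h
  · rw [norm_sub_rev, abs_sub_comm, abs_of_nonneg (by linarith)]
    exact norm_prim_sub_le_of_le v h

lemma continuous_prim {T : ℝ} {k : ℕ} (v : L2 T k) : Continuous (prim v) := by
  rw [continuous_iff_continuousAt]
  intro s
  rw [ContinuousAt, tendsto_iff_norm_sub_tendsto_zero]
  have h : Tendsto (fun t : ℝ => √|t - s| * ‖v‖) (𝓝 s) (𝓝 (√|s - s| * ‖v‖)) :=
    Continuous.tendsto (by fun_prop) s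
  rw [sub_self, abs_zero, Real.sqrt_zero, zero_mul] at h
  exact squeeze_zero (fun t => norm_nonneg _) (fun t => norm_prim_sub_le v s t) h

lemma prim_of_nonpos {T : ℝ} {k : ℕ} (v : L2 T k) {t : ℝ} (ht : t ≤ 0) : prim v t = 0 := by
  rw [prim, setIntL_apply, Measure.restrict_restrict measurableSet_Iic]
  have : Iic t ∩ Ioo 0 T = ∅ := by
    ext x
    simp only [mem_inter_iff, mem_Iic, mem_Ioo, mem_empty_iff_false, iff_false, not_and]
    intro h1 h2
    linarith
  simp [this]

lemma prim_of_ge {T : ℝ} {k : ℕ} (v : L2 T k) {t : ℝ} (ht : T ≤ t) : prim v t = intL T v := by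
  rw [prim, intL, setIntL_apply, setIntL_apply,
    Measure.restrict_restrict measurableSet_Iic, Measure.restrict_restrict MeasurableSet.univ,
    univ_inter]
  congr 2
  ext x
  simp only [mem_inter_iff, mem_Iic, mem_Ioo, and_iff_right_iff_imp]
  intro h
  linarith

lemma memLp_prim_comp {T : ℝ} (hT : 0 ≤ T) {k : ℕ} (v : L2 T k) {θ : ℝ → ℝ} (hθ : Measurable θ) :
    MemLp (fun t => prim v (θ t)) 2 (timeMeasure T) :=
  MemLp.of_bound ((continuous_prim v).measurable.comp hθ).aestronglyMeasurable (√T * ‖v‖)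
    (Eventually.of_forall fun _ => norm_prim_le hT v _)

lemma norm_L2_le_of_ae_bound {T : ℝ} (hT : 0 ≤ T) {k : ℕ} (v : L2 T k) {C : ℝ} (hC : 0 ≤ C)
    (h : ∀ᵐ t ∂timeMeasure T, ‖v t‖ ≤ C) : ‖v‖ ≤ √T * C := by
  refine (Lp.norm_le_of_ae_bound hC h).trans_eq ?_
  congr 1
  rw [Real.sqrt_eq_rpow]
  have : ((measureUnivNNReal (timeMeasure T) : NNReal) : ℝ) = T := by
    have h2 : ((measureUnivNNReal (timeMeasure T) : NNReal) : ℝ) =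
      ((timeMeasure T) univ).toReal := rfl
    rw [h2]
    simp [timeMeasure, Real.volume_Ioo, hT]
  rw [this]
  norm_num

/-- The delayed Volterra operator `v ↦ (t ↦ ∫₀^{θ(t)} v)`. The case `θ = id` is integration, and
rounding `t` up to the next grid point gives its implicit Euler discretisation. -/
def volterra (T : ℝ) (hT : 0 ≤ T) {k : ℕ} (θ : ℝ → ℝ) (hθ : Measurable θ) :
    L2 T k →L[ℝ] L2 T k :=
  LinearMap.mkContinuous
    { toFun := fun v => (memLp_prim_comp hT v hθ).toLp _
      map_add' := fun v w => by
        rw [← MemLp.toLp_add]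
        refine MemLp.toLp_congr _ _ (Eventually.of_forall fun t => ?_)
        simp [prim]
      map_smul' := fun c v => by
        rw [RingHom.id_apply, ← MemLp.toLp_const_smul]
        refine MemLp.toLp_congr _ _ (Eventually.of_forall fun t => ?_)
        simp [prim] }
    (√T * √T) fun v => by
      rw [mul_assoc]
      refine norm_L2_le_of_ae_bound hT _ (by positivity) ?_
      filter_upwards [MemLp.coeFn_toLp (memLp_prim_comp hT v hθ)] with t ht
      change ‖(memLp_prim_comp hT v hθ).toLp _ t‖ ≤ _
      rw [ht]
      exact norm_prim_le hT v _

lemma coeFn_volterra {T : ℝ} (hT : 0 ≤ T) {k : ℕ} {θ : ℝ → ℝ} (hθ : Measurable θ) (v : L2 T k) :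
    ∀ᵐ t ∂timeMeasure T, volterra T hT θ hθ v t = prim v (θ t) :=
  MemLp.coeFn_toLp (memLp_prim_comp hT v hθ)

lemma norm_volterra_sub_le {T : ℝ} (hT : 0 ≤ T) {k : ℕ} {θ θ' : ℝ → ℝ} (hθ : Measurable θ)
    (hθ' : Measurable θ') {h : ℝ} (hh : ∀ t, |θ t - θ' t| ≤ h) :
    ‖(volterra T hT θ hθ : L2 T k →L[ℝ] L2 T k) - volterra T hT θ' hθ'‖ ≤ √T * √h := by
  refine ContinuousLinearMap.opNorm_le_bound _ (by positivity) fun v => ?_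
  rw [mul_assoc]
  refine norm_L2_le_of_ae_bound hT _ (by positivity) ?_
  filter_upwards [coeFn_volterra hT hθ v, coeFn_volterra hT hθ' v,
    Lp.coeFn_sub (volterra T hT θ hθ v) (volterra T hT θ' hθ' v)] with t h1 h2 h3
  rw [sub_apply, h3, Pi.sub_apply, h1, h2]
  exact (norm_prim_sub_le v _ _).trans
    (mul_le_mul_of_nonneg_right (Real.sqrt_le_sqrt (hh t)) (norm_nonneg _))

/-- The iterates of `v ↦ ∫₀ᵗ A v` decay factorially. -/
lemma norm_pow_volterra_apply_le {T : ℝ} (hT : 0 ≤ T) {k : ℕ} (A : Matrix (Fin k) (Fin k) ℝ)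
    (j : ℕ) (v : L2 T k) :
    ∀ᵐ t ∂timeMeasure T, ‖(((volterra T hT id measurable_id).comp (matL T A)) ^ (j + 1)) v t‖ ≤
      ‖mulVL A‖ ^ (j + 1) * (√T * ‖v‖) * (t ^ j / j.factorial) := by
  set K : L2 T k →L[ℝ] L2 T k := (volterra T hT id measurable_id).comp (matL T A) with hK
  induction j with
  | zero =>
    filter_upwards [coeFn_volterra hT measurable_id (matL T A v)] with t ht
    rw [zero_add, pow_one, pow_one, hK, ContinuousLinearMap.comp_apply, ht]
    refine (norm_prim_le hT _ _).trans ?_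
    have h1 : ‖matL T A v‖ ≤ ‖mulVL A‖ * ‖v‖ :=
      ((matL T A).le_opNorm v).trans
        (mul_le_mul_of_nonneg_right (ContinuousLinearMap.norm_compLpL_le _) (norm_nonneg _))
    calc √T * ‖matL T A v‖ ≤ √T * (‖mulVL A‖ * ‖v‖) :=
          mul_le_mul_of_nonneg_left h1 (Real.sqrt_nonneg _)
      _ = _ := by simp; ring
  | succ j ih =>
    set u := (K ^ (j + 1)) v with hu
    have hpow : (K ^ (j + 1 + 1)) v = K u := by
      rw [pow_succ' K (j + 1)]
      rfl
    rw [hpow]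
    filter_upwards [coeFn_volterra hT measurable_id (matL T A u),
      ae_restrict_mem (measurableSet_Ioo : MeasurableSet (Ioo (0 : ℝ) T))] with t ht htT
    rw [hK, ContinuousLinearMap.comp_apply, ht, prim, setIntL_apply, id]
    have hset : (timeMeasure T).restrict (Iic t) = volume.restrict (Ioc 0 t) := by
      rw [timeMeasure, Measure.restrict_restrict measurableSet_Iic]
      congr 1
      ext x
      simp only [mem_inter_iff, mem_Iic, mem_Ioo, mem_Ioc]
      exact ⟨fun h => ⟨h.2.1, h.1⟩, fun h => ⟨h.2, h.1, h.2.trans_lt htT.2⟩⟩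
    set c := ‖mulVL A‖ ^ (j + 1 + 1) * (√T * ‖v‖) with hc
    have hbound : ∀ᵐ s ∂(timeMeasure T).restrict (Iic t),
        ‖matL T A u s‖ ≤ c * (s ^ j / j.factorial) := by
      refine ae_restrict_of_ae ?_
      filter_upwards [ih, coeFn_matL A u] with s hs hs'
      rw [hs', ← mulVL_apply]
      refine ((mulVL A).le_opNorm _).trans
        ((mul_le_mul_of_nonneg_left hs (norm_nonneg _)).trans_eq ?_)
      rw [hc]
      ring
    have hint : Integrable (fun s : ℝ => c * (s ^ j / j.factorial))
        ((timeMeasure T).restrict (Iic t)) := by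
      rw [hset]
      exact (Continuous.integrableOn_Icc (by fun_prop)).mono_set Ioc_subset_Icc_self
    refine (norm_integral_le_of_norm_le hint hbound).trans_eq ?_
    rw [hset, ← intervalIntegral.integral_of_le htT.1.le, intervalIntegral.integral_const_mul,
      intervalIntegral.integral_div, integral_pow]
    rw [Nat.factorial_succ]
    push_cast
    field_simp
    ring

/-- `1 - ∫₀ᵗ A` is invertible: the linear differential equation is uniquely solvable. -/
theorem isUnit_one_sub_volterra {T : ℝ} (hT : 0 ≤ T) {k : ℕ} (A : Matrix (Fin k) (Fin k) ℝ) :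
    IsUnit (1 - (volterra T hT id measurable_id).comp (matL T A) : L2 T k →L[ℝ] L2 T k) := by
  set K : L2 T k →L[ℝ] L2 T k := (volterra T hT id measurable_id).comp (matL T A) with hK
  obtain ⟨j, hj⟩ : ∃ j : ℕ, ‖K ^ (j + 1)‖ < 1 := by
    have h1 := (FloorSemiring.tendsto_pow_div_factorial_atTop (‖mulVL A‖ * T)).const_mul
      (√T * √T * ‖mulVL A‖)
    rw [mul_zero] at h1
    obtain ⟨j, hj⟩ := (h1.eventually (gt_mem_nhds one_pos)).exists
    refine ⟨j, lt_of_le_of_lt (ContinuousLinearMap.opNorm_le_bound _ ?_ fun v => ?_) hj⟩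
    · positivity
    have h2 := norm_L2_le_of_ae_bound hT ((K ^ (j + 1)) v)
      (C := ‖mulVL A‖ ^ (j + 1) * (√T * ‖v‖) * (T ^ j / j.factorial)) (by positivity) (by
        filter_upwards [norm_pow_volterra_apply_le hT A j v,
          ae_restrict_mem (measurableSet_Ioo : MeasurableSet (Ioo (0 : ℝ) T))] with t ht htT
        refine ht.trans (mul_le_mul_of_nonneg_left ?_ (by positivity))
        have := htT.1.le
        have := htT.2.le
        gcongr)
    refine h2.trans_eq ?_
    rw [mul_pow, pow_succ]
    ring
  have h1 : IsUnit (1 - K ^ (j + 1)) := isUnit_one_sub_of_norm_lt_one hj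
  have hcomm : Commute (1 - K) (∑ i ∈ Finset.range (j + 1), K ^ i) :=
    (Commute.one_left _).sub_left (Commute.sum_right _ _ _ fun i _ => (Commute.refl K).pow_right i)
  rw [← mul_neg_geom_sum K (j + 1)] at h1
  exact (hcomm.isUnit_mul_iff.mp h1).1

/-- A constant function. -/
def constFn (T : ℝ) {k : ℕ} (c : Vec k) : L2 T k := (memLp_const c).toLp _

lemma coeFn_constFn {T : ℝ} {k : ℕ} (c : Vec k) :
    ∀ᵐ t ∂timeMeasure T, constFn T c t = c :=
  MemLp.coeFn_toLp (memLp_const c)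

/-! ### Step functions on the uniform grid -/

/-- The `i`-th cell `(t_i, t_{i+1}]` of the uniform grid `t_i = i T/N`. -/
def cell (T : ℝ) (N i : ℕ) : Set ℝ := Ioc ((i : ℝ) * (T / N)) (((i : ℝ) + 1) * (T / N))

/-- Rounding up to the next grid point. -/
def gridCeil (T : ℝ) (N : ℕ) (t : ℝ) : ℝ := ⌈t * N / T⌉ * (T / N)

lemma measurableSet_cell (T : ℝ) (N i : ℕ) : MeasurableSet (cell T N i) := measurableSet_Ioc

lemma measurable_gridCeil (T : ℝ) (N : ℕ) : Measurable (gridCeil T N) := by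
  unfold gridCeil
  exact ((measurable_from_top (f := fun k : ℤ => (k : ℝ))).comp
    (Int.measurable_ceil.comp ((measurable_id.mul_const _).div_const _))).mul_const _

lemma ceil_of_mem_cell {T : ℝ} (hT : 0 < T) {N : ℕ} (hN : 0 < N) {i : ℕ} {t : ℝ} :
    t ∈ cell T N i ↔ ⌈t * N / T⌉ = (i : ℤ) + 1 := by
  have hN' : (0 : ℝ) < N := by exact_mod_cast hN
  rw [Int.ceil_eq_iff, cell, mem_Ioc]
  push_cast
  rw [add_sub_cancel_right, lt_div_iff₀ hT, div_le_iff₀ hT, ← mul_div_assoc, ← mul_div_assoc,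
    div_lt_iff₀ hN', le_div_iff₀ hN']

lemma gridCeil_of_mem_cell {T : ℝ} (hT : 0 < T) {N : ℕ} (hN : 0 < N) {i : ℕ} {t : ℝ}
    (ht : t ∈ cell T N i) : gridCeil T N t = ((i : ℝ) + 1) * (T / N) := by
  rw [gridCeil, (ceil_of_mem_cell hT hN).mp ht]
  push_cast
  rfl

lemma abs_gridCeil_sub_le {T : ℝ} (hT : 0 < T) {N : ℕ} (hN : 0 < N) (t : ℝ) :
    |gridCeil T N t - t| ≤ T / N := by
  have hN' : (0 : ℝ) < N := by exact_mod_cast hN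
  have h1 := Int.le_ceil (t * N / T)
  have h2 := Int.ceil_lt_add_one (t * N / T)
  have hpos : 0 < T / N := div_pos hT hN'
  have e : t = t * N / T * (T / N) := by field_simp
  have h3 : gridCeil T N t - t = (⌈t * N / T⌉ - t * N / T) * (T / N) := by
    rw [sub_mul, ← e, gridCeil]
  rw [h3, abs_mul, abs_of_pos hpos, abs_of_nonneg (by linarith)]
  nlinarith

lemma exists_mem_cell {T : ℝ} (hT : 0 < T) {N : ℕ} (hN : 0 < N) {t : ℝ} (ht : t ∈ Ioc 0 T) :
    ∃ i : Fin N, t ∈ cell T N i := by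
  have hN' : (0 : ℝ) < N := by exact_mod_cast hN
  have h1 : 0 < ⌈t * N / T⌉ := Int.ceil_pos.mpr (div_pos (mul_pos ht.1 hN') hT)
  have h2 : ⌈t * N / T⌉ ≤ (N : ℤ) := by
    rw [Int.ceil_le, div_le_iff₀ hT, mul_comm]
    push_cast
    exact mul_le_mul_of_nonneg_left ht.2 hN'.le
  refine ⟨⟨(⌈t * N / T⌉ - 1).toNat, by omega⟩, ?_⟩
  rw [ceil_of_mem_cell hT hN]
  simp only
  omega

lemma cell_eq_of_mem {T : ℝ} (hT : 0 < T) {N : ℕ} (hN : 0 < N) {i j : ℕ} {t : ℝ}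
    (hi : t ∈ cell T N i) (hj : t ∈ cell T N j) : i = j := by
  rw [ceil_of_mem_cell hT hN] at hi hj
  omega

lemma ae_of_forall_cell {T : ℝ} (hT : 0 < T) {N : ℕ} (hN : 0 < N) {p : ℝ → Prop}
    (h : ∀ i : Fin N, ∀ᵐ t ∂timeMeasure T, t ∈ cell T N i → p t) :
    ∀ᵐ t ∂timeMeasure T, p t := by
  filter_upwards [ae_all_iff.mpr h, ae_restrict_mem (measurableSet_Ioo : MeasurableSet (Ioo 0 T))]
    with t ht htT
  obtain ⟨i, hi⟩ := exists_mem_cell hT hN ⟨htT.1, htT.2.le⟩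
  exact ht i hi

lemma cell_subset {T : ℝ} (hT : 0 < T) {N : ℕ} (i : Fin N) : cell T N i ⊆ Ioc 0 T := by
  have hN : 0 < N := i.pos
  have hN' : (0 : ℝ) < N := by exact_mod_cast hN
  have hpos : 0 < T / N := div_pos hT hN'
  intro t ht
  refine ⟨lt_of_le_of_lt (by positivity) ht.1, ht.2.trans ?_⟩
  have h1 : ((i : ℕ) : ℝ) + 1 ≤ N := by exact_mod_cast i.2
  calc _ ≤ (N : ℝ) * (T / N) := mul_le_mul_of_nonneg_right h1 hpos.le
    _ = T := by field_simp

lemma timeMeasure_restrict_cell {T : ℝ} (hT : 0 < T) {N : ℕ} (i : Fin N) :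
    (timeMeasure T).restrict (cell T N i) = volume.restrict (cell T N i) := by
  rw [timeMeasure, Measure.restrict_congr_set (Ioo_ae_eq_Ioc (μ := volume) (a := (0 : ℝ)) (b := T)),
    Measure.restrict_restrict (measurableSet_cell T N i), inter_eq_left.mpr (cell_subset hT i)]

lemma timeMeasure_real_cell {T : ℝ} (hT : 0 < T) {N : ℕ} (i : Fin N) :
    (timeMeasure T).real (cell T N i) = T / N := by
  have hN' : (0 : ℝ) < N := by exact_mod_cast i.pos
  have h1 : (timeMeasure T) (cell T N i) = volume (cell T N i) := by
    rw [← Measure.restrict_apply_univ, timeMeasure_restrict_cell hT i, Measure.restrict_apply_univ]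
  rw [measureReal_def, h1, cell, Real.volume_Ioc, ENNReal.toReal_ofReal]
  · ring
  · have : 0 < T / N := div_pos hT hN'
    nlinarith

/-- The step function with value `d i` on the `i`-th cell. -/
def stepFn (T : ℝ) (N : ℕ) {k : ℕ} (d : Fin N → Vec k) : L2 T k :=
  ∑ i : Fin N, indicatorConstLp 2 (measurableSet_cell T N i) (measure_ne_top _ _) (d i)

lemma coeFn_sum_L2 {T : ℝ} {k : ℕ} {ι : Type*} (s : Finset ι) (f : ι → L2 T k) :
    ∀ᵐ t ∂timeMeasure T, (∑ i ∈ s, f i) t = ∑ i ∈ s, f i t := by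
  classical
  induction s using Finset.induction_on with
  | empty =>
    filter_upwards [Lp.coeFn_zero (Vec k) 2 (timeMeasure T)] with t ht
    rw [Finset.sum_empty, Finset.sum_empty, ht, Pi.zero_apply]
  | insert i s hi ih =>
    filter_upwards [ih, Lp.coeFn_add (f i) (∑ i ∈ s, f i)] with t h1 h2
    rw [Finset.sum_insert hi, Finset.sum_insert hi, h2, Pi.add_apply, h1]

lemma coeFn_stepFn {T : ℝ} (hT : 0 < T) {N : ℕ} {k : ℕ} (d : Fin N → Vec k) :
    ∀ᵐ t ∂timeMeasure T, ∀ i : Fin N, t ∈ cell T N i → stepFn T N d t = d i := by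
  have h1 : ∀ᵐ t ∂timeMeasure T, ∀ i : Fin N,
      indicatorConstLp 2 (measurableSet_cell T N i) (measure_ne_top (timeMeasure T) _) (d i) t =
        (cell T N i).indicator (fun _ => d i) t := by
    rw [ae_all_iff]
    exact fun i => indicatorConstLp_coeFn
  filter_upwards [h1, coeFn_sum_L2 Finset.univ (fun i : Fin N => indicatorConstLp 2
    (measurableSet_cell T N i) (measure_ne_top (timeMeasure T) _) (d i))] with t ht hs i hi
  rw [stepFn, hs, Finset.sum_eq_single i]
  · rw [ht, Set.indicator_of_mem hi]
  · intro j _ hji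
    rw [ht, Set.indicator_of_notMem]
    exact fun hj => hji (Fin.ext (cell_eq_of_mem hT i.pos hj hi))
  · simp

lemma eq_stepFn {T : ℝ} (hT : 0 < T) {N : ℕ} (hN : 0 < N) {k : ℕ} {v : L2 T k}
    {d : Fin N → Vec k}
    (h : ∀ i : Fin N, ∀ᵐ t ∂timeMeasure T, t ∈ cell T N i → v t = d i) :
    v = stepFn T N d := by
  refine Lp.ext (ae_of_forall_cell hT hN fun i => ?_)
  filter_upwards [h i, coeFn_stepFn hT d] with t h1 h2 hi
  rw [h1 hi, h2 i hi]

lemma stepFn_sub {T : ℝ} (hT : 0 < T) {N : ℕ} (hN : 0 < N) {k : ℕ} (d e : Fin N → Vec k) :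
    stepFn T N (d - e) = stepFn T N d - stepFn T N e := by
  symm
  refine eq_stepFn hT hN fun i => ?_
  filter_upwards [Lp.coeFn_sub (stepFn T N d) (stepFn T N e), coeFn_stepFn hT d,
    coeFn_stepFn hT e] with t h1 h2 h3 hi
  rw [h1, Pi.sub_apply, h2 i hi, h3 i hi, Pi.sub_apply]

lemma stepFn_add {T : ℝ} (hT : 0 < T) {N : ℕ} (hN : 0 < N) {k : ℕ} (d e : Fin N → Vec k) :
    stepFn T N (d + e) = stepFn T N d + stepFn T N e := by
  symm
  refine eq_stepFn hT hN fun i => ?_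
  filter_upwards [Lp.coeFn_add (stepFn T N d) (stepFn T N e), coeFn_stepFn hT d,
    coeFn_stepFn hT e] with t h1 h2 h3 hi
  rw [h1, Pi.add_apply, h2 i hi, h3 i hi, Pi.add_apply]

lemma matL_stepFn {T : ℝ} (hT : 0 < T) {N : ℕ} (hN : 0 < N) {a b : ℕ}
    (A : Matrix (Fin a) (Fin b) ℝ) (d : Fin N → Vec b) :
    matL T A (stepFn T N d) = stepFn T N fun i => mulV A (d i) := by
  refine eq_stepFn hT hN fun i => ?_
  filter_upwards [coeFn_matL A (stepFn T N d), coeFn_stepFn hT d] with t h1 h2 hi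
  rw [h1, h2 i hi]

lemma constFn_eq_stepFn {T : ℝ} (hT : 0 < T) {N : ℕ} (hN : 0 < N) {k : ℕ} (c : Vec k) :
    constFn T c = stepFn T N fun _ => c := by
  refine eq_stepFn hT hN fun i => ?_
  filter_upwards [coeFn_constFn c] with t h1 _ using h1

/-- The integral over the `i`-th cell. -/
def cellInt (T : ℝ) (N : ℕ) {k : ℕ} (v : L2 T k) (i : ℕ) : Vec k :=
  setIntL T (cell T N i) (measurableSet_cell T N i) v

lemma inner_stepFn {T : ℝ} {N : ℕ} {k : ℕ} (d : Fin N → Vec k) (v : L2 T k) :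
    inner ℝ (stepFn T N d) v = ∑ i : Fin N, inner ℝ (d i) (cellInt T N v i) := by
  rw [stepFn, sum_inner]
  exact Finset.sum_congr rfl fun i _ => L2.inner_indicatorConstLp_eq_inner_setIntegral ℝ
    (measurableSet_cell T N i) (measure_ne_top (timeMeasure T) _) (d i) v

lemma cellInt_stepFn {T : ℝ} (hT : 0 < T) {N : ℕ} {k : ℕ} (d : Fin N → Vec k) (i : Fin N) :
    cellInt T N (stepFn T N d) i = (T / N) • d i := by
  rw [cellInt, setIntL_apply]
  have h1 : ∫ t in cell T N i, stepFn T N d t ∂timeMeasure T =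
      ∫ _ in cell T N i, d i ∂timeMeasure T := by
    refine setIntegral_congr_ae (measurableSet_cell T N i) ?_
    filter_upwards [coeFn_stepFn hT d] with t ht hi using ht i hi
  rw [h1, setIntegral_const, timeMeasure_real_cell hT i]

/-- The step function of the cell averages of `v`. -/
def cellAvg (T : ℝ) (N : ℕ) {k : ℕ} (v : L2 T k) : L2 T k :=
  stepFn T N fun i => ((T / N)⁻¹ : ℝ) • cellInt T N v i

lemma cellInt_cellAvg {T : ℝ} (hT : 0 < T) {N : ℕ} {k : ℕ} (v : L2 T k) (i : Fin N) :
    cellInt T N (cellAvg T N v) i = cellInt T N v i := by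
  have hN' : (0 : ℝ) < N := by exact_mod_cast i.pos
  rw [cellAvg, cellInt_stepFn hT, smul_smul, mul_inv_cancel₀ (div_pos hT hN').ne', one_smul]

lemma cellAvg_stepFn {T : ℝ} (hT : 0 < T) {N : ℕ} {k : ℕ} (d : Fin N → Vec k) :
    cellAvg T N (stepFn T N d) = stepFn T N d := by
  rw [cellAvg]
  congr 1
  funext i
  have hN' : (0 : ℝ) < N := by exact_mod_cast i.pos
  rw [cellInt_stepFn hT, smul_smul, inv_mul_cancel₀ (div_pos hT hN').ne', one_smul]

lemma cellAvg_add {T : ℝ} (hT : 0 < T) {N : ℕ} (hN : 0 < N) {k : ℕ} (v w : L2 T k) :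
    cellAvg T N (v + w) = cellAvg T N v + cellAvg T N w := by
  rw [cellAvg, cellAvg, cellAvg, ← stepFn_add hT hN]
  congr 1
  funext i
  simp [cellInt]

lemma cellAvg_sub {T : ℝ} (hT : 0 < T) {N : ℕ} (hN : 0 < N) {k : ℕ} (v w : L2 T k) :
    cellAvg T N (v - w) = cellAvg T N v - cellAvg T N w := by
  rw [cellAvg, cellAvg, cellAvg, ← stepFn_sub hT hN]
  congr 1
  funext i
  simp [cellInt, smul_sub]

lemma cellAvg_matL {T : ℝ} (hT : 0 < T) {N : ℕ} (hN : 0 < N) {a b : ℕ}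
    (A : Matrix (Fin a) (Fin b) ℝ) (v : L2 T b) :
    cellAvg T N (matL T A v) = matL T A (cellAvg T N v) := by
  rw [cellAvg, cellAvg, matL_stepFn hT hN]
  congr 1
  funext i
  rw [cellInt, setIntL_matL, ← mulVL_apply, ← mulVL_apply, map_smul]
  rfl

/-- Averaging is the orthogonal projection onto the step functions. -/
lemma norm_cellAvg_sub_le {T : ℝ} (hT : 0 < T) {N : ℕ} (hN : 0 < N) {k : ℕ} (v : L2 T k)
    (d : Fin N → Vec k) : ‖cellAvg T N v - stepFn T N d‖ ≤ ‖v - stepFn T N d‖ := by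
  obtain ⟨e, he⟩ : ∃ e : Fin N → Vec k, cellAvg T N v - stepFn T N d = stepFn T N e :=
    ⟨_, (stepFn_sub hT hN _ _).symm⟩
  have horth : inner ℝ (stepFn T N e) (v - cellAvg T N v) = 0 := by
    rw [inner_stepFn]
    refine Finset.sum_eq_zero fun i _ => ?_
    have h1 : cellInt T N (v - cellAvg T N v) i = 0 := by
      have := cellInt_cellAvg hT v i
      simp only [cellInt, map_sub] at this ⊢
      rw [this, sub_self]
    rw [h1, inner_zero_right]
  have hsplit : v - stepFn T N d = stepFn T N e + (v - cellAvg T N v) := by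
    rw [← he]
    abel
  have h2 := norm_add_sq_eq_norm_sq_add_norm_sq_of_inner_eq_zero _ _ horth
  rw [← hsplit] at h2
  rw [he]
  refine le_of_sq_le_sq ?_ (norm_nonneg _)
  nlinarith [mul_self_nonneg ‖v - cellAvg T N v‖]

lemma prim_grid_succ_sub {T : ℝ} (hT : 0 < T) (N : ℕ) {k : ℕ} (v : L2 T k) (i : ℕ) :
    prim v (((i : ℝ) + 1) * (T / N)) - prim v ((i : ℝ) * (T / N)) = cellInt T N v i := by
  have h : 0 ≤ T / N := by positivity
  rw [prim_sub_prim v (by nlinarith)]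
  rfl

/-- Integration up to the next grid point. The integral equation `x = x₀ + V(Ax + Bu)` with this
operator is the implicit Euler scheme, and its solutions are step functions. -/
def gridVolterra (T : ℝ) (hT : 0 ≤ T) (N : ℕ) {k : ℕ} : L2 T k →L[ℝ] L2 T k :=
  volterra T hT (gridCeil T N) (measurable_gridCeil T N)

lemma gridVolterra_eq_stepFn {T : ℝ} (hT : 0 < T) {N : ℕ} (hN : 0 < N) {k : ℕ} (v : L2 T k) :
    gridVolterra T hT.le N v = stepFn T N fun i => prim v (((i : ℝ) + 1) * (T / N)) := by
  refine eq_stepFn hT hN fun i => ?_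
  filter_upwards [coeFn_volterra hT.le (measurable_gridCeil T N) v] with t h1 hi
  rw [gridVolterra, h1, gridCeil_of_mem_cell hT hN hi]

lemma natCast_mul_div_self {T : ℝ} {N : ℕ} (hN : 0 < N) : (N : ℝ) * (T / N) = T := by
  have hN' : (0 : ℝ) < N := by exact_mod_cast hN
  field_simp

lemma prim_last {T : ℝ} {N : ℕ} (hN : 0 < N) {k : ℕ} (v : L2 T k) :
    prim v ((N : ℝ) * (T / N)) = intL T v := by
  rw [natCast_mul_div_self hN, prim_of_ge v le_rfl]

lemma tendsto_gridVolterra {T : ℝ} (hT : 0 < T) {k : ℕ} :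
    Tendsto (fun N => (gridVolterra T hT.le N : L2 T k →L[ℝ] L2 T k)) atTop
      (𝓝 (volterra T hT.le id measurable_id)) := by
  rw [tendsto_iff_norm_sub_tendsto_zero]
  have h1 : Tendsto (fun N : ℕ => √T * √(T / N)) atTop (𝓝 (√T * √0)) :=
    ((tendsto_const_div_atTop_nhds_zero_nat T).sqrt).const_mul _
  rw [Real.sqrt_zero, mul_zero] at h1
  refine squeeze_zero' (Eventually.of_forall fun _ => norm_nonneg _) ?_ h1
  filter_upwards [eventually_gt_atTop 0] with N hN
  exact norm_volterra_sub_le hT.le _ _ fun t => abs_gridCeil_sub_le hT hN t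

/-- The step function of the values of `φ` at the right end points of the cells. -/
def sampleFn (T : ℝ) (N : ℕ) {k : ℕ} (φ : ℝ → Vec k) : L2 T k :=
  stepFn T N fun i => φ (((i : ℝ) + 1) * (T / N))

lemma norm_sub_sampleFn_sq {T : ℝ} (hT : 0 < T) {N : ℕ} (hN : 0 < N) {k : ℕ} {φ : ℝ → Vec k}
    (hφ : MemLp φ 2 (timeMeasure T)) :
    ‖hφ.toLp φ - sampleFn T N φ‖ ^ 2 = ∑ i ∈ Finset.range N,
      ∫ t in Ioc ((i : ℝ) * (T / N)) (((i : ℝ) + 1) * (T / N)),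
        ‖φ t - φ (((i : ℝ) + 1) * (T / N))‖ ^ 2 := by
  set u := hφ.toLp φ - sampleFn T N φ with hu
  have hae : ∀ᵐ t ∂timeMeasure T, ∀ i : Fin N, t ∈ cell T N i →
      u t = φ t - φ (((i : ℝ) + 1) * (T / N)) := by
    filter_upwards [Lp.coeFn_sub (hφ.toLp φ) (sampleFn T N φ), hφ.coeFn_toLp,
      coeFn_stepFn hT fun i : Fin N => φ (((i : ℝ) + 1) * (T / N))] with t h1 h2 h3 i hi
    rw [hu, h1, Pi.sub_apply, h2, sampleFn, h3 i hi]
  have hint : Integrable (fun t => ‖u t‖ ^ 2) (timeMeasure T) :=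
    (memLp_two_iff_integrable_sq_norm (Lp.memLp u).1).mp (Lp.memLp u)
  have h1 : ‖u‖ ^ 2 = ∫ t, ‖u t‖ ^ 2 ∂timeMeasure T := by
    rw [← real_inner_self_eq_norm_sq, L2.inner_def]
    exact integral_congr_ae (Eventually.of_forall fun t => real_inner_self_eq_norm_sq _)
  have hint' : IntegrableOn (fun t => ‖u t‖ ^ 2) (Ioc 0 T) volume :=
    (integrableOn_Ioc_iff_integrableOn_Ioo).mpr hint
  have h2 : ∫ t, ‖u t‖ ^ 2 ∂timeMeasure T = ∫ t in (0 : ℝ)..T, ‖u t‖ ^ 2 := by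
    rw [intervalIntegral.integral_of_le hT.le, integral_Ioc_eq_integral_Ioo]
  have hpos : 0 ≤ T / N := by positivity
  have h3 := intervalIntegral.sum_integral_adjacent_intervals (μ := volume)
    (f := fun t => ‖u t‖ ^ 2) (a := fun i : ℕ => (i : ℝ) * (T / N)) (n := N) (by
      intro i hi
      rw [intervalIntegrable_iff_integrableOn_Ioc_of_le (by push_cast; nlinarith)]
      refine hint'.mono_set ?_
      have := cell_subset hT ⟨i, hi⟩
      simpa [cell] using this)
  simp only [Nat.cast_zero, zero_mul, natCast_mul_div_self hN] at h3
  rw [h1, h2, ← h3]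
  refine Finset.sum_congr rfl fun i hi => ?_
  rw [intervalIntegral.integral_of_le (by push_cast; nlinarith)]
  push_cast
  have hi' : i < N := Finset.mem_range.mp hi
  have h4 := timeMeasure_restrict_cell hT (⟨i, hi'⟩ : Fin N)
  simp only [cell] at h4
  rw [← h4]
  refine setIntegral_congr_ae measurableSet_Ioc ?_
  filter_upwards [hae] with t ht hti
  rw [ht ⟨i, hi'⟩ hti]

lemma tendsto_sampleFn {T : ℝ} (hT : 0 < T) {k : ℕ} {φ : ℝ → Vec k}
    (hφ : MemLp φ 2 (timeMeasure T)) (h : GridConsistent T φ) :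
    Tendsto (fun N => sampleFn T N φ) atTop (𝓝 (hφ.toLp φ)) := by
  rw [tendsto_iff_norm_sub_tendsto_zero]
  have h1 : Tendsto (fun N => ‖hφ.toLp φ - sampleFn T N φ‖ ^ 2) atTop (𝓝 0) := by
    refine h.congr' ?_
    filter_upwards [eventually_gt_atTop 0] with N hN
    exact (norm_sub_sampleFn_sq hT hN hφ).symm
  have h2 := h1.sqrt
  rw [Real.sqrt_zero] at h2
  refine h2.congr fun N => ?_
  rw [Real.sqrt_sq (norm_nonneg _), norm_sub_rev]

/-- The a.e. nonpositive functions. -/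
def nonposSet (T : ℝ) (k : ℕ) : Set (L2 T k) := {s | ∀ᵐ t ∂timeMeasure T, ∀ j, s t j ≤ 0}

lemma setIntL_coord {T : ℝ} {k : ℕ} {S : Set ℝ} (hS : MeasurableSet S) (s : L2 T k) (j : Fin k) :
    setIntL T S hS s j = ∫ t in S, s t j ∂timeMeasure T :=
  ((EuclideanSpace.proj (𝕜 := ℝ) j).integral_comp_comm (integrable_L2 s).integrableOn).symm

/-- A description by continuous functionals, from which closedness is evident. -/
lemma mem_nonposSet_iff {T : ℝ} {k : ℕ} {s : L2 T k} :
    s ∈ nonposSet T k ↔ ∀ (S : Set ℝ) (hS : MeasurableSet S) (j : Fin k),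
      setIntL T S hS s j ≤ 0 := by
  refine ⟨fun h S hS j => ?_, fun h => ?_⟩
  · rw [setIntL_coord]
    refine integral_nonpos_of_ae (ae_restrict_of_ae ?_)
    filter_upwards [h] with t ht using ht j
  · change ∀ᵐ t ∂timeMeasure T, ∀ j, s t j ≤ 0
    rw [ae_all_iff]
    intro j
    refine ae_le_of_forall_setIntegral_le (g := fun _ => (0 : ℝ))
      ((EuclideanSpace.proj (𝕜 := ℝ) j).integrable_comp (integrable_L2 s))
      (integrable_zero _ _ _) fun S hS _ => ?_
    rw [integral_zero]
    have := h S hS j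
    rwa [setIntL_coord] at this

lemma isClosed_nonposSet (T : ℝ) (k : ℕ) : IsClosed (nonposSet T k) := by
  have h : nonposSet T k = ⋂ (S : Set ℝ) (hS : MeasurableSet S) (j : Fin k),
      {s | setIntL T S hS s j ≤ 0} := by
    ext s
    simp only [mem_iInter]
    exact mem_nonposSet_iff
  rw [h]
  refine isClosed_iInter fun S => isClosed_iInter fun hS => isClosed_iInter fun j => ?_
  exact isClosed_le ((EuclideanSpace.proj (𝕜 := ℝ) j).continuous.comp (setIntL T S hS).continuous)
    continuous_const

lemma convex_nonposSet (T : ℝ) (k : ℕ) : Convex ℝ (nonposSet T k) := by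
  intro s hs s' hs' a b ha hb _
  rw [mem_nonposSet_iff] at hs hs' ⊢
  intro S hS j
  have h1 := hs S hS j
  have h2 := hs' S hS j
  simp only [map_add, map_smul, PiLp.add_apply, PiLp.smul_apply, smul_eq_mul]
  nlinarith

lemma zero_mem_nonposSet (T : ℝ) (k : ℕ) : (0 : L2 T k) ∈ nonposSet T k := by
  rw [mem_nonposSet_iff]
  intro S hS j
  simp

lemma stepFn_mem_nonposSet {T : ℝ} (hT : 0 < T) {N : ℕ} (hN : 0 < N) {k : ℕ}
    {d : Fin N → Vec k} (h : ∀ i j, d i j ≤ 0) : stepFn T N d ∈ nonposSet T k := by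
  refine ae_of_forall_cell hT hN fun i => ?_
  filter_upwards [coeFn_stepFn hT d] with t ht hi j
  rw [ht i hi]
  exact h i j

lemma le_zero_of_stepFn_mem_nonposSet {T : ℝ} (hT : 0 < T) {N : ℕ} {k : ℕ}
    {d : Fin N → Vec k} (h : stepFn T N d ∈ nonposSet T k) (i : Fin N) (j : Fin k) :
    d i j ≤ 0 := by
  have hN' : (0 : ℝ) < N := by exact_mod_cast i.pos
  have hpos : 0 < T / N := div_pos hT hN'
  have h1 := mem_nonposSet_iff.mp h (cell T N i) (measurableSet_cell T N i) j
  have h2 := cellInt_stepFn hT d i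
  rw [cellInt] at h2
  rw [h2, PiLp.smul_apply, smul_eq_mul] at h1
  by_contra hc
  exact absurd h1 (not_le.mpr (mul_pos hpos (not_le.mp hc)))

lemma cellAvg_mem_nonposSet {T : ℝ} (hT : 0 < T) {N : ℕ} (hN : 0 < N) {k : ℕ} {s : L2 T k}
    (h : s ∈ nonposSet T k) : cellAvg T N s ∈ nonposSet T k := by
  refine stepFn_mem_nonposSet hT hN fun i j => ?_
  have h1 := mem_nonposSet_iff.mp h (cell T N i) (measurableSet_cell T N i) j
  rw [PiLp.smul_apply, smul_eq_mul]
  exact mul_nonpos_of_nonneg_of_nonpos (by positivity) h1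

/-! ### Weak derivatives on `(0,T)` -/

lemma integrable_test_smul {n : ℕ} {φ : ℝ → ℝ} (hφ : Continuous φ)
    (hc : HasCompactSupport φ) {μ : Measure ℝ} {v : ℝ → Vec n} (hv : Integrable v μ) :
    Integrable (fun t => φ t • v t) μ := by
  obtain ⟨C, hC⟩ := hc.exists_bound_of_continuous hφ
  exact hv.bdd_smul C hφ.aestronglyMeasurable (Eventually.of_forall hC)

lemma test_eq_zero {T : ℝ} {φ : ℝ → ℝ} (hs : tsupport φ ⊆ Ioo 0 T) {t : ℝ} (ht : t ∉ Ioo 0 T) :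
    φ t = 0 :=
  image_eq_zero_of_notMem_tsupport fun h => ht (hs h)

lemma integral_deriv_test {φ : ℝ → ℝ} (hφ : ContDiff ℝ ∞ φ) (a b : ℝ) :
    ∫ t in a..b, deriv φ t = φ b - φ a :=
  intervalIntegral.integral_deriv_eq_sub (fun x _ => (hφ.differentiable (by simp)).differentiableAt)
    ((hφ.continuous_deriv (by simp)).intervalIntegrable _ _)

/-- The primitive of a square integrable function has that function as weak derivative. -/
theorem isWeakDeriv_const_add_volterra {T : ℝ} (hT : 0 < T) {n : ℕ} (c : Vec n) (v : L2 T n) :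
    IsWeakDeriv (constFn T c + volterra T hT.le id measurable_id v) v := by
  intro φ hφ hcs hs
  have hd : Continuous (deriv φ) := hφ.continuous_deriv (by simp)
  have hdc : HasCompactSupport (deriv φ) := hcs.deriv
  have hx : ∀ᵐ t ∂timeMeasure T,
      (constFn T c + volterra T hT.le id measurable_id v : L2 T n) t = c + prim v t := by
    filter_upwards [Lp.coeFn_add (constFn T c) (volterra T hT.le id measurable_id v),
      coeFn_constFn c, coeFn_volterra hT.le measurable_id v] with t h1 h2 h3
    rw [h1, Pi.add_apply, h2, h3, id]
  have h1 : ∫ t in Ioo 0 T, deriv φ t •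
      (constFn T c + volterra T hT.le id measurable_id v : L2 T n) t =
      ∫ t, (deriv φ t • c + deriv φ t • prim v t) ∂timeMeasure T := by
    refine integral_congr_ae ?_
    filter_upwards [hx] with t ht
    rw [ht, smul_add]
  have hconst : ∫ t, deriv φ t • c ∂timeMeasure T = 0 := by
    rw [integral_smul_const, timeMeasure, ← integral_Ioc_eq_integral_Ioo,
      ← intervalIntegral.integral_of_le hT.le, integral_deriv_test hφ,
      test_eq_zero hs (by simp : T ∉ Ioo 0 T), test_eq_zero hs (by simp : (0 : ℝ) ∉ Ioo 0 T),
      sub_zero, zero_smul]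
  have hprim : Integrable (prim v) (timeMeasure T) :=
    (memLp_prim_comp hT.le v measurable_id).integrable one_le_two
  rw [h1, integral_add (integrable_test_smul hd hdc (integrable_const c))
    (integrable_test_smul hd hdc hprim), hconst, zero_add]
  -- Exchange the order of integration over the triangle `s ≤ t`.
  set D : Set (ℝ × ℝ) := {p | p.2 ≤ p.1} with hD
  have hDm : MeasurableSet D := measurableSet_le measurable_snd measurable_fst
  have hint : Integrable (Function.uncurry fun t s => D.indicator
      (fun p : ℝ × ℝ => deriv φ p.1 • v p.2) (t, s)) ((timeMeasure T).prod (timeMeasure T)) := by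
    have h2 : Integrable (deriv φ) (timeMeasure T) :=
      (hd.integrable_of_hasCompactSupport hdc).integrableOn
    exact (h2.smul_prod (integrable_L2 v)).indicator hDm
  have hswap := integral_integral_swap hint
  have hleft : ∀ t, ∫ s, D.indicator (fun p : ℝ × ℝ => deriv φ p.1 • v p.2) (t, s) ∂timeMeasure T
      = deriv φ t • prim v t := by
    intro t
    rw [prim, setIntL_apply, ← integral_smul, ← integral_indicator measurableSet_Iic]
    refine integral_congr_ae (Eventually.of_forall fun s => ?_)
    by_cases h : s ≤ t
    · simp [Set.indicator, hD, h]
    · simp [Set.indicator, hD, h]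
  have hright : ∀ s ∈ Ioo 0 T, ∫ t, D.indicator (fun p : ℝ × ℝ => deriv φ p.1 • v p.2) (t, s)
      ∂timeMeasure T = -(φ s • v s) := by
    intro s hsT
    have e1 : ∀ t, D.indicator (fun p : ℝ × ℝ => deriv φ p.1 • v p.2) (t, s) =
        (Ici s).indicator (fun t => deriv φ t • v s) t := by
      intro t
      by_cases h : s ≤ t
      · simp [Set.indicator, hD, h]
      · simp [Set.indicator, hD, h]
    simp only [e1]
    rw [integral_indicator measurableSet_Ici, integral_smul_const,
      Measure.restrict_restrict measurableSet_Ici]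
    have e2 : Ici s ∩ Ioo 0 T = Ico s T := by
      ext x
      simp only [mem_inter_iff, mem_Ici, mem_Ioo, mem_Ico]
      exact ⟨fun h => ⟨h.1, h.2.2⟩, fun h => ⟨h.1, hsT.1.trans_le h.1, h.2⟩⟩
    rw [e2, integral_Ico_eq_integral_Ioo, ← integral_Ioc_eq_integral_Ioo,
      ← intervalIntegral.integral_of_le hsT.2.le, integral_deriv_test hφ,
      test_eq_zero hs (by simp : T ∉ Ioo 0 T), zero_sub, neg_smul]
  simp only [hleft] at hswap
  rw [hswap, ← integral_neg]
  refine integral_congr_ae ?_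
  filter_upwards [ae_restrict_mem (measurableSet_Ioo : MeasurableSet (Ioo 0 T))] with s hsT
  exact hright s hsT

/-- The fundamental lemma of the calculus of variations. -/
lemma ae_eq_zero_of_test {T : ℝ} {n : ℕ} {v : ℝ → Vec n} (hv : Integrable v (timeMeasure T))
    (h : ∀ φ : ℝ → ℝ, ContDiff ℝ ∞ φ → HasCompactSupport φ → tsupport φ ⊆ Ioo 0 T →
      ∫ t in Ioo 0 T, φ t • v t = 0) : ∀ᵐ t ∂timeMeasure T, v t = 0 := by
  have h1 := isOpen_Ioo.ae_eq_zero_of_integral_contDiff_smul_eq_zero (μ := volume) (f := v)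
    (IntegrableOn.locallyIntegrableOn hv) (fun g hg hgc hgs => by
      rw [← setIntegral_eq_integral_of_forall_compl_eq_zero (s := Ioo 0 T)]
      · exact h g hg hgc hgs
      · intro x hx
        rw [test_eq_zero hgs hx, zero_smul])
  exact (ae_restrict_iff' measurableSet_Ioo).mpr h1

lemma IsWeakDeriv.unique {T : ℝ} {n : ℕ} {x v v' : L2 T n} (h : IsWeakDeriv x v)
    (h' : IsWeakDeriv x v') : v = v' := by
  refine Lp.ext ?_
  have h1 := ae_eq_zero_of_test ((integrable_L2 v).sub (integrable_L2 v')) (by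
    intro φ hφ hc hs
    have e := (h φ hφ hc hs).symm.trans (h' φ hφ hc hs)
    rw [neg_inj] at e
    simp only [Pi.sub_apply, smul_sub]
    rw [integral_sub (integrable_test_smul hφ.continuous hc (integrable_L2 v))
      (integrable_test_smul hφ.continuous hc (integrable_L2 v')), e, sub_self])
  filter_upwards [h1] with t ht
  exact sub_eq_zero.mp ht

/-- The primitive of a smooth function that is supported in `[a,b]` and has integral zero. -/
lemma exists_test_primitive {T : ℝ} {g : ℝ → ℝ} (hg : ContDiff ℝ ∞ g) {a b : ℝ} (ha : 0 < a)
    (hb : b < T) (hgs : ∀ t, t ∉ Icc a b → g t = 0) (hg0 : ∫ t, g t = 0) :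
    ∃ φ : ℝ → ℝ, ContDiff ℝ ∞ φ ∧ HasCompactSupport φ ∧ tsupport φ ⊆ Ioo 0 T ∧ deriv φ = g := by
  have hder : ∀ t, HasDerivAt (fun t => ∫ s in (0 : ℝ)..t, g s) (g t) t := fun t =>
    intervalIntegral.integral_hasDerivAt_right (hg.continuous.intervalIntegrable _ _)
      (hg.continuous.stronglyMeasurableAtFilter _ _) hg.continuous.continuousAt
  have hderiv : deriv (fun t => ∫ s in (0 : ℝ)..t, g s) = g := funext fun t => (hder t).deriv
  have hzero : ∀ t, t ∉ Icc a b → ∫ s in (0 : ℝ)..t, g s = 0 := by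
    intro t ht
    rw [mem_Icc, not_and_or, not_le, not_le] at ht
    rcases ht with ht | ht
    · refine intervalIntegral.integral_zero_ae (Eventually.of_forall fun s hs => hgs s fun hs' => ?_)
      have h1 := hs.2
      rw [← not_lt] at h1
      exact h1 (max_lt ha ht |>.trans_le hs'.1)
    · rw [intervalIntegral.integral_eq_integral_of_support_subset, hg0]
      intro s hs
      have h1 : s ∈ Icc a b := by
        by_contra hc
        exact hs (hgs s hc)
      exact ⟨ha.trans_le h1.1, h1.2.trans ht.le⟩
  have hsupp : tsupport (fun t => ∫ s in (0 : ℝ)..t, g s) ⊆ Icc a b := by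
    refine closure_minimal (fun t ht => ?_) isClosed_Icc
    by_contra hc
    exact ht (hzero t hc)
  refine ⟨fun t => ∫ s in (0 : ℝ)..t, g s, ?_, HasCompactSupport.intro isCompact_Icc hzero,
    fun t ht => ⟨ha.trans_le (hsupp ht).1, (hsupp ht).2.trans_lt hb⟩, hderiv⟩
  rw [contDiff_infty_iff_deriv, hderiv]
  exact ⟨fun t => (hder t).differentiableAt, hg⟩

lemma exists_Icc_of_isCompact {T : ℝ} {K : Set ℝ} (hK : IsCompact K) (hne : K.Nonempty)
    (hs : K ⊆ Ioo 0 T) : ∃ a b, 0 < a ∧ b < T ∧ K ⊆ Icc a b := by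
  obtain ⟨a, ha, hamin⟩ := hK.exists_isLeast hne
  obtain ⟨b, hb, hbmax⟩ := hK.exists_isGreatest hne
  exact ⟨a, b, (hs ha).1, (hs hb).2, fun t ht => ⟨hamin ht, hbmax ht⟩⟩

/-- The lemma of du Bois-Reymond: a function whose weak derivative vanishes is constant. -/
theorem exists_eq_constFn {T : ℝ} (hT : 0 < T) {n : ℕ} {z : L2 T n}
    (hz : ∀ φ : ℝ → ℝ, ContDiff ℝ ∞ φ → HasCompactSupport φ → tsupport φ ⊆ Ioo 0 T →
      ∫ t in Ioo 0 T, deriv φ t • z t = 0) : ∃ c : Vec n, z = constFn T c := by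
  let B : ContDiffBump (T / 2) := ⟨T / 8, T / 4, by positivity, by linarith⟩
  set ψ := B.normed volume with hψ
  have hψd : ContDiff ℝ ∞ ψ := B.contDiff_normed
  have hψc : HasCompactSupport ψ := B.hasCompactSupport_normed
  have hψts : tsupport ψ = Metric.closedBall (T / 2) (T / 4) := B.tsupport_normed_eq
  have hψs : tsupport ψ ⊆ Ioo 0 T := by
    rw [hψts, Real.closedBall_eq_Icc]
    intro t ht
    rw [mem_Icc] at ht
    rw [mem_Ioo]
    constructor <;> linarith
  have hψ1 : ∫ t, ψ t = 1 := B.integral_normed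
  set c := ∫ t in Ioo 0 T, ψ t • z t with hc
  refine ⟨c, Lp.ext ?_⟩
  have h1 := ae_eq_zero_of_test ((integrable_L2 z).sub (integrable_const c)) (by
    intro g hg hgc hgs
    obtain ⟨a, b, ha, hb, hab⟩ := exists_Icc_of_isCompact (T := T) (hgc.union hψc)
      ⟨T / 2, Or.inr (by rw [hψts]; exact Metric.mem_closedBall_self (by positivity))⟩
      (union_subset hgs hψs)
    set r := ∫ t, g t with hr
    have hgi : Integrable g volume := hg.continuous.integrable_of_hasCompactSupport hgc
    have hψi : Integrable ψ volume := hψd.continuous.integrable_of_hasCompactSupport hψc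
    obtain ⟨φ, hφ, hφc, hφs, hφd⟩ := exists_test_primitive (T := T) (g := fun t => g t - r * ψ t)
      (hg.sub (contDiff_const.mul hψd)) ha hb (fun t ht => by
        rw [image_eq_zero_of_notMem_tsupport fun h => ht (hab (Or.inl h)),
          image_eq_zero_of_notMem_tsupport (f := ψ) fun h => ht (hab (Or.inr h)), mul_zero,
          sub_zero]) (by
        rw [integral_sub hgi (hψi.const_mul r), integral_const_mul, hψ1, mul_one, sub_self])
    have h2 := hz φ hφ hφc hφs
    rw [hφd] at h2
    have i1 := integrable_test_smul hg.continuous hgc (integrable_L2 z)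
    have i2 := integrable_test_smul hψd.continuous hψc (integrable_L2 z)
    have h3 : ∫ t in Ioo 0 T, (g t - r * ψ t) • z t = (∫ t in Ioo 0 T, g t • z t) - r • c := by
      have i3 : Integrable (fun t => r • ψ t • z t) (timeMeasure T) := i2.smul r
      rw [hc, ← integral_smul, ← integral_sub i1 i3]
      refine integral_congr_ae (Eventually.of_forall fun t => ?_)
      simp only [sub_smul, mul_smul]
    rw [h3] at h2
    have h4 : ∫ t in Ioo 0 T, g t • c = r • c := by
      rw [integral_smul_const, setIntegral_eq_integral_of_forall_compl_eq_zero
        fun t ht => test_eq_zero hgs ht]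
    simp only [Pi.sub_apply, smul_sub]
    rw [integral_sub i1 (integrable_test_smul hg.continuous hgc (integrable_const c)), h4, h2])
  filter_upwards [h1, coeFn_constFn c] with t ht ht'
  rw [ht']
  exact sub_eq_zero.mp ht

/-- A function with a weak derivative is a constant plus the primitive of its derivative. -/
theorem IsWeakDeriv.eq_const_add_volterra {T : ℝ} (hT : 0 < T) {n : ℕ} {x v : L2 T n}
    (h : IsWeakDeriv x v) : ∃ c, x = constFn T c + volterra T hT.le id measurable_id v := by
  obtain ⟨c, hc⟩ := exists_eq_constFn hT (z := x - volterra T hT.le id measurable_id v) (by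
    intro φ hφ hcs hs
    have h1 := h φ hφ hcs hs
    have h2 := isWeakDeriv_const_add_volterra hT 0 v φ hφ hcs hs
    have h0 : (constFn T 0 : L2 T n) = 0 := by
      refine Lp.ext ?_
      filter_upwards [coeFn_constFn (T := T) (0 : Vec n), Lp.coeFn_zero (Vec n) 2 (timeMeasure T)]
        with t e1 e2
      rw [e1, e2, Pi.zero_apply]
    rw [h0, zero_add] at h2
    have hd : Continuous (deriv φ) := hφ.continuous_deriv (by simp)
    have e : ∫ t in Ioo 0 T, deriv φ t • (x - volterra T hT.le id measurable_id v : L2 T n) t =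
        ∫ t, (deriv φ t • x t - deriv φ t • volterra T hT.le id measurable_id v t)
          ∂timeMeasure T := by
      refine integral_congr_ae ?_
      filter_upwards [Lp.coeFn_sub x (volterra T hT.le id measurable_id v)] with t ht
      rw [ht, Pi.sub_apply, smul_sub]
    rw [e, integral_sub (integrable_test_smul hd hcs.deriv (integrable_L2 x))
      (integrable_test_smul hd hcs.deriv (integrable_L2 _)), h1, h2, sub_self])
  exact ⟨c, by rw [← hc]; abel⟩

/-- The value of an `H¹` function given by its initial value and derivative. -/
theorem H1.value_eq {T : ℝ} (hT : 0 < T) {n : ℕ} {x : H1 T n} {c : Vec n}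
    (h : x.val = constFn T c + volterra T hT.le id measurable_id x.der) {t : ℝ}
    (ht : t ∈ Icc 0 T) : x.value t = c + prim x.der t := by
  have hcont : ContinuousOn (fun t => c + prim x.der t) (Icc 0 T) :=
    (continuous_const.add (continuous_prim _)).continuousOn
  have hae : (fun t => c + prim x.der t) =ᵐ[timeMeasure T] x.val := by
    rw [h]
    filter_upwards [Lp.coeFn_add (constFn T c) (volterra T hT.le id measurable_id x.der),
      coeFn_constFn c, coeFn_volterra hT.le measurable_id x.der] with t h1 h2 h3
    rw [h1, Pi.add_apply, h2, h3, id]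
  have hex : ∃ y : ℝ → Vec n, ContinuousOn y (Icc 0 T) ∧ y =ᵐ[timeMeasure T] x.val :=
    ⟨_, hcont, hae⟩
  rw [H1.value, dif_pos hex]
  have h1 : hex.choose =ᵐ[volume.restrict (Icc 0 T)] fun t => c + prim x.der t := by
    rw [← Measure.restrict_congr_set (Ioo_ae_eq_Icc (μ := volume) (a := (0 : ℝ)) (b := T))]
    exact hex.choose_spec.2.trans hae.symm
  exact Measure.eqOn_Icc_of_ae_eq volume hT.ne h1 hex.choose_spec.1 hcont ht

/-! ### Controllability -/

lemma mulVec_surjective_of_rank {a : ℕ} {ι : Type*} [Fintype ι] {W : Matrix (Fin a) ι ℝ}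
    (h : W.rank = a) : Function.Surjective W.mulVec := by
  have h1 : LinearMap.range W.mulVecLin = ⊤ := by
    refine Submodule.eq_top_of_finrank_eq ?_
    rw [← Matrix.rank, h]
    simp
  intro v
  obtain ⟨x, hx⟩ := LinearMap.range_eq_top.mp h1 v
  exact ⟨x, hx⟩

lemma isUnit_det_of_rank {a : ℕ} {W : Matrix (Fin a) (Fin a) ℝ} (h : W.rank = a) :
    IsUnit W.det :=
  (Matrix.isUnit_iff_isUnit_det W).mp
    (Matrix.mulVec_surjective_iff_isUnit.mp (mulVec_surjective_of_rank h))

lemma mulVL_pow {a : ℕ} (A : Matrix (Fin a) (Fin a) ℝ) (k : ℕ) :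
    mulVL (A ^ k) = mulVL A ^ k := by
  induction k with
  | zero =>
    ext v
    simp [mulVL_apply, mulV_one]
  | succ k ih =>
    ext1 v
    rw [pow_succ, pow_succ, mulVL_apply, mulV_mul, ← mulVL_apply, ih]
    rfl

/-- A functional that annihilates all reachable directions `Âᵏ E u` vanishes. -/
lemma eq_zero_of_controllable {n r : ℕ} {A : Matrix (Fin n) (Fin n) ℝ}
    {E : Matrix (Fin n) (Fin r) ℝ}
    (hrank : (Matrix.of fun (i : Fin n) (p : Fin n × Fin r) => (A ^ (p.1 : ℕ) * E) i p.2).rank = n)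
    {η : Vec n} (h : ∀ (k : ℕ) (u : Vec r), inner ℝ η ((mulVL A ^ k) (mulVL E u)) = 0) : η = 0 := by
  obtain ⟨x, hx⟩ := mulVec_surjective_of_rank hrank η.ofLp
  have h1 : ∑ i, η i * η i = 0 := by
    have e : ∀ p : Fin n × Fin r, ∑ i, η i * (A ^ (p.1 : ℕ) * E) i p.2 = 0 := by
      intro p
      have h2 := h p.1 (EuclideanSpace.single p.2 1)
      rw [← mulVL_pow, mulVL_apply, mulVL_apply, ← mulV_mul, mulV] at h2
      simpa [PiLp.inner_apply, mul_comm] using h2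
    have hη : ∀ i, η i = ∑ p : Fin n × Fin r, (A ^ (p.1 : ℕ) * E) i p.2 * x p := by
      intro i
      rw [← congrFun hx i]
      rfl
    calc ∑ i, η i * η i = ∑ i, ∑ p : Fin n × Fin r, η i * (A ^ (p.1 : ℕ) * E) i p.2 * x p := by
          refine Finset.sum_congr rfl fun i _ => ?_
          calc η i * η i = η i * ∑ p : Fin n × Fin r, (A ^ (p.1 : ℕ) * E) i p.2 * x p := by
                rw [← hη i]
            _ = _ := by
                rw [Finset.mul_sum]
                exact Finset.sum_congr rfl fun p _ => (mul_assoc _ _ _).symm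
      _ = 0 := by
          rw [Finset.sum_comm]
          refine Finset.sum_eq_zero fun p _ => ?_
          rw [← Finset.sum_mul, e p, zero_mul]
  have h3 : inner ℝ η η = 0 := by
    rw [PiLp.inner_apply]
    simpa [pow_two] using h1
  exact inner_self_eq_zero.mp h3

lemma hasDerivAt_exp_apply {n : ℕ} (a : Vec n →L[ℝ] Vec n) (v : Vec n) (t : ℝ) :
    HasDerivAt (fun s : ℝ => NormedSpace.exp (s • a) v) (NormedSpace.exp (t • a) (a v)) t := by
  have h := (hasDerivAt_exp_smul_const (𝕂 := ℝ) a t).clm_apply (hasDerivAt_const t v)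
  simpa using h

lemma exp_smul_mul_exp_smul {n : ℕ} (a : Vec n →L[ℝ] Vec n) (s t : ℝ) :
    NormedSpace.exp (s • a) * NormedSpace.exp (t • a) = NormedSpace.exp ((s + t) • a) := by
  let _ : NormedAlgebra ℚ (Vec n →L[ℝ] Vec n) := NormedAlgebra.restrictScalars ℚ ℝ _
  have hc : Commute (s • a) (t • a) := by
    ext1 v
    simp [mul_comm s t, smul_smul]
  have h : (s + t) • a = s • a + t • a := add_smul s t a
  rw [← NormedSpace.exp_add_of_commute hc, h]

lemma exp_zero_smul {n : ℕ} (a : Vec n →L[ℝ] Vec n) : NormedSpace.exp ((0 : ℝ) • a) = 1 := by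
  have h : (0 : ℝ) • a = 0 := zero_smul ℝ a
  rw [h, NormedSpace.exp_zero]

lemma continuous_exp_smul {n : ℕ} (a : Vec n →L[ℝ] Vec n) :
    Continuous fun s : ℝ => NormedSpace.exp (s • a) :=
  continuous_iff_continuousAt.mpr fun t => (hasDerivAt_exp_smul_const (𝕂 := ℝ) a t).continuousAt

/-- If `⟨η, exp(τ a) v⟩` vanishes for `τ` in an interval `(0,T)` then all `⟨η, aᵏ v⟩` vanish. -/
lemma inner_pow_eq_zero {n : ℕ} {a : Vec n →L[ℝ] Vec n} {η v : Vec n} {T : ℝ} (hT : 0 < T)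
    (h : ∀ τ ∈ Ioo 0 T, inner ℝ η (NormedSpace.exp (τ • a) v) = 0) (k : ℕ) :
    inner ℝ η ((a ^ k) v) = 0 := by
  have h1 : ∀ k : ℕ, ∀ τ ∈ Ioo 0 T, inner ℝ η (NormedSpace.exp (τ • a) ((a ^ k) v)) = 0 := by
    intro k
    induction k with
    | zero => simpa using h
    | succ k ih =>
      intro τ hτ
      have hd : HasDerivAt (fun s : ℝ => inner ℝ η (NormedSpace.exp (s • a) ((a ^ k) v)))
          (inner ℝ η (NormedSpace.exp (τ • a) (a ((a ^ k) v)))) τ := by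
        exact (innerSL ℝ η).hasFDerivAt.comp_hasDerivAt τ
          (hasDerivAt_exp_apply a ((a ^ k) v) τ)
      have h0 : HasDerivAt (fun s : ℝ => inner ℝ η (NormedSpace.exp (s • a) ((a ^ k) v))) 0 τ := by
        refine (hasDerivAt_const τ (0 : ℝ)).congr_of_eventuallyEq ?_
        filter_upwards [isOpen_Ioo.mem_nhds hτ] with s hs using ih s hs
      rw [pow_succ']
      exact hd.unique h0
  have hcont : Continuous fun s : ℝ => inner ℝ η (NormedSpace.exp (s • a) ((a ^ k) v)) :=
    continuous_const.inner ((continuous_exp_smul a).clm_apply continuous_const)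
  have hcl : (0 : ℝ) ∈ closure (Ioo 0 T) := by
    rw [closure_Ioo hT.ne]
    exact left_mem_Icc.mpr hT.le
  have h2 : inner ℝ η (NormedSpace.exp ((0 : ℝ) • a) ((a ^ k) v)) = 0 :=
    closure_minimal (s := Ioo 0 T)
      (t := {s | inner ℝ η (NormedSpace.exp (s • a) ((a ^ k) v)) = 0})
      (h1 k) (isClosed_eq hcont continuous_const) hcl
  rw [exp_zero_smul] at h2
  exact h2

lemma memLp_of_continuous {T : ℝ} {k : ℕ} {g : ℝ → Vec k} (hg : Continuous g) :
    MemLp g 2 (timeMeasure T) := by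
  obtain ⟨C, hC⟩ := isCompact_Icc.exists_bound_of_continuousOn (s := Icc 0 T) hg.continuousOn
  refine MemLp.of_bound hg.aestronglyMeasurable C ?_
  filter_upwards [ae_restrict_mem (measurableSet_Ioo : MeasurableSet (Ioo 0 T))] with t ht
  exact hC t (Ioo_subset_Icc_self ht)

lemma prim_eq_intervalIntegral {T : ℝ} {k : ℕ} {v : L2 T k} {g : ℝ → Vec k}
    (hv : ∀ᵐ t ∂timeMeasure T, v t = g t) {t : ℝ} (ht : t ∈ Icc 0 T) :
    prim v t = ∫ s in (0 : ℝ)..t, g s := by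
  rw [prim, setIntL_apply, intervalIntegral.integral_of_le ht.1,
    integral_congr_ae (ae_restrict_of_ae hv), timeMeasure,
    Measure.restrict_congr_set (Ioo_ae_eq_Ioc (μ := volume) (a := (0 : ℝ)) (b := T)),
    Measure.restrict_restrict measurableSet_Iic]
  congr 2
  ext x
  simp only [mem_inter_iff, mem_Iic, mem_Ioc]
  exact ⟨fun h => ⟨h.2.1, h.1⟩, fun h => ⟨h.2, h.1, h.2.trans ht.2⟩⟩

/-- The variation of constants formula: the state at time `T` driven by a continuous input. -/
lemma exists_state {T : ℝ} (hT : 0 < T) {n : ℕ} (A : Matrix (Fin n) (Fin n) ℝ) {g : ℝ → Vec n}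
    (hg : Continuous g) :
    ∃ x : L2 T n, x = volterra T hT.le id measurable_id
        (matL T A x + (memLp_of_continuous hg).toLp g) ∧
      intL T (matL T A x + (memLp_of_continuous hg).toLp g) = ∫ s in (0 : ℝ)..T,
        (NormedSpace.exp (T • mulVL A) * NormedSpace.exp ((-s) • mulVL A)) (g s) := by
  set a := mulVL A with ha
  have hinv : ∀ t : ℝ, NormedSpace.exp (t • a) * NormedSpace.exp ((-t) • a) = 1 := by
    intro t
    rw [exp_smul_mul_exp_smul, add_neg_cancel, exp_zero_smul]
  have hk : Continuous fun s : ℝ => NormedSpace.exp ((-s) • a) (g s) :=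
    ((continuous_exp_smul a).comp continuous_neg).clm_apply hg
  set X : ℝ → Vec n := fun t => NormedSpace.exp (t • a)
    (∫ s in (0 : ℝ)..t, NormedSpace.exp ((-s) • a) (g s)) with hX
  have hXd : ∀ t, HasDerivAt X (a (X t) + g t) t := by
    intro t
    have h1 := (hasDerivAt_exp_smul_const' (𝕂 := ℝ) a t).clm_apply
      (intervalIntegral.integral_hasDerivAt_right (hk.intervalIntegrable 0 t)
        (hk.stronglyMeasurableAtFilter _ _) hk.continuousAt)
    have h2 : NormedSpace.exp (t • a) (NormedSpace.exp ((-t) • a) (g t)) = g t :=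
      DFunLike.congr_fun (hinv t) (g t)
    rw [h2] at h1
    exact h1
  have hXc : Continuous X := continuous_iff_continuousAt.mpr fun t => (hXd t).continuousAt
  have hder : Continuous fun t => a (X t) + g t := (a.continuous.comp hXc).add hg
  have hX0 : X 0 = 0 := by simp [hX]
  have hftc : ∀ t, ∫ s in (0 : ℝ)..t, (a (X s) + g s) = X t := by
    intro t
    rw [intervalIntegral.integral_eq_sub_of_hasDerivAt (fun s _ => hXd s)
      (hder.intervalIntegrable _ _), hX0, sub_zero]
  set x : L2 T n := (memLp_of_continuous hXc).toLp X with hx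
  have hae : ∀ᵐ t ∂timeMeasure T, (matL T A x + (memLp_of_continuous hg).toLp g : L2 T n) t =
      a (X t) + g t := by
    filter_upwards [Lp.coeFn_add (matL T A x) ((memLp_of_continuous hg).toLp g), coeFn_matL A x,
      (memLp_of_continuous (T := T) hXc).coeFn_toLp, (memLp_of_continuous (T := T) hg).coeFn_toLp]
      with t h1 h2 h3 h4
    rw [h1, Pi.add_apply, h2, h4, hx, h3]
    rfl
  refine ⟨x, Lp.ext ?_, ?_⟩
  · filter_upwards [(memLp_of_continuous (T := T) hXc).coeFn_toLp, coeFn_volterra hT.le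
      measurable_id (matL T A x + (memLp_of_continuous hg).toLp g),
      ae_restrict_mem (measurableSet_Ioo : MeasurableSet (Ioo 0 T))] with t h1 h2 h3
    rw [h2, id, prim_eq_intervalIntegral hae (Ioo_subset_Icc_self h3), hftc, hx, h1]
  · rw [← prim_of_ge _ le_rfl, prim_eq_intervalIntegral hae (right_mem_Icc.mpr hT.le), hftc]
    change NormedSpace.exp (T • a) (∫ s in (0 : ℝ)..T, NormedSpace.exp ((-s) • a) (g s)) = _
    rw [← ContinuousLinearMap.intervalIntegral_comp_comm _ (hk.intervalIntegrable _ _)]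
    rfl

/-- Under the rank condition every terminal state can be reached from `0`. A vector `η` orthogonal to
the reachable states satisfies `⟨η, exp(τA) E u⟩ = 0` for all `τ` and `u`, as the input
`w(s) = (exp((T-s)A) E)ᵀ η` shows, and so it vanishes. -/
theorem surjective_terminal {T : ℝ} (hT : 0 < T) {n r : ℕ} {A : Matrix (Fin n) (Fin n) ℝ}
    {E : Matrix (Fin n) (Fin r) ℝ}
    (hrank : (Matrix.of fun (i : Fin n) (p : Fin n × Fin r) => (A ^ (p.1 : ℕ) * E) i p.2).rank = n)
    (Λ : L2 T r →ₗ[ℝ] Vec n)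
    (hΛ : ∀ (w : L2 T r) (x : L2 T n), x = volterra T hT.le id measurable_id
      (matL T A x + matL T E w) → Λ w = intL T (matL T A x + matL T E w)) :
    Function.Surjective Λ := by
  rw [← LinearMap.range_eq_top, ← Submodule.orthogonal_eq_bot_iff, Submodule.eq_bot_iff]
  intro η hη
  set a := mulVL A with ha
  set U : ℝ → Vec n →L[ℝ] Vec n := fun s =>
    NormedSpace.exp (T • a) * NormedSpace.exp ((-s) • a) with hU
  have hUc : Continuous U :=
    continuous_const.mul ((continuous_exp_smul a).comp continuous_neg)
  -- The input along the adjoint direction of `η`.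
  set w₀ : ℝ → Vec r := fun s => ContinuousLinearMap.adjoint ((U s).comp (mulVL E)) η with hw₀
  have hw₀c : Continuous w₀ := by
    have h1 : Continuous fun s => (U s).comp (mulVL E) := hUc.clm_comp continuous_const
    exact ((ContinuousLinearMap.adjoint (𝕜 := ℝ) (E := Vec r) (F := Vec n)).continuous.comp
      h1).clm_apply continuous_const
  have hinner : ∀ s u, inner ℝ η (U s (mulVL E u)) = inner ℝ (w₀ s) u := fun s u =>
    (ContinuousLinearMap.adjoint_inner_left ((U s).comp (mulVL E)) u η).symm
  have hgc : Continuous fun s => mulVL E (w₀ s) := (mulVL E).continuous.comp hw₀c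
  obtain ⟨x, hx, hterm⟩ := exists_state hT A hgc
  have hE : matL T E ((memLp_of_continuous hw₀c).toLp w₀) =
      (memLp_of_continuous (T := T) hgc).toLp fun s => mulVL E (w₀ s) := by
    refine Lp.ext ?_
    filter_upwards [coeFn_matL E ((memLp_of_continuous (T := T) hw₀c).toLp w₀),
      (memLp_of_continuous (T := T) hw₀c).coeFn_toLp,
      (memLp_of_continuous (T := T) hgc).coeFn_toLp] with t h1 h2 h3
    rw [h1, h2, h3]
    rfl
  rw [← hE] at hx hterm
  have hval := hΛ _ x hx
  rw [hterm] at hval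
  have h0 : inner ℝ η (Λ ((memLp_of_continuous hw₀c).toLp w₀)) = 0 := by
    rw [real_inner_comm]
    exact hη _ ⟨_, rfl⟩
  have hcont2 : Continuous fun s => U s (mulVL E (w₀ s)) := hUc.clm_apply hgc
  have hsq : ∫ s in (0 : ℝ)..T, ‖w₀ s‖ ^ 2 = 0 := by
    rw [hval] at h0
    have h1 : ∫ s in (0 : ℝ)..T, inner ℝ η (U s (mulVL E (w₀ s))) =
        inner ℝ η (∫ s in (0 : ℝ)..T, U s (mulVL E (w₀ s))) :=
      ContinuousLinearMap.intervalIntegral_comp_comm (innerSL ℝ η : Vec n →L[ℝ] ℝ)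
        (hcont2.intervalIntegrable (μ := volume) 0 T)
    refine Eq.trans (Eq.trans ?_ h1) h0
    refine intervalIntegral.integral_congr fun s _ => ?_
    rw [hinner, real_inner_self_eq_norm_sq]
  have hw0 : ∀ s ∈ Icc 0 T, w₀ s = 0 := by
    intro s hs
    by_contra hne
    refine hsq.not_gt (intervalIntegral.integral_pos hT (by fun_prop)
      (fun _ _ => sq_nonneg _) ⟨s, hs, ?_⟩)
    exact pow_pos (norm_pos_iff.mpr hne) 2
  refine eq_zero_of_controllable hrank fun k u => inner_pow_eq_zero hT (fun τ hτ => ?_) k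
  have h1 := hinner (T - τ) u
  rw [hw0 (T - τ) ⟨by linarith [hτ.2], by linarith [hτ.1]⟩, inner_zero_left] at h1
  have h2 : U (T - τ) = NormedSpace.exp (τ • a) := by
    simp only [hU]
    rw [exp_smul_mul_exp_smul]
    congr 2
    ring
  rw [h2] at h1
  exact h1

/-! ### The matrix identities behind the slack variables -/

section MatrixIdentities

variable {n m l k : ℕ} {Ξ : Type*} {P : ControlProblem n m l k Ξ}
  {Y : Matrix (Fin m) (Fin (m - l)) ℝ}

/-- The pseudoinverse `D† = Dᵀ (D Dᵀ)⁻¹`. -/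
def pinvD (P : ControlProblem n m l k Ξ) : Matrix (Fin m) (Fin l) ℝ := P.Dᵀ * (P.D * P.Dᵀ)⁻¹

/-- The left inverse `(Yᵀ Y)⁻¹ Yᵀ`. -/
def leftInv {a b : ℕ} (Y : Matrix (Fin a) (Fin b) ℝ) : Matrix (Fin b) (Fin a) ℝ :=
  (Yᵀ * Y)⁻¹ * Yᵀ

lemma D_mul_pinvD (h : P.Controllable Y) : P.D * pinvD P = 1 := by
  have h1 : IsUnit (P.D * P.Dᵀ).det := isUnit_det_of_rank (by
    rw [Matrix.rank_self_mul_transpose, h.rank_D])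
  rw [pinvD, ← Matrix.mul_assoc, Matrix.mul_nonsing_inv _ h1]

lemma leftInv_mul (h : P.Controllable Y) : leftInv Y * Y = 1 := by
  have h1 : IsUnit (Yᵀ * Y).det := isUnit_det_of_rank (by
    rw [Matrix.rank_transpose_mul_self, h.rank_Y])
  rw [leftInv, Matrix.mul_assoc, Matrix.nonsing_inv_mul _ h1]

lemma leftInv_mul_pinvD (h : P.Controllable Y) : leftInv Y * pinvD P = 0 := by
  have h1 : Yᵀ * P.Dᵀ = 0 := by rw [← Matrix.transpose_mul, h.D_mul_Y, Matrix.transpose_zero]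
  rw [leftInv, pinvD, Matrix.mul_assoc, ← Matrix.mul_assoc Yᵀ, h1, Matrix.zero_mul,
    Matrix.mul_zero]

/-- Every control splits into the part seen by `D` and a part in the range of `Y`. -/
lemma pinvD_mul_add (h : P.Controllable Y) : pinvD P * P.D + Y * leftInv Y = 1 := by
  have h1 : Matrix.fromRows P.D (leftInv Y) * Matrix.fromCols (pinvD P) Y = 1 := by
    rw [Matrix.fromRows_mul_fromCols, D_mul_pinvD h, h.D_mul_Y, leftInv_mul_pinvD h,
      leftInv_mul h, Matrix.fromBlocks_one]
  have h2 : Matrix.fromCols (pinvD P) Y * Matrix.fromRows P.D (leftInv Y) = 1 :=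
    (Matrix.mul_eq_one_comm_of_card_eq _ _ _ (by
      have := h.lt
      simp
      omega)).mp h1
  rwa [Matrix.fromCols_mul_fromRows] at h2

end MatrixIdentities

/-! ### The optimal control problem in slack variables -/

namespace ControlProblem

variable {n m l k : ℕ} {Ξ : Type*} (P : ControlProblem n m l k Ξ)
  (Y : Matrix (Fin m) (Fin (m - l)) ℝ)

/-- The new unknowns: the slack `s = Cx + Du - f` and the free part `w` of the control. -/
abbrev Slack : Type := L2 P.T l × L2 P.T (m - l)

/-- The operator `(1 - V Â)⁻¹` with `Â = A - B D† C`. Here and below `V` is the integration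
operator or a time discretisation of it. -/
def resolvent (V : L2 P.T n →L[ℝ] L2 P.T n) : L2 P.T n →L[ℝ] L2 P.T n :=
  Ring.inverse (1 - V.comp (matL P.T P.reducedA))

/-- The linear part of the map from the slack variables to the state. -/
def stateLin (V : L2 P.T n →L[ℝ] L2 P.T n) : P.Slack →L[ℝ] L2 P.T n :=
  ((P.resolvent V).comp V).comp
    ((matL P.T (P.B * pinvD P)).comp (ContinuousLinearMap.fst ℝ _ _) +
      (matL P.T (P.B * Y)).comp (ContinuousLinearMap.snd ℝ _ _))

/-- The state that belongs to vanishing slack variables. -/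
def stateConst (V : L2 P.T n →L[ℝ] L2 P.T n) (f : L2 P.T l) : L2 P.T n :=
  P.resolvent V (constFn P.T P.x₀ + V (matL P.T (P.B * pinvD P) f))

/-- The linear part of the map from the slack variables to the control. -/
def controlLin (V : L2 P.T n →L[ℝ] L2 P.T n) : P.Slack →L[ℝ] L2 P.T m :=
  (matL P.T (pinvD P)).comp
      (ContinuousLinearMap.fst ℝ _ _ - (matL P.T P.C).comp (P.stateLin Y V)) +
    (matL P.T Y).comp (ContinuousLinearMap.snd ℝ _ _)

/-- The control that belongs to vanishing slack variables. -/
def controlConst (V : L2 P.T n →L[ℝ] L2 P.T n) (f : L2 P.T l) : L2 P.T m :=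
  matL P.T (pinvD P) (f - matL P.T P.C (P.stateConst V f))

/-- The linear part of the map from the slack variables to the right-hand side `Ax + Bu`. -/
def rateLin (V : L2 P.T n →L[ℝ] L2 P.T n) : P.Slack →L[ℝ] L2 P.T n :=
  (matL P.T P.A).comp (P.stateLin Y V) + (matL P.T P.B).comp (P.controlLin Y V)

/-- The right-hand side `Ax + Bu` that belongs to vanishing slack variables. -/
def rateConst (V : L2 P.T n →L[ℝ] L2 P.T n) (f : L2 P.T l) : L2 P.T n :=
  matL P.T P.A (P.stateConst V f) + matL P.T P.B (P.controlConst V f)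

/-- The state in terms of the slack variables. -/
def stateOf (V : L2 P.T n →L[ℝ] L2 P.T n) (f : L2 P.T l) (y : P.Slack) : L2 P.T n :=
  P.stateLin Y V y + P.stateConst V f

/-- The control in terms of the slack variables. -/
def controlOf (V : L2 P.T n →L[ℝ] L2 P.T n) (f : L2 P.T l) (y : P.Slack) : L2 P.T m :=
  P.controlLin Y V y + P.controlConst V f

/-- The right-hand side `Ax + Bu` in terms of the slack variables. -/
def rateOf (V : L2 P.T n →L[ℝ] L2 P.T n) (f : L2 P.T l) (y : P.Slack) : L2 P.T n :=
  P.rateLin Y V y + P.rateConst V f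

lemma rateOf_eq (V : L2 P.T n →L[ℝ] L2 P.T n) (f : L2 P.T l) (y : P.Slack) :
    P.rateOf Y V f y = matL P.T P.A (P.stateOf Y V f y) + matL P.T P.B (P.controlOf Y V f y) := by
  simp only [rateOf, rateLin, rateConst, stateOf, controlOf, map_add, add_apply,
    ContinuousLinearMap.comp_apply]
  abel

lemma controlOf_eq (V : L2 P.T n →L[ℝ] L2 P.T n) (f : L2 P.T l) (y : P.Slack) :
    P.controlOf Y V f y = matL P.T (pinvD P) (y.1 + f - matL P.T P.C (P.stateOf Y V f y)) +
      matL P.T Y y.2 := by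
  simp only [controlOf, controlLin, controlConst, stateOf, map_add, map_sub, add_apply, sub_apply,
    ContinuousLinearMap.comp_apply, ContinuousLinearMap.coe_fst', ContinuousLinearMap.coe_snd']
  abel

/-- Eliminating the control turns the drift `Ax + Bu` into `Âx` plus terms in the slack variables. -/
lemma drift_eq (x : L2 P.T n) (s : L2 P.T l) (w : L2 P.T (m - l)) :
    matL P.T P.reducedA x + (matL P.T (P.B * pinvD P) s + matL P.T (P.B * Y) w) =
      matL P.T P.A x + matL P.T P.B (matL P.T (pinvD P) (s - matL P.T P.C x) + matL P.T Y w) := by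
  have h1 : matL P.T P.A x =
      matL P.T P.reducedA x + matL P.T P.B (matL P.T (pinvD P) (matL P.T P.C x)) := by
    rw [← matL_mul, ← matL_mul, ← matL_add]
    congr 2
    rw [reducedA, pinvD]
    simp only [Matrix.mul_assoc, sub_add_cancel]
  rw [h1, matL_mul, matL_mul]
  simp only [map_add, map_sub]
  abel

variable {P}

lemma resolvent_eq_iff {V : L2 P.T n →L[ℝ] L2 P.T n}
    (hV : IsUnit (1 - V.comp (matL P.T P.reducedA))) {x v : L2 P.T n} :
    x = P.resolvent V v ↔ x = v + V (matL P.T P.reducedA x) := by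
  have h1 := Ring.inverse_mul_cancel _ hV
  have h2 := Ring.mul_inverse_cancel _ hV
  constructor
  · intro h
    have h3 : (1 - V.comp (matL P.T P.reducedA)) (P.resolvent V v) = v :=
      DFunLike.congr_fun h2 v
    rw [← h] at h3
    rw [← h3]
    simp
  · intro h
    have h3 : P.resolvent V ((1 - V.comp (matL P.T P.reducedA)) x) = x :=
      DFunLike.congr_fun h1 x
    rw [← h3]
    congr 1
    change x - V (matL P.T P.reducedA x) = v
    exact sub_eq_of_eq_add h

lemma eq_stateOf_iff {V : L2 P.T n →L[ℝ] L2 P.T n}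
    (hV : IsUnit (1 - V.comp (matL P.T P.reducedA))) {f : L2 P.T l} {y : P.Slack} {x : L2 P.T n} :
    x = P.stateOf Y V f y ↔ x = constFn P.T P.x₀ + V (matL P.T P.A x + matL P.T P.B
      (matL P.T (pinvD P) (y.1 + f - matL P.T P.C x) + matL P.T Y y.2)) := by
  have h : P.stateOf Y V f y = P.resolvent V (constFn P.T P.x₀ +
      V (matL P.T (P.B * pinvD P) (y.1 + f) + matL P.T (P.B * Y) y.2)) := by
    simp only [stateOf, stateLin, stateConst, map_add, add_apply, ContinuousLinearMap.comp_apply,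
      ContinuousLinearMap.coe_fst', ContinuousLinearMap.coe_snd']
    abel
  rw [h, resolvent_eq_iff hV, ← P.drift_eq Y, add_assoc, ← map_add,
    add_comm (matL P.T P.reducedA x)]

/-- The state solves the integral equation `x = x₀ + V(Ax + Bu)`. -/
lemma stateOf_eq {V : L2 P.T n →L[ℝ] L2 P.T n}
    (hV : IsUnit (1 - V.comp (matL P.T P.reducedA))) (f : L2 P.T l) (y : P.Slack) :
    P.stateOf Y V f y = constFn P.T P.x₀ + V (P.rateOf Y V f y) := by
  have h := (eq_stateOf_iff Y hV).mp (rfl : P.stateOf Y V f y = _)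
  rw [rateOf_eq, controlOf_eq]
  exact h

variable {Y}

lemma matL_D_controlOf (hY : P.Controllable Y) (V : L2 P.T n →L[ℝ] L2 P.T n) (f : L2 P.T l)
    (y : P.Slack) :
    matL P.T P.C (P.stateOf Y V f y) + matL P.T P.D (P.controlOf Y V f y) = y.1 + f := by
  rw [controlOf_eq, map_add, ← matL_mul, ← matL_mul, D_mul_pinvD hY, hY.D_mul_Y, matL_one,
    matL_zero]
  abel

/-- Every solution of the state equation arises from exactly these slack variables. -/
lemma stateOf_controlOf_of_eq (hY : P.Controllable Y) {V : L2 P.T n →L[ℝ] L2 P.T n}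
    (hV : IsUnit (1 - V.comp (matL P.T P.reducedA))) {f : L2 P.T l} {x : L2 P.T n} {u : L2 P.T m}
    (h : x = constFn P.T P.x₀ + V (matL P.T P.A x + matL P.T P.B u)) :
    P.stateOf Y V f (matL P.T P.C x + matL P.T P.D u - f, matL P.T (leftInv Y) u) = x ∧
    P.controlOf Y V f (matL P.T P.C x + matL P.T P.D u - f, matL P.T (leftInv Y) u) = u := by
  have h1 : matL P.T (pinvD P) (matL P.T P.C x + matL P.T P.D u - f + f - matL P.T P.C x) +
      matL P.T Y (matL P.T (leftInv Y) u) = u := by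
    rw [sub_add_cancel, add_sub_cancel_left, ← matL_mul, ← matL_mul, ← matL_add,
      pinvD_mul_add hY, matL_one]
  have h2 : P.stateOf Y V f (matL P.T P.C x + matL P.T P.D u - f, matL P.T (leftInv Y) u) = x :=
    ((eq_stateOf_iff Y hV).mpr (by
      simp only
      rw [h1]
      exact h)).symm
  refine ⟨h2, ?_⟩
  rw [controlOf_eq, h2, h1]

/-- The slack variables are controlled by the state and the control, uniformly in the integration
operator. -/
lemma norm_slack_le (hY : P.Controllable Y) (V : L2 P.T n →L[ℝ] L2 P.T n) (y : P.Slack) :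
    ‖y‖ ≤ (‖matL P.T P.C‖ + ‖matL P.T P.D‖ + ‖matL P.T (leftInv Y)‖) *
      (‖P.stateLin Y V y‖ + ‖P.controlLin Y V y‖) := by
  set x := P.stateLin Y V y with hx
  set u := P.controlLin Y V y with hu
  have hu' : u = matL P.T (pinvD P) (y.1 - matL P.T P.C x) + matL P.T Y y.2 := rfl
  have h1 : y.1 = matL P.T P.C x + matL P.T P.D u := by
    rw [hu', map_add, ← matL_mul, ← matL_mul, D_mul_pinvD hY, hY.D_mul_Y, matL_one, matL_zero]
    abel
  have h2 : y.2 = matL P.T (leftInv Y) u := by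
    rw [hu', map_add, ← matL_mul, ← matL_mul, leftInv_mul_pinvD hY, leftInv_mul hY, matL_one,
      matL_zero, zero_add]
  have hC := (matL P.T P.C).le_opNorm x
  have hD := (matL P.T P.D).le_opNorm u
  have hW := (matL P.T (leftInv Y)).le_opNorm u
  have h3 : ‖y.1‖ ≤ ‖matL P.T P.C‖ * ‖x‖ + ‖matL P.T P.D‖ * ‖u‖ := by
    rw [h1]
    exact (norm_add_le _ _).trans (add_le_add hC hD)
  rw [← h2] at hW
  have n1 := norm_nonneg x
  have n2 := norm_nonneg u
  have n3 := norm_nonneg (matL P.T P.C)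
  have n4 := norm_nonneg (matL P.T P.D)
  have n5 := norm_nonneg (matL P.T (leftInv Y))
  refine max_le ?_ ?_
  · nlinarith [mul_nonneg n3 n2, mul_nonneg n4 n1, mul_nonneg n5 n1, mul_nonneg n5 n2]
  · nlinarith [mul_nonneg n3 n2, mul_nonneg n4 n1, mul_nonneg n5 n1, mul_nonneg n3 n1,
      mul_nonneg n4 n2]

variable (P Y)

/-- The tracking problem for a given terminal state as a least squares problem: the constraint is
that the terminal state `x₀ + ∫(Ax + Bu)` is prescribed, and half the squared norm of the residual
is `½‖x - x_d‖² + (δ/2)‖u - u_d‖²`. -/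
def trackingLS (V : L2 P.T n →L[ℝ] L2 P.T n) (f : L2 P.T l) (xd : L2 P.T n) (ud : L2 P.T m) :
    LeastSquares P.Slack (WithLp 2 (L2 P.T n × L2 P.T m)) (Vec n) where
  L := (intL P.T).comp (P.rateLin Y V)
  c := P.x₀ + intL P.T (P.rateConst V f)
  G := ((WithLp.prodContinuousLinearEquiv 2 ℝ (L2 P.T n) (L2 P.T m)).symm :
      L2 P.T n × L2 P.T m →L[ℝ] WithLp 2 (L2 P.T n × L2 P.T m)).comp
    ((P.stateLin Y V).prod (√P.δ • P.controlLin Y V))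
  b := (WithLp.prodContinuousLinearEquiv 2 ℝ (L2 P.T n) (L2 P.T m)).symm
    (xd - P.stateConst V f, √P.δ • (ud - P.controlConst V f))

lemma trackingLS_terminal (V : L2 P.T n →L[ℝ] L2 P.T n) (f : L2 P.T l) (xd : L2 P.T n)
    (ud : L2 P.T m) (y : P.Slack) :
    (P.trackingLS Y V f xd ud).L y + (P.trackingLS Y V f xd ud).c =
      P.x₀ + intL P.T (P.rateOf Y V f y) := by
  simp only [trackingLS, rateOf, map_add, ContinuousLinearMap.comp_apply]
  abel

lemma norm_res_trackingLS_sq (hδ : 0 < P.δ) (V : L2 P.T n →L[ℝ] L2 P.T n) (f : L2 P.T l)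
    (xd : L2 P.T n) (ud : L2 P.T m) (y : P.Slack) :
    ‖(P.trackingLS Y V f xd ud).res y‖ ^ 2 =
      ‖P.stateOf Y V f y - xd‖ ^ 2 + P.δ * ‖P.controlOf Y V f y - ud‖ ^ 2 := by
  rw [WithLp.prod_norm_sq_eq_of_L2]
  have h1 : ((P.trackingLS Y V f xd ud).res y).fst = P.stateOf Y V f y - xd := by
    change P.stateLin Y V y - (xd - P.stateConst V f) = _
    rw [stateOf]
    abel
  have h2 : ((P.trackingLS Y V f xd ud).res y).snd = √P.δ • (P.controlOf Y V f y - ud) := by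
    change √P.δ • P.controlLin Y V y - √P.δ • (ud - P.controlConst V f) = _
    rw [controlOf, ← smul_sub]
    congr 1
    abel
  rw [h1, h2, norm_smul, mul_pow, Real.norm_of_nonneg (Real.sqrt_nonneg _),
    Real.sq_sqrt hδ.le]

variable {Y}

lemma exists_trackingLS_bound (hδ : 0 < P.δ) (hY : P.Controllable Y) :
    ∃ γ : ℝ, 0 < γ ∧ ∀ V f xd ud y, γ * ‖y‖ ≤ ‖(P.trackingLS Y V f xd ud).G y‖ := by
  set K := ‖matL P.T P.C‖ + ‖matL P.T P.D‖ + ‖matL P.T (leftInv Y)‖ with hK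
  have hs := Real.sqrt_pos.mpr hδ
  have hK0 : 0 ≤ K := by positivity
  have hpos : 0 < (K + 1) * (1 + 1 / √P.δ) := by positivity
  refine ⟨1 / ((K + 1) * (1 + 1 / √P.δ)), by positivity, fun V f xd ud y => ?_⟩
  rw [one_div, inv_mul_le_iff₀ hpos]
  have h0 := P.norm_slack_le hY V y
  set g := (P.trackingLS Y V f xd ud).G y with hg
  have h1 : ‖g‖ ^ 2 = ‖P.stateLin Y V y‖ ^ 2 + ‖√P.δ • P.controlLin Y V y‖ ^ 2 :=
    WithLp.prod_norm_sq_eq_of_L2 _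
  have hx : ‖P.stateLin Y V y‖ ≤ ‖g‖ := by
    refine abs_le_of_sq_le_sq' ?_ (norm_nonneg _) |>.2
    nlinarith [sq_nonneg ‖√P.δ • P.controlLin Y V y‖]
  have hu : ‖√P.δ • P.controlLin Y V y‖ ≤ ‖g‖ := by
    refine abs_le_of_sq_le_sq' ?_ (norm_nonneg _) |>.2
    nlinarith [sq_nonneg ‖P.stateLin Y V y‖]
  rw [norm_smul, Real.norm_of_nonneg hs.le, mul_comm, ← le_div_iff₀ hs] at hu
  calc ‖y‖ ≤ K * (‖P.stateLin Y V y‖ + ‖P.controlLin Y V y‖) := h0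
    _ ≤ (K + 1) * (‖g‖ + ‖g‖ / √P.δ) := by
        have := norm_nonneg (P.stateLin Y V y)
        have := norm_nonneg (P.controlLin Y V y)
        gcongr
        linarith
    _ = (K + 1) * (1 + 1 / √P.δ) * ‖g‖ := by ring

/-- Controllability yields a right inverse of the terminal map with values in the directions that
leave the slack unchanged. -/
lemma exists_terminal_right_inverse (hT : 0 < P.T) (hY : P.Controllable Y) :
    ∃ r : Vec n →L[ℝ] L2 P.T (m - l), ∀ z,
      intL P.T (P.rateLin Y (volterra P.T hT.le id measurable_id) (0, r z)) = z := by
  set V : L2 P.T n →L[ℝ] L2 P.T n := volterra P.T hT.le id measurable_id with hVdef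
  have hV : IsUnit (1 - V.comp (matL P.T P.reducedA)) := isUnit_one_sub_volterra hT.le _
  let Λ : L2 P.T (m - l) →ₗ[ℝ] Vec n :=
    (((intL P.T).comp (P.rateLin Y V)).comp
      (ContinuousLinearMap.inr ℝ (L2 P.T l) (L2 P.T (m - l)))).toLinearMap
  have hsurj : Function.Surjective Λ := by
    refine surjective_terminal hT hY.rank_controllability Λ fun w x hx => ?_
    have hx' : P.stateLin Y V (0, w) = x := by
      refine ((resolvent_eq_iff hV
        (v := V (matL P.T (P.B * pinvD P) 0 + matL P.T (P.B * Y) w))).mpr ?_).symm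
      rw [map_zero, zero_add, add_comm, ← map_add]
      exact hx
    change intL P.T (P.rateLin Y V (0, w)) = _
    congr 1
    have h := P.drift_eq Y (P.stateLin Y V (0, w)) 0 w
    rw [map_zero, zero_add, hx'] at h
    rw [h, ← hx']
    rfl
  obtain ⟨g, hg⟩ := LinearMap.exists_rightInverse_of_surjective Λ
    (LinearMap.range_eq_top.mpr hsurj)
  refine ⟨LinearMap.toContinuousLinearMap g, fun z => ?_⟩
  exact LinearMap.congr_fun hg z

section Continuity

variable (Y)

lemma continuousAt_resolvent {V₀ : L2 P.T n →L[ℝ] L2 P.T n}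
    (hV : IsUnit (1 - V₀.comp (matL P.T P.reducedA))) : ContinuousAt P.resolvent V₀ := by
  have h1 : ContinuousAt (Ring.inverse (M₀ := L2 P.T n →L[ℝ] L2 P.T n))
      (1 - V₀.comp (matL P.T P.reducedA)) := by
    obtain ⟨u, hu⟩ := hV
    rw [← hu]
    exact NormedRing.inverse_continuousAt u
  have h2 : ContinuousAt (fun V : L2 P.T n →L[ℝ] L2 P.T n =>
      1 - V.comp (matL P.T P.reducedA)) V₀ :=
    continuousAt_const.sub (continuousAt_id.clm_comp continuousAt_const)
  exact ContinuousAt.comp (f := fun V : L2 P.T n →L[ℝ] L2 P.T n =>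
    1 - V.comp (matL P.T P.reducedA)) h1 h2

lemma continuousAt_stateLin {V₀ : L2 P.T n →L[ℝ] L2 P.T n}
    (hV : IsUnit (1 - V₀.comp (matL P.T P.reducedA))) : ContinuousAt (P.stateLin Y) V₀ :=
  ((P.continuousAt_resolvent hV).clm_comp continuousAt_id).clm_comp continuousAt_const

lemma continuousAt_controlLin {V₀ : L2 P.T n →L[ℝ] L2 P.T n}
    (hV : IsUnit (1 - V₀.comp (matL P.T P.reducedA))) : ContinuousAt (P.controlLin Y) V₀ :=
  (continuousAt_const.clm_comp (continuousAt_const.sub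
    (continuousAt_const.clm_comp (P.continuousAt_stateLin Y hV)))).add continuousAt_const

lemma continuousAt_rateLin {V₀ : L2 P.T n →L[ℝ] L2 P.T n}
    (hV : IsUnit (1 - V₀.comp (matL P.T P.reducedA))) : ContinuousAt (P.rateLin Y) V₀ :=
  (continuousAt_const.clm_comp (P.continuousAt_stateLin Y hV)).add
    (continuousAt_const.clm_comp (P.continuousAt_controlLin Y hV))

lemma tendsto_clm_apply {ι E₁ E₂ : Type*} [NormedAddCommGroup E₁] [NormedSpace ℝ E₁]
    [NormedAddCommGroup E₂] [NormedSpace ℝ E₂] {F : Filter ι} {g : ι → E₁ →L[ℝ] E₂}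
    {g₀ : E₁ →L[ℝ] E₂} {x : ι → E₁} {x₀ : E₁} (hg : Tendsto g F (𝓝 g₀))
    (hx : Tendsto x F (𝓝 x₀)) : Tendsto (fun i => g i (x i)) F (𝓝 (g₀ x₀)) :=
  ((continuous_fst.clm_apply continuous_snd).tendsto (g₀, x₀)).comp (hg.prodMk_nhds hx)

variable {ι : Type*} {F : Filter ι} {V : ι → L2 P.T n →L[ℝ] L2 P.T n}
  {V₀ : L2 P.T n →L[ℝ] L2 P.T n} {f : ι → L2 P.T l} {f₀ : L2 P.T l}

lemma tendsto_stateConst (hV₀ : IsUnit (1 - V₀.comp (matL P.T P.reducedA)))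
    (hV : Tendsto V F (𝓝 V₀)) (hf : Tendsto f F (𝓝 f₀)) :
    Tendsto (fun i => P.stateConst (V i) (f i)) F (𝓝 (P.stateConst V₀ f₀)) := by
  have h1 := (P.continuousAt_resolvent hV₀).tendsto.comp hV
  have h2 := ((matL P.T (P.B * pinvD P)).continuous.tendsto f₀).comp hf
  exact tendsto_clm_apply h1 (tendsto_const_nhds.add (tendsto_clm_apply hV h2))

lemma tendsto_controlConst (hV₀ : IsUnit (1 - V₀.comp (matL P.T P.reducedA)))
    (hV : Tendsto V F (𝓝 V₀)) (hf : Tendsto f F (𝓝 f₀)) :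
    Tendsto (fun i => P.controlConst (V i) (f i)) F (𝓝 (P.controlConst V₀ f₀)) :=
  ((matL P.T (pinvD P)).continuous.tendsto _).comp (hf.sub
    (((matL P.T P.C).continuous.tendsto _).comp (P.tendsto_stateConst hV₀ hV hf)))

lemma tendsto_rateConst (hV₀ : IsUnit (1 - V₀.comp (matL P.T P.reducedA)))
    (hV : Tendsto V F (𝓝 V₀)) (hf : Tendsto f F (𝓝 f₀)) :
    Tendsto (fun i => P.rateConst (V i) (f i)) F (𝓝 (P.rateConst V₀ f₀)) :=
  (((matL P.T P.A).continuous.tendsto _).comp (P.tendsto_stateConst hV₀ hV hf)).add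
    (((matL P.T P.B).continuous.tendsto _).comp (P.tendsto_controlConst hV₀ hV hf))

variable {xd : ι → L2 P.T n} {xd₀ : L2 P.T n} {ud : ι → L2 P.T m} {ud₀ : L2 P.T m}

lemma tendsto_trackingLS (hV₀ : IsUnit (1 - V₀.comp (matL P.T P.reducedA)))
    (hV : Tendsto V F (𝓝 V₀)) (hf : Tendsto f F (𝓝 f₀)) (hx : Tendsto xd F (𝓝 xd₀))
    (hu : Tendsto ud F (𝓝 ud₀)) :
    Tendsto (fun i => (P.trackingLS Y (V i) (f i) (xd i) (ud i)).L) F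
      (𝓝 (P.trackingLS Y V₀ f₀ xd₀ ud₀).L) ∧
    Tendsto (fun i => (P.trackingLS Y (V i) (f i) (xd i) (ud i)).c) F
      (𝓝 (P.trackingLS Y V₀ f₀ xd₀ ud₀).c) ∧
    Tendsto (fun i => (P.trackingLS Y (V i) (f i) (xd i) (ud i)).G) F
      (𝓝 (P.trackingLS Y V₀ f₀ xd₀ ud₀).G) ∧
    Tendsto (fun i => (P.trackingLS Y (V i) (f i) (xd i) (ud i)).b) F
      (𝓝 (P.trackingLS Y V₀ f₀ xd₀ ud₀).b) := by
  have hcomp {E₁ E₂ E₃ : Type _} [NormedAddCommGroup E₁] [NormedSpace ℝ E₁]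
      [NormedAddCommGroup E₂] [NormedSpace ℝ E₂] [NormedAddCommGroup E₃] [NormedSpace ℝ E₃]
      (A : E₂ →L[ℝ] E₃) {g : ι → E₁ →L[ℝ] E₂} {g₀ : E₁ →L[ℝ] E₂} (h : Tendsto g F (𝓝 g₀)) :
      Tendsto (fun i => A.comp (g i)) F (𝓝 (A.comp g₀)) :=
    ((continuous_const.clm_comp continuous_id).tendsto g₀).comp h
  refine ⟨hcomp _ ((P.continuousAt_rateLin Y hV₀).tendsto.comp hV),
    tendsto_const_nhds.add (((intL P.T).continuous.tendsto _).comp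
      (P.tendsto_rateConst hV₀ hV hf)), ?_, ?_⟩
  · have h1 := (P.continuousAt_stateLin Y hV₀).tendsto.comp hV
    have h2 := ((P.continuousAt_controlLin Y hV₀).tendsto.comp hV).const_smul √P.δ
    have h3 := ((ContinuousLinearMap.prodₗᵢ (𝕜 := ℝ) (E := P.Slack) (F := L2 P.T n)
      (G := L2 P.T m) ℝ).continuous.tendsto _).comp (h1.prodMk_nhds h2)
    exact hcomp _ h3
  · have h1 := hx.sub (P.tendsto_stateConst hV₀ hV hf)
    have h2 := (hu.sub (P.tendsto_controlConst hV₀ hV hf)).const_smul √P.δ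
    exact ((WithLp.prodContinuousLinearEquiv 2 ℝ (L2 P.T n) (L2 P.T m)).symm.continuous.tendsto
      _).comp (h1.prodMk_nhds h2)

end Continuity

end ControlProblem

/-! ### The time-stepping problem in slack variables -/

lemma norm_stepFn_sq {T : ℝ} (hT : 0 < T) {N : ℕ} {k : ℕ} (d : Fin N → Vec k) :
    ‖stepFn T N d‖ ^ 2 = T / N * ∑ i, ‖d i‖ ^ 2 := by
  rw [← real_inner_self_eq_norm_sq, inner_stepFn, Finset.mul_sum]
  refine Finset.sum_congr rfl fun i _ => ?_
  rw [cellInt_stepFn hT, real_inner_smul_right, real_inner_self_eq_norm_sq]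

lemma prim_sub_grid {T : ℝ} (hT : 0 < T) {N : ℕ} {k : ℕ} (d : Fin N → Vec k) (i : Fin N) {t : ℝ}
    (ht : t ∈ cell T N i) :
    prim (stepFn T N d) t - prim (stepFn T N d) ((i : ℕ) * (T / N)) =
      (t - (i : ℕ) * (T / N)) • d i := by
  have hsub : Ioc ((i : ℕ) * (T / N)) t ⊆ cell T N i := Ioc_subset_Ioc_right ht.2
  rw [prim_sub_prim _ ht.1.le, setIntL_apply]
  have h1 : ∫ t in Ioc ((i : ℕ) * (T / N)) t, stepFn T N d t ∂timeMeasure T =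
      ∫ _ in Ioc ((i : ℕ) * (T / N)) t, d i ∂timeMeasure T := by
    refine setIntegral_congr_ae measurableSet_Ioc ?_
    filter_upwards [coeFn_stepFn hT d] with t ht hi using ht i (hsub hi)
  have h2 : (timeMeasure T).real (Ioc ((i : ℕ) * (T / N)) t) = t - (i : ℕ) * (T / N) := by
    have h3 : (timeMeasure T).restrict (Ioc ((i : ℕ) * (T / N)) t) =
        volume.restrict (Ioc ((i : ℕ) * (T / N)) t) := by
      rw [← inter_eq_left.mpr hsub, ← Measure.restrict_restrict measurableSet_Ioc,
        timeMeasure_restrict_cell hT i, Measure.restrict_restrict measurableSet_Ioc]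
    have h4 : (timeMeasure T) (Ioc ((i : ℕ) * (T / N)) t) = volume (Ioc ((i : ℕ) * (T / N)) t) := by
      rw [← Measure.restrict_apply_univ, h3, Measure.restrict_apply_univ]
    rw [measureReal_def, h4, Real.volume_Ioc, ENNReal.toReal_ofReal (sub_nonneg.mpr ht.1.le)]
  rw [h1, setIntegral_const, h2]

lemma cellInt_matL {T : ℝ} {N : ℕ} {a b : ℕ} (A : Matrix (Fin a) (Fin b) ℝ) (v : L2 T b) (i : ℕ) :
    cellInt T N (matL T A v) i = mulV A (cellInt T N v i) :=
  setIntL_matL _ A v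

lemma mulV_smul {a b : ℕ} (A : Matrix (Fin a) (Fin b) ℝ) (c : ℝ) (v : Vec b) :
    mulV A (c • v) = c • mulV A v := (mulVL A).map_smul c v

namespace ControlProblem

variable {n m l k : ℕ} {Ξ : Type*} (P : ControlProblem n m l k Ξ)
  (Y : Matrix (Fin m) (Fin (m - l)) ℝ)

/-- The slack variables with nonpositive slack. -/
def slackSet : Set P.Slack := {y | y.1 ∈ nonposSet P.T l}

lemma isClosed_slackSet : IsClosed P.slackSet :=
  (isClosed_nonposSet P.T l).preimage continuous_fst

lemma convex_slackSet : Convex ℝ P.slackSet :=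
  (convex_nonposSet P.T l).linear_preimage (LinearMap.fst ℝ _ _)

lemma zero_mem_slackSet : (0 : P.Slack) ∈ P.slackSet := zero_mem_nonposSet P.T l

/-- The constraints of the time-stepping problem other than those on the terminal state. -/
def DiscreteDynamics (N : ℕ) (d : Discrete n m N) : Prop :=
  d.1 0 = P.x₀ ∧
  (∀ i : Fin N, d.1 i.succ - d.1 i.castSucc =
    P.step N • mulV P.A (d.1 i.succ) + P.step N • mulV P.B (d.2 i)) ∧
  ∀ i : Fin N, ∀ j,
    (mulV P.C (d.1 i.succ) + mulV P.D (d.2 i) - P.f (P.grid N (i + 1))) j ≤ 0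

/-- The tracking part of the objective of the time-stepping problem. -/
def discreteTracking (N : ℕ) (d : Discrete n m N) : ℝ :=
  P.step N / 2 * ∑ i : Fin N, (‖d.1 i.succ - P.xd (P.grid N (i + 1))‖ ^ 2 +
    P.δ * ‖d.2 i - P.ud (P.grid N (i + 1))‖ ^ 2)

/-- The tracking problem of the grid with `N` cells. -/
def gridLS (hT : 0 < P.T) (N : ℕ) :
    LeastSquares P.Slack (WithLp 2 (L2 P.T n × L2 P.T m)) (Vec n) :=
  P.trackingLS Y (gridVolterra P.T hT.le N) (sampleFn P.T N P.f) (sampleFn P.T N P.xd)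
    (sampleFn P.T N P.ud)

/-- The discrete state and control are the values of the state and the control that belong to the
slack variables `y`. -/
def GridRelated (hT : 0 < P.T) (N : ℕ) (d : Discrete n m N) (y : P.Slack) : Prop :=
  P.stateOf Y (gridVolterra P.T hT.le N) (sampleFn P.T N P.f) y =
    stepFn P.T N (fun i => d.1 i.succ) ∧
  P.controlOf Y (gridVolterra P.T hT.le N) (sampleFn P.T N P.f) y = stepFn P.T N d.2

lemma grid_eq (N i : ℕ) : P.grid N i = i * (P.T / N) := rfl

lemma grid_succ_eq (N i : ℕ) : P.grid N (i + 1) = ((i : ℝ) + 1) * (P.T / N) := by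
  rw [grid_eq]
  push_cast
  rfl

lemma sampleFn_eq (N : ℕ) {a : ℕ} (φ : ℝ → Vec a) :
    sampleFn P.T N φ = stepFn P.T N fun i => φ (P.grid N (i + 1)) := by
  simp only [grid_succ_eq]
  rfl

variable {P} {N : ℕ}

lemma tracking_eq_of_step (hT : 0 < P.T) (hN : 0 < N) (d : Discrete n m N) :
    P.discreteTracking N d =
      1 / 2 * (‖stepFn P.T N (fun i => d.1 i.succ) - sampleFn P.T N P.xd‖ ^ 2 +
        P.δ * ‖stepFn P.T N d.2 - sampleFn P.T N P.ud‖ ^ 2) := by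
  rw [sampleFn_eq, sampleFn_eq, ← stepFn_sub hT hN, ← stepFn_sub hT hN, norm_stepFn_sq hT,
    norm_stepFn_sq hT, discreteTracking, step, Finset.sum_add_distrib, ← Finset.mul_sum]
  simp only [Pi.sub_apply]
  ring

lemma DiscreteDynamics.rate_eq (hT : 0 < P.T) (hN : 0 < N) (d : Discrete n m N) :
    matL P.T P.A (stepFn P.T N fun i => d.1 i.succ) + matL P.T P.B (stepFn P.T N d.2) =
      stepFn P.T N fun i => mulV P.A (d.1 i.succ) + mulV P.B (d.2 i) := by
  rw [matL_stepFn hT hN, matL_stepFn hT hN, ← stepFn_add hT hN]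
  rfl

/-- Summing the implicit Euler steps. -/
lemma DiscreteDynamics.state_eq (hT : 0 < P.T) {d : Discrete n m N} (hd : P.DiscreteDynamics N d)
    (i : Fin (N + 1)) :
    d.1 i = P.x₀ + prim (stepFn P.T N fun i => mulV P.A (d.1 i.succ) + mulV P.B (d.2 i))
      ((i : ℕ) * (P.T / N)) := by
  induction i using Fin.induction with
  | zero => simp [hd.1, prim_of_nonpos]
  | succ i ih =>
    have h1 := prim_grid_succ_sub hT N
      (stepFn P.T N fun i => mulV P.A (d.1 i.succ) + mulV P.B (d.2 i)) i
    rw [cellInt_stepFn hT, smul_add] at h1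
    have h2 := hd.2.1 i
    rw [step, ← h1, ih] at h2
    rw [Fin.val_succ]
    push_cast
    rw [eq_add_of_sub_eq h2, Fin.val_castSucc]
    abel

/-- Discrete trajectories have slack variables. -/
lemma DiscreteDynamics.exists_slack (hT : 0 < P.T) (hδ : 0 < P.δ) (hY : P.Controllable Y)
    (hN : 0 < N)
    (hV : IsUnit (1 - (gridVolterra P.T hT.le N).comp (matL P.T P.reducedA)))
    {d : Discrete n m N} (hd : P.DiscreteDynamics N d) :
    ∃ y ∈ P.slackSet, P.GridRelated Y hT N d y ∧
      (P.gridLS Y hT N).L y + (P.gridLS Y hT N).c = d.1 (Fin.last N) ∧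
      P.discreteTracking N d = 1 / 2 * ‖(P.gridLS Y hT N).res y‖ ^ 2 := by
  set x := stepFn P.T N (fun i => d.1 i.succ) with hx
  set u := stepFn P.T N d.2 with hu
  have hrate := DiscreteDynamics.rate_eq hT hN d
  have heq : x = constFn P.T P.x₀ +
      gridVolterra P.T hT.le N (matL P.T P.A x + matL P.T P.B u) := by
    rw [hrate, gridVolterra_eq_stepFn hT hN, constFn_eq_stepFn hT hN, ← stepFn_add hT hN, hx]
    congr 1
    funext i
    rw [hd.state_eq hT i.succ, Fin.val_succ]
    push_cast
    rfl
  obtain ⟨h1, h2⟩ := stateOf_controlOf_of_eq hY hV (f := sampleFn P.T N P.f) heq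
  refine ⟨_, ?_, ⟨h1, h2⟩, ?_, ?_⟩
  · change matL P.T P.C x + matL P.T P.D u - sampleFn P.T N P.f ∈ nonposSet P.T l
    rw [hx, hu, matL_stepFn hT hN, matL_stepFn hT hN, sampleFn_eq, ← stepFn_add hT hN,
      ← stepFn_sub hT hN]
    exact stepFn_mem_nonposSet hT hN hd.2.2
  · rw [gridLS, trackingLS_terminal, rateOf_eq, h1, h2, hrate, hd.state_eq hT (Fin.last N),
      Fin.val_last, prim_last hN]
  · rw [gridLS, norm_res_trackingLS_sq P Y hδ, h1, h2, tracking_eq_of_step hT hN]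

/-- Averaging the control over the cells turns slack variables into a discrete trajectory with the
same terminal state, whose cost is not larger. -/
lemma exists_discreteDynamics (hT : 0 < P.T) (hδ : 0 < P.δ) (hY : P.Controllable Y)
    (hN : 0 < N)
    (hV : IsUnit (1 - (gridVolterra P.T hT.le N).comp (matL P.T P.reducedA)))
    {y : P.Slack} (hy : y ∈ P.slackSet) :
    ∃ d : Discrete n m N, P.DiscreteDynamics N d ∧
      (P.gridLS Y hT N).L y + (P.gridLS Y hT N).c = d.1 (Fin.last N) ∧
      P.discreteTracking N d ≤ 1 / 2 * ‖(P.gridLS Y hT N).res y‖ ^ 2 := by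
  set V : L2 P.T n →L[ℝ] L2 P.T n := gridVolterra P.T hT.le N with hVdef
  set x := P.stateOf Y V (sampleFn P.T N P.f) y with hx
  set u := P.controlOf Y V (sampleFn P.T N P.f) y with hu
  set v := P.rateOf Y V (sampleFn P.T N P.f) y with hv
  set d : Discrete n m N := (fun i => P.x₀ + prim v ((i : ℕ) * (P.T / N)),
    fun i => ((P.T / N)⁻¹ : ℝ) • cellInt P.T N u i) with hd
  have hxs : x = stepFn P.T N fun i => d.1 i.succ := by
    rw [hx, stateOf_eq Y hV, hVdef, gridVolterra_eq_stepFn hT hN, constFn_eq_stepFn hT hN,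
      ← stepFn_add hT hN]
    congr 1
    funext i
    simp only [hd, Fin.val_succ, Pi.add_apply]
    push_cast
    rfl
  have hus : cellAvg P.T N u = stepFn P.T N d.2 := rfl
  have hN' : (0 : ℝ) < N := by exact_mod_cast hN
  have hstep : P.T / N ≠ 0 := (div_pos hT hN').ne'
  refine ⟨d, ⟨?_, fun i => ?_, fun i j => ?_⟩, ?_, ?_⟩
  · simp [hd, prim_of_nonpos]
  · have h1 : d.1 i.succ - d.1 i.castSucc = cellInt P.T N v i := by
      rw [← prim_grid_succ_sub hT N v i]
      simp only [hd, Fin.val_succ, Fin.val_castSucc]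
      push_cast
      abel
    have h2 : cellInt P.T N v i = cellInt P.T N (matL P.T P.A x) i +
        cellInt P.T N (matL P.T P.B u) i := by
      rw [hv, rateOf_eq]
      exact map_add _ _ _
    have h3 : cellInt P.T N x i = (P.T / N) • d.1 i.succ := by
      rw [hxs, cellInt_stepFn hT]
    have h4 : cellInt P.T N u i = (P.T / N) • d.2 i := by
      simp only [hd]
      rw [smul_smul, mul_inv_cancel₀ hstep, one_smul]
    rw [h1, h2, cellInt_matL, cellInt_matL, h3, h4, mulV_smul, mulV_smul]
    rfl
  · have h1 : cellAvg P.T N y.1 = stepFn P.T N fun i =>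
        mulV P.C (d.1 i.succ) + mulV P.D (d.2 i) - P.f (P.grid N (i + 1)) := by
      have h2 : y.1 = matL P.T P.C x + matL P.T P.D u - sampleFn P.T N P.f := by
        rw [hx, hu, matL_D_controlOf hY]
        abel
      rw [h2, cellAvg_sub hT hN, cellAvg_add hT hN, cellAvg_matL hT hN, cellAvg_matL hT hN, hus,
        hxs, cellAvg_stepFn hT, sampleFn_eq, cellAvg_stepFn hT, matL_stepFn hT hN,
        matL_stepFn hT hN, ← stepFn_add hT hN, ← stepFn_sub hT hN]
      rfl
    have h3 : cellAvg P.T N y.1 ∈ nonposSet P.T l := cellAvg_mem_nonposSet hT hN hy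
    rw [h1] at h3
    exact le_zero_of_stepFn_mem_nonposSet hT h3 i j
  · rw [gridLS, trackingLS_terminal]
    simp only [hd, Fin.val_last]
    rw [prim_last hN]
  · rw [tracking_eq_of_step hT hN, gridLS, norm_res_trackingLS_sq P Y hδ, ← hxs, ← hus]
    have h1 : ‖cellAvg P.T N u - sampleFn P.T N P.ud‖ ≤ ‖u - sampleFn P.T N P.ud‖ :=
      norm_cellAvg_sub_le hT hN u _
    gcongr

/-- The interpolants of a discrete trajectory in terms of its slack variables. -/
lemma isInterpolant_iff (hT : 0 < P.T) (hN : 0 < N) {d : Discrete n m N}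
    (hd : P.DiscreteDynamics N d) {y : P.Slack} (hy : P.GridRelated Y hT N d y)
    {p : StateControl P.T n m} :
    P.IsInterpolant N d p ↔
      p.1.val = constFn P.T P.x₀ + volterra P.T hT.le id measurable_id
        (P.rateOf Y (gridVolterra P.T hT.le N) (sampleFn P.T N P.f) y) ∧
      p.2 = P.controlOf Y (gridVolterra P.T hT.le N) (sampleFn P.T N P.f) y := by
  set v := P.rateOf Y (gridVolterra P.T hT.le N) (sampleFn P.T N P.f) y with hv
  have hrate : v = stepFn P.T N fun i => mulV P.A (d.1 i.succ) + mulV P.B (d.2 i) := by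
    rw [hv, rateOf_eq, hy.1, hy.2, DiscreteDynamics.rate_eq hT hN]
  have hN' : (0 : ℝ) < N := by exact_mod_cast hN
  have hstep : P.T / N ≠ 0 := (div_pos hT hN').ne'
  have hval : ∀ i : Fin N, ∀ t ∈ cell P.T N i, P.x₀ + prim v t = d.1 i.castSucc +
      ((t - P.grid N i) / P.step N) • (d.1 i.succ - d.1 i.castSucc) := by
    intro i t ht
    have h1 := prim_sub_grid hT (fun i => mulV P.A (d.1 i.succ) + mulV P.B (d.2 i)) i ht
    rw [← hrate] at h1
    have h2 := hd.state_eq hT i.castSucc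
    rw [← hrate, Fin.val_castSucc] at h2
    rw [hd.2.1 i, ← smul_add, smul_smul, step, div_mul_cancel₀ _ hstep, h2,
      eq_add_of_sub_eq h1, grid_eq]
    abel
  have hae : ∀ᵐ t ∂timeMeasure P.T,
      (constFn P.T P.x₀ + volterra P.T hT.le id measurable_id v : L2 P.T n) t =
        P.x₀ + prim v t := by
    filter_upwards [Lp.coeFn_add (constFn P.T P.x₀) (volterra P.T hT.le id measurable_id v),
      coeFn_constFn P.x₀, coeFn_volterra hT.le measurable_id v] with t h1 h2 h3
    rw [h1, Pi.add_apply, h2, h3, id]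
  have hcell : ∀ (i : Fin N) (t : ℝ),
      t ∈ Ioc (P.grid N i) (P.grid N (i + 1)) ↔ t ∈ cell P.T N i := by
    intro i t
    rw [grid_succ_eq, grid_eq, cell]
  rw [hy.2]
  constructor
  · intro h
    refine ⟨Lp.ext (ae_of_forall_cell hT hN fun i => ?_), eq_stepFn hT hN fun i => ?_⟩
    · filter_upwards [h i, hae] with t h1 h2 hi
      rw [h2, hval i t hi]
      exact (h1 ((hcell i t).mpr hi)).1
    · filter_upwards [h i] with t h1 hi
      exact (h1 ((hcell i t).mpr hi)).2
  · rintro ⟨h1, h2⟩ i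
    filter_upwards [hae, coeFn_stepFn hT d.2] with t h3 h4 hi
    rw [hcell] at hi
    rw [h1, h2, h3, h4 i hi, hval i t hi]
    exact ⟨rfl, rfl⟩

/-! ### The original problem in slack variables -/

/-- The tracking problem in continuous time. -/
def limitLS (P : ControlProblem n m l k Ξ) (Y : Matrix (Fin m) (Fin (m - l)) ℝ) (hT : 0 < P.T)
    (hf : MemLp P.f 2 (timeMeasure P.T)) (hx : MemLp P.xd 2 (timeMeasure P.T))
    (hu : MemLp P.ud 2 (timeMeasure P.T)) :
    LeastSquares P.Slack (WithLp 2 (L2 P.T n × L2 P.T m)) (Vec n) :=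
  P.trackingLS Y (volterra P.T hT.le id measurable_id) (hf.toLp P.f) (hx.toLp P.xd)
    (hu.toLp P.ud)

/-- State, derivative and control belong to the slack variables `y`. -/
def Related (P : ControlProblem n m l k Ξ) (Y : Matrix (Fin m) (Fin (m - l)) ℝ)
    (V : L2 P.T n →L[ℝ] L2 P.T n) (f : L2 P.T l) (p : StateControl P.T n m) (y : P.Slack) : Prop :=
  p.1.val = P.stateOf Y V f y ∧ p.1.der = P.rateOf Y V f y ∧ p.2 = P.controlOf Y V f y

lemma norm_sub_toLp_sq {T : ℝ} {a : ℕ} {φ : ℝ → Vec a} (hφ : MemLp φ 2 (timeMeasure T))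
    (v : L2 T a) : ‖v - hφ.toLp φ‖ ^ 2 = ∫ t in Ioo 0 T, ‖v t - φ t‖ ^ 2 := by
  rw [← real_inner_self_eq_norm_sq, L2.inner_def]
  refine integral_congr_ae ?_
  filter_upwards [Lp.coeFn_sub v (hφ.toLp φ), hφ.coeFn_toLp] with t h1 h2
  rw [h1, Pi.sub_apply, h2, real_inner_self_eq_norm_sq]

variable {Y}

lemma Related.trackingCost_eq (hδ : 0 < P.δ) {V : L2 P.T n →L[ℝ] L2 P.T n} {f : L2 P.T l}
    (hx : MemLp P.xd 2 (timeMeasure P.T)) (hu : MemLp P.ud 2 (timeMeasure P.T))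
    {p : StateControl P.T n m} {y : P.Slack} (h : P.Related Y V f p y) :
    P.trackingCost p =
      1 / 2 * ‖(P.trackingLS Y V f (hx.toLp P.xd) (hu.toLp P.ud)).res y‖ ^ 2 := by
  rw [norm_res_trackingLS_sq P Y hδ, ← h.1, ← h.2.2, norm_sub_toLp_sq, norm_sub_toLp_sq,
    trackingCost]
  ring

lemma Related.value_eq (hT : 0 < P.T) {f : L2 P.T l} {p : StateControl P.T n m} {y : P.Slack}
    (h : P.Related Y (volterra P.T hT.le id measurable_id) f p y) {t : ℝ} (ht : t ∈ Icc 0 P.T) :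
    p.1.value t = P.x₀ + prim p.1.der t := by
  refine H1.value_eq hT ?_ ht
  rw [h.1, h.2.1]
  exact stateOf_eq Y (isUnit_one_sub_volterra hT.le _) f y

lemma exists_related (P : ControlProblem n m l k Ξ) (Y : Matrix (Fin m) (Fin (m - l)) ℝ)
    (hT : 0 < P.T) (f : L2 P.T l) (y : P.Slack) :
    ∃ p, P.Related Y (volterra P.T hT.le id measurable_id) f p y := by
  have h := isWeakDeriv_const_add_volterra hT P.x₀
    (P.rateOf Y (volterra P.T hT.le id measurable_id) f y)
  exact ⟨(⟨_, _, h⟩, P.controlOf Y (volterra P.T hT.le id measurable_id) f y),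
    (stateOf_eq Y (isUnit_one_sub_volterra hT.le _) f y).symm, rfl, rfl⟩

lemma Related.terminal_eq (hT : 0 < P.T) {f : L2 P.T l} (xd : L2 P.T n) (ud : L2 P.T m)
    {p : StateControl P.T n m} {y : P.Slack}
    (h : P.Related Y (volterra P.T hT.le id measurable_id) f p y) :
    (P.trackingLS Y (volterra P.T hT.le id measurable_id) f xd ud).L y +
      (P.trackingLS Y (volterra P.T hT.le id measurable_id) f xd ud).c = p.1.value P.T := by
  rw [trackingLS_terminal, h.value_eq hT (right_mem_Icc.mpr hT.le), h.2.1, prim_of_ge _ le_rfl]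

lemma Related.dynamics (hT : 0 < P.T) (hY : P.Controllable Y)
    (hf : MemLp P.f 2 (timeMeasure P.T)) {p : StateControl P.T n m} {y : P.Slack}
    (hy : y ∈ P.slackSet)
    (h : P.Related Y (volterra P.T hT.le id measurable_id) (hf.toLp P.f) p y) : P.Dynamics p := by
  refine ⟨?_, ?_, ?_⟩
  · have h1 : p.1.der = matL P.T P.A p.1.val + matL P.T P.B p.2 := by
      rw [h.2.1, rateOf_eq, h.1, h.2.2]
    filter_upwards [Lp.coeFn_add (matL P.T P.A p.1.val) (matL P.T P.B p.2),
      coeFn_matL P.A p.1.val, coeFn_matL P.B p.2] with t h2 h3 h4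
    rw [h1, h2, Pi.add_apply, h3, h4]
  · have h1 : y.1 = matL P.T P.C p.1.val + matL P.T P.D p.2 - hf.toLp P.f := by
      rw [h.1, h.2.2, matL_D_controlOf hY]
      abel
    have hy' : ∀ᵐ t ∂timeMeasure P.T, ∀ j, y.1 t j ≤ 0 := hy
    filter_upwards [hy', Lp.coeFn_sub (matL P.T P.C p.1.val + matL P.T P.D p.2) (hf.toLp P.f),
      Lp.coeFn_add (matL P.T P.C p.1.val) (matL P.T P.D p.2), coeFn_matL P.C p.1.val,
      coeFn_matL P.D p.2, hf.coeFn_toLp] with t h2 h3 h4 h5 h6 h7 j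
    have h8 := h2 j
    rwa [h1, h3, Pi.sub_apply, h4, Pi.add_apply, h5, h6, h7] at h8
  · rw [h.value_eq hT (left_mem_Icc.mpr hT.le), prim_of_nonpos _ le_rfl, add_zero]

lemma Dynamics.exists_related (hT : 0 < P.T) (hY : P.Controllable Y)
    (hf : MemLp P.f 2 (timeMeasure P.T)) {p : StateControl P.T n m} (hp : P.Dynamics p) :
    ∃ y ∈ P.slackSet, P.Related Y (volterra P.T hT.le id measurable_id) (hf.toLp P.f) p y := by
  obtain ⟨h1, h2, h3⟩ := hp
  have hder : p.1.der = matL P.T P.A p.1.val + matL P.T P.B p.2 := by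
    refine Lp.ext ?_
    filter_upwards [h1, Lp.coeFn_add (matL P.T P.A p.1.val) (matL P.T P.B p.2),
      coeFn_matL P.A p.1.val, coeFn_matL P.B p.2] with t h0 h2 h3 h4
    rw [h0, h2, Pi.add_apply, h3, h4]
  obtain ⟨c, hc⟩ := p.1.isWeakDeriv.eq_const_add_volterra hT
  have hc0 : c = P.x₀ := by
    rw [← h3, H1.value_eq hT hc (left_mem_Icc.mpr hT.le), prim_of_nonpos _ le_rfl, add_zero]
  have heq : p.1.val = constFn P.T P.x₀ + volterra P.T hT.le id measurable_id
      (matL P.T P.A p.1.val + matL P.T P.B p.2) := by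
    rw [← hder, ← hc0]
    exact hc
  obtain ⟨h4, h5⟩ := stateOf_controlOf_of_eq hY (isUnit_one_sub_volterra hT.le _)
    (f := hf.toLp P.f) heq
  refine ⟨_, ?_, h4.symm, ?_, h5.symm⟩
  · change ∀ᵐ t ∂timeMeasure P.T, ∀ j,
      (matL P.T P.C p.1.val + matL P.T P.D p.2 - hf.toLp P.f : L2 P.T l) t j ≤ 0
    filter_upwards [h2, Lp.coeFn_sub (matL P.T P.C p.1.val + matL P.T P.D p.2) (hf.toLp P.f),
      Lp.coeFn_add (matL P.T P.C p.1.val) (matL P.T P.D p.2), coeFn_matL P.C p.1.val,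
      coeFn_matL P.D p.2, hf.coeFn_toLp] with t h2 h3 h4 h5 h6 h7 j
    rw [h3, Pi.sub_apply, h4, Pi.add_apply, h5, h6, h7]
    exact h2 j
  · rw [rateOf_eq, h4, h5, hder]

end ControlProblem

/-! ### Reduction of the optimisation problems to the terminal state -/

/-- Trajectories `p` with dynamics `Dyn`, terminal state `term p` and tracking cost `J p` are
reduced to a least squares problem whose parameter is the terminal state: every trajectory is
related to a point `y` with the same terminal state and cost, and every `y` is matched by a
trajectory that is not more expensive. -/
structure IsReduction {X Y H Z : Type*} [NormedAddCommGroup Y] [NormedSpace ℝ Y]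
    [NormedAddCommGroup H] [InnerProductSpace ℝ H] [NormedAddCommGroup Z] [NormedSpace ℝ Z]
    (Dyn : X → Prop) (term : X → Z) (J : X → ℝ) (Rel : X → Y → Prop) (LS : LeastSquares Y H Z)
    (Q : Set Y) : Prop where
  exists_point : ∀ p, Dyn p → ∃ y ∈ Q, Rel p y ∧ LS.L y + LS.c = term p ∧
    J p = 1 / 2 * ‖LS.res y‖ ^ 2
  exists_trajectory : ∀ y ∈ Q, ∃ p, Dyn p ∧ LS.L y + LS.c = term p ∧
    J p ≤ 1 / 2 * ‖LS.res y‖ ^ 2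

namespace IsReduction

variable {X Y H Z : Type*} [NormedAddCommGroup Y] [NormedSpace ℝ Y] [CompleteSpace Y]
  [NormedAddCommGroup H] [InnerProductSpace ℝ H] [CompleteSpace H] [NormedAddCommGroup Z]
  [NormedSpace ℝ Z] {Dyn : X → Prop} {term : X → Z} {J : X → ℝ} {Rel : X → Y → Prop}
  {LS : LeastSquares Y H Z} {Q : Set Y} {γ : ℝ} {R : Z →L[ℝ] Y} {S : Set Z} {Φ : Z → ℝ}

lemma exists_le_value (h : IsReduction Dyn term J Rel LS Q) (hreg : LS.Regular Q γ R)
    (hconv : Convex ℝ Q) (hclosed : IsClosed Q) (h0 : (0 : Y) ∈ Q) (z : Z) :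
    ∃ p, Dyn p ∧ term p = z ∧ J p ≤ LS.value Q z := by
  have hmin := LeastSquares.argmin_spec (hreg.exists_isMinimizer hconv hclosed h0 z)
  obtain ⟨p, hp, hterm, hJ⟩ := h.exists_trajectory _ hmin.mem
  exact ⟨p, hp, hterm.symm.trans hmin.eq, hJ⟩

lemma value_le (h : IsReduction Dyn term J Rel LS Q) (hreg : LS.Regular Q γ R)
    (hconv : Convex ℝ Q) (hclosed : IsClosed Q) (h0 : (0 : Y) ∈ Q) {p : X} (hp : Dyn p) :
    LS.value Q (term p) ≤ J p := by
  obtain ⟨y, hy, -, hterm, hJ⟩ := h.exists_point p hp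
  have hmin := LeastSquares.argmin_spec (hreg.exists_isMinimizer hconv hclosed h0 (term p))
  rw [hJ, LeastSquares.value]
  have := hmin.le y hy hterm
  gcongr

/-- The terminal state of an optimal trajectory minimises the reduced cost, and the trajectory is
the one selected by the least squares problem. -/
lemma of_optimal (h : IsReduction Dyn term J Rel LS Q) (hreg : LS.Regular Q γ R)
    (hconv : Convex ℝ Q) (hclosed : IsClosed Q) (h0 : (0 : Y) ∈ Q) {p : X} (hp : Dyn p)
    (hpS : term p ∈ S)
    (hopt : ∀ p', Dyn p' → term p' ∈ S → Φ (term p) + J p ≤ Φ (term p') + J p') :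
    term p ∈ argminOn S (fun z => Φ z + LS.value Q z) ∧ Rel p (LS.argmin Q (term p)) := by
  have hmin := LeastSquares.argmin_spec (hreg.exists_isMinimizer hconv hclosed h0 (term p))
  constructor
  · refine ⟨hpS, fun z hz => ?_⟩
    obtain ⟨p', hp', hterm, hJ⟩ := h.exists_le_value hreg hconv hclosed h0 z
    have h1 := hopt p' hp' (hterm ▸ hz)
    rw [hterm] at h1
    have h2 := h.value_le hreg hconv hclosed h0 hp
    dsimp only
    linarith
  · obtain ⟨y, hy, hrel, hterm, hJ⟩ := h.exists_point p hp
    obtain ⟨p', hp', hterm', hJ'⟩ := h.exists_le_value hreg hconv hclosed h0 (term p)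
    have h1 := hopt p' hp' (hterm' ▸ hpS)
    rw [hterm'] at h1
    have h2 : 1 / 2 * ‖LS.res y‖ ^ 2 ≤ 1 / 2 * ‖LS.res (LS.argmin Q (term p))‖ ^ 2 := by
      rw [← hJ]
      exact (by linarith : J p ≤ J p').trans hJ'
    have h3 : ‖LS.res y‖ ≤ ‖LS.res (LS.argmin Q (term p))‖ :=
      le_of_sq_le_sq (by linarith) (norm_nonneg _)
    have hy' : LS.IsMinimizer Q (term p) y :=
      ⟨hy, hterm, fun y' hy' hz => h3.trans (hmin.le y' hy' hz)⟩
    rw [← hreg.eq_of_isMinimizer hconv hmin hy']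
    exact hrel

lemma exists_optimal (h : IsReduction Dyn term J Rel LS Q) (hreg : LS.Regular Q γ R)
    (hconv : Convex ℝ Q) (hclosed : IsClosed Q) (h0 : (0 : Y) ∈ Q) {z : Z}
    (hz : z ∈ argminOn S (fun z => Φ z + LS.value Q z)) :
    ∃ p, Dyn p ∧ term p = z ∧
      ∀ p', Dyn p' → term p' ∈ S → Φ (term p) + J p ≤ Φ (term p') + J p' := by
  obtain ⟨p, hp, hterm, hJ⟩ := h.exists_le_value hreg hconv hclosed h0 z
  refine ⟨p, hp, hterm, fun p' hp' hS => ?_⟩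
  have h1 := hz.2 _ hS
  have h2 := h.value_le hreg hconv hclosed h0 hp'
  dsimp only at h1
  rw [hterm]
  linarith

end IsReduction

/-! ### Convergence of the tracking problems -/

lemma LeastSquares.Regular.exists_argmin_bound {Y H Z : Type*} [NormedAddCommGroup Y]
    [NormedSpace ℝ Y] [CompleteSpace Y] [NormedAddCommGroup H] [InnerProductSpace ℝ H]
    [CompleteSpace H] [NormedAddCommGroup Z] [NormedSpace ℝ Z] [ProperSpace Z]
    {LS : LeastSquares Y H Z} {Q : Set Y} {γ : ℝ} {R : Z →L[ℝ] Y} (hreg : LS.Regular Q γ R)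
    (hconv : Convex ℝ Q) (hclosed : IsClosed Q) (h0 : (0 : Y) ∈ Q) (r : ℝ) :
    ∃ C, ∀ z, ‖z‖ ≤ r → ‖LS.argmin Q z‖ ≤ C := by
  obtain ⟨M, hM⟩ := (isCompact_closedBall (0 : Z) r).exists_bound_of_continuousOn
    (hreg.continuous_value hconv hclosed h0).continuousOn
  refine ⟨(√(2 * M) + ‖LS.b‖) / γ, fun z hz => ?_⟩
  have h1 := (le_abs_self _).trans (hM z (mem_closedBall_zero_iff.mpr hz))
  rw [LeastSquares.value] at h1
  have h2 : ‖LS.res (LS.argmin Q z)‖ ≤ √(2 * M) := Real.le_sqrt_of_sq_le (by linarith)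
  have h3 : ‖LS.G (LS.argmin Q z)‖ ≤ ‖LS.res (LS.argmin Q z)‖ + ‖LS.b‖ := by
    have h4 : LS.G (LS.argmin Q z) = LS.res (LS.argmin Q z) + LS.b := by
      rw [LeastSquares.res, sub_add_cancel]
    rw [h4]
    exact norm_add_le _ _
  rw [le_div_iff₀ hreg.pos, mul_comm]
  linarith [hreg.bound (LS.argmin Q z)]

/-- Convergent affine maps converge uniformly on bounded sets, also along nearby points. -/
lemma eventually_affine_close {Y E : Type*} [NormedAddCommGroup Y] [NormedSpace ℝ Y]
    [NormedAddCommGroup E] [NormedSpace ℝ E] {G : ℕ → Y →L[ℝ] E} {G₀ : Y →L[ℝ] E} {c : ℕ → E}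
    {c₀ : E} (hG : Tendsto G atTop (𝓝 G₀)) (hc : Tendsto c atTop (𝓝 c₀)) (R : ℝ) {η : ℝ}
    (hη : 0 < η) :
    ∃ r > 0, ∀ᶠ N in atTop, ∀ y y', ‖y'‖ ≤ R → ‖y - y'‖ ≤ r →
      ‖(G N y + c N) - (G₀ y' + c₀)‖ ≤ η := by
  have hr : 0 < min 1 (η / (3 * (‖G₀‖ + 1))) := by positivity
  refine ⟨min 1 (η / (3 * (‖G₀‖ + 1))), hr, ?_⟩
  have h1 : Tendsto (fun N => ‖G N - G₀‖ * (|R| + 1)) atTop (𝓝 0) := by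
    simpa using (tendsto_iff_norm_sub_tendsto_zero.mp hG).mul_const (|R| + 1)
  have h2 := tendsto_iff_norm_sub_tendsto_zero.mp hc
  filter_upwards [h1.eventually (gt_mem_nhds (by positivity : 0 < η / 3)),
    h2.eventually (gt_mem_nhds (by positivity : 0 < η / 3))] with N hN1 hN2 y y' hy' hyy'
  have hy : ‖y‖ ≤ |R| + 1 := by
    have h3 : y = (y - y') + y' := by abel
    rw [h3]
    refine (norm_add_le _ _).trans ?_
    linarith [hyy'.trans (min_le_left _ _), le_abs_self R]
  have h3 : (G N y + c N) - (G₀ y' + c₀) = (G N - G₀) y + G₀ (y - y') + (c N - c₀) := by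
    rw [sub_apply, map_sub]
    abel
  have h4 : ‖(G N - G₀) y‖ ≤ η / 3 := ((G N - G₀).le_opNorm y).trans
    ((mul_le_mul_of_nonneg_left hy (norm_nonneg _)).trans hN1.le)
  have h5 : ‖G₀ (y - y')‖ ≤ η / 3 := by
    refine (G₀.le_opNorm _).trans ?_
    have h6 := hyy'.trans (min_le_right _ _)
    rw [le_div_iff₀ (by positivity)] at h6
    nlinarith [norm_nonneg (y - y'), norm_nonneg G₀]
  rw [h3]
  refine (norm_add₃_le).trans ?_
  linarith

lemma scDist_le {T : ℝ} (hT : 0 ≤ T) {n m : ℕ} {p p' : StateControl T n m} {c : L2 T n}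
    (h : p.1.val = c + volterra T hT id measurable_id p.1.der)
    (h' : p'.1.val = c + volterra T hT id measurable_id p'.1.der) :
    scDist p p' ≤ (‖(volterra T hT id measurable_id : L2 T n →L[ℝ] L2 T n)‖ + 1) *
      ‖p.1.der - p'.1.der‖ + ‖p.2 - p'.2‖ := by
  set V : L2 T n →L[ℝ] L2 T n := volterra T hT id measurable_id
  have h1 : p.1.val - p'.1.val = V (p.1.der - p'.1.der) := by
    rw [h, h', map_sub]
    abel
  have h2 : ‖p.1.val - p'.1.val‖ ≤ ‖V‖ * ‖p.1.der - p'.1.der‖ := h1 ▸ V.le_opNorm _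
  rw [scDist]
  refine add_le_add_left (Real.sqrt_le_iff.mpr ⟨by positivity, ?_⟩) _
  nlinarith [norm_nonneg (p.1.val - p'.1.val), norm_nonneg (p.1.der - p'.1.der), norm_nonneg V,
    pow_le_pow_left₀ (norm_nonneg _) h2 2, mul_nonneg (norm_nonneg V)
      (sq_nonneg ‖p.1.der - p'.1.der‖)]

namespace ControlProblem

variable {n m l k : ℕ} {Ξ : Type*} {P : ControlProblem n m l k Ξ}
  {Y : Matrix (Fin m) (Fin (m - l)) ℝ}

lemma eventually_isUnit_grid (P : ControlProblem n m l k Ξ) (hT : 0 < P.T) :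
    ∀ᶠ N in atTop, IsUnit (1 - (gridVolterra P.T hT.le N).comp (matL P.T P.reducedA)) := by
  have h1 : Tendsto (fun N => (1 : L2 P.T n →L[ℝ] L2 P.T n) -
      (gridVolterra P.T hT.le N).comp (matL P.T P.reducedA)) atTop
      (𝓝 (1 - (volterra P.T hT.le id measurable_id).comp (matL P.T P.reducedA))) :=
    tendsto_const_nhds.sub (((continuous_id.clm_comp continuous_const).tendsto _).comp
      (tendsto_gridVolterra hT))
  exact h1.eventually (Units.isOpen.mem_nhds (isUnit_one_sub_volterra hT.le _))

/-- The tracking problems are regular with the same lower bound and bounded right inverses. -/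
lemma exists_regular (hδ : 0 < P.δ) (hY : P.Controllable Y) (hT : 0 < P.T)
    (hf : MemLp P.f 2 (timeMeasure P.T)) (hx : MemLp P.xd 2 (timeMeasure P.T))
    (hu : MemLp P.ud 2 (timeMeasure P.T)) :
    ∃ (γ : ℝ) (R₀ : Vec n →L[ℝ] P.Slack) (R : ℕ → Vec n →L[ℝ] P.Slack),
      (P.limitLS Y hT hf hx hu).Regular P.slackSet γ R₀ ∧ R =O[atTop] (fun _ => (1 : ℝ)) ∧
      ∀ᶠ N in atTop, (P.gridLS Y hT N).Regular P.slackSet γ (R N) := by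
  obtain ⟨γ, hγ, hb⟩ := P.exists_trackingLS_bound hδ hY
  obtain ⟨r, hr⟩ := P.exists_terminal_right_inverse hT hY
  set R₀ : Vec n →L[ℝ] P.Slack :=
    (ContinuousLinearMap.inr ℝ (L2 P.T l) (L2 P.T (m - l))).comp r with hR₀
  have hV := isUnit_one_sub_volterra hT.le P.reducedA
  have hL : Tendsto (fun N => (P.gridLS Y hT N).L) atTop (𝓝 (P.limitLS Y hT hf hx hu).L) :=
    ((continuous_const.clm_comp continuous_id).tendsto _).comp
      ((P.continuousAt_rateLin Y hV).tendsto.comp (tendsto_gridVolterra hT))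
  have hright : ∀ z, (P.limitLS Y hT hf hx hu).L (R₀ z) = z := hr
  obtain ⟨S, hS, hSr⟩ := LeastSquares.exists_perturbed_right_inverse hright hL
  have hinv : ∀ (B : Vec n →L[ℝ] Vec n), ∀ y ∈ P.slackSet, ∀ z,
      y + R₀.comp B z ∈ P.slackSet := by
    intro B y hy z
    change y.1 + 0 ∈ nonposSet P.T l
    rw [add_zero]
    exact hy
  refine ⟨γ, R₀, fun N => R₀.comp (S N), ⟨hγ, hb _ _ _ _, hright, hinv 1⟩, ?_, ?_⟩
  · have h1 : Tendsto (fun N => R₀.comp (S N)) atTop (𝓝 (R₀.comp 1)) :=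
      ((continuous_const.clm_comp continuous_id).tendsto _).comp hS
    exact h1.isBigO_one ℝ
  · filter_upwards [hSr] with N hN
    exact ⟨hγ, hb _ _ _ _, hN, hinv (S N)⟩

lemma tendsto_gridLS [MeasurableSpace Ξ] (P : ControlProblem n m l k Ξ)
    (Y : Matrix (Fin m) (Fin (m - l)) ℝ) {μ : Measure Ξ} (hP : P.Standing μ) :
    let L₀ := P.limitLS Y hP.T_pos hP.f_mem hP.xd_mem hP.ud_mem
    Tendsto (fun N => (P.gridLS Y hP.T_pos N).L) atTop (𝓝 L₀.L) ∧
    Tendsto (fun N => (P.gridLS Y hP.T_pos N).c) atTop (𝓝 L₀.c) ∧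
    Tendsto (fun N => (P.gridLS Y hP.T_pos N).G) atTop (𝓝 L₀.G) ∧
    Tendsto (fun N => (P.gridLS Y hP.T_pos N).b) atTop (𝓝 L₀.b) :=
  P.tendsto_trackingLS Y (isUnit_one_sub_volterra hP.T_pos.le P.reducedA)
    (tendsto_gridVolterra hP.T_pos) (tendsto_sampleFn hP.T_pos hP.f_mem hP.f_grid)
    (tendsto_sampleFn hP.T_pos hP.xd_mem hP.xd_grid)
    (tendsto_sampleFn hP.T_pos hP.ud_mem hP.ud_grid)

lemma isReduction_limit [MeasurableSpace Ξ] {μ : Measure Ξ} (hP : P.Standing μ)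
    (hY : P.Controllable Y) :
    IsReduction P.Dynamics (fun p => p.1.value P.T) P.trackingCost
      (P.Related Y (volterra P.T hP.T_pos.le id measurable_id) (hP.f_mem.toLp P.f))
      (P.limitLS Y hP.T_pos hP.f_mem hP.xd_mem hP.ud_mem) P.slackSet where
  exists_point p hp := by
    obtain ⟨y, hy, hrel⟩ := hp.exists_related hP.T_pos hY hP.f_mem
    exact ⟨y, hy, hrel, hrel.terminal_eq hP.T_pos _ _,
      hrel.trackingCost_eq hP.δ_pos hP.xd_mem hP.ud_mem⟩
  exists_trajectory y hy := by
    obtain ⟨p, hp⟩ := P.exists_related Y hP.T_pos (hP.f_mem.toLp P.f) y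
    exact ⟨p, hp.dynamics hP.T_pos hY hP.f_mem hy, hp.terminal_eq hP.T_pos _ _,
      (hp.trackingCost_eq hP.δ_pos hP.xd_mem hP.ud_mem).le⟩

lemma isReduction_grid (hT : 0 < P.T) (hδ : 0 < P.δ) (hY : P.Controllable Y) {N : ℕ}
    (hN : 0 < N)
    (hV : IsUnit (1 - (gridVolterra P.T hT.le N).comp (matL P.T P.reducedA))) :
    IsReduction (P.DiscreteDynamics N) (fun d => d.1 (Fin.last N)) (P.discreteTracking N)
      (P.GridRelated Y hT N) (P.gridLS Y hT N) P.slackSet where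
  exists_point _ hd := hd.exists_slack Y hT hδ hY hN hV
  exists_trajectory _ hy := exists_discreteDynamics Y hT hδ hY hN hV hy

/-- Interpolants of discrete trajectories are close to the trajectories of nearby slack
variables. -/
lemma eventually_scDist_le [MeasurableSpace Ξ] {μ : Measure Ξ} (hP : P.Standing μ) (R : ℝ)
    {η : ℝ} (hη : 0 < η) :
    ∃ r > 0, ∀ᶠ N in atTop, ∀ y y' : P.Slack, ‖y'‖ ≤ R → ‖y - y'‖ ≤ r →
      ∀ (d : Discrete n m N) (p p' : StateControl P.T n m), P.DiscreteDynamics N d →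
        P.GridRelated Y hP.T_pos N d y → P.IsInterpolant N d p →
        P.Related Y (volterra P.T hP.T_pos.le id measurable_id) (hP.f_mem.toLp P.f) p' y' →
        scDist p p' ≤ η := by
  have hT := hP.T_pos
  set V : L2 P.T n →L[ℝ] L2 P.T n := volterra P.T hT.le id measurable_id with hVdef
  have hV : IsUnit (1 - V.comp (matL P.T P.reducedA)) := isUnit_one_sub_volterra hT.le _
  have hVN := tendsto_gridVolterra hT (k := n)
  have hfN := tendsto_sampleFn hT hP.f_mem hP.f_grid
  obtain ⟨r₁, hr₁, h1⟩ := eventually_affine_close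
    ((P.continuousAt_rateLin Y hV).tendsto.comp hVN) (P.tendsto_rateConst hV hVN hfN) R
    (by positivity : 0 < η / 2 / (‖V‖ + 1))
  obtain ⟨r₂, hr₂, h2⟩ := eventually_affine_close
    ((P.continuousAt_controlLin Y hV).tendsto.comp hVN) (P.tendsto_controlConst hV hVN hfN) R
    (by positivity : 0 < η / 2)
  refine ⟨min r₁ r₂, lt_min hr₁ hr₂, ?_⟩
  filter_upwards [h1, h2, eventually_gt_atTop 0] with N hN1 hN2 hN y y' hy' hyy' d p p' hd hrel hp
    hp'
  obtain ⟨hval, hctrl⟩ := (isInterpolant_iff Y hT hN hd hrel).mp hp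
  have hder : p.1.der = P.rateOf Y (gridVolterra P.T hT.le N) (sampleFn P.T N P.f) y := by
    have h3 := p.1.isWeakDeriv
    rw [hval] at h3
    exact h3.unique (isWeakDeriv_const_add_volterra hT _ _)
  have e1 : ‖p.1.der - p'.1.der‖ ≤ η / 2 / (‖V‖ + 1) := by
    rw [hder, hp'.2.1]
    exact hN1 y y' hy' (hyy'.trans (min_le_left _ _))
  have e2 : ‖p.2 - p'.2‖ ≤ η / 2 := by
    rw [hctrl, hp'.2.2]
    exact hN2 y y' hy' (hyy'.trans (min_le_right _ _))
  have h3 := scDist_le hT.le (c := constFn P.T P.x₀) (p := p) (p' := p')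
    (by rw [hder]; exact hval)
    (by rw [hp'.1, hp'.2.1]; exact stateOf_eq Y hV _ y')
  rw [le_div_iff₀ (by positivity)] at e1
  refine h3.trans ?_
  change (‖V‖ + 1) * _ + _ ≤ η
  linarith

lemma exists_isInterpolant (hT : 0 < P.T) {N : ℕ} (hN : 0 < N) {d : Discrete n m N}
    (hd : P.DiscreteDynamics N d) {y : P.Slack} (hy : P.GridRelated Y hT N d y) :
    ∃ p, P.IsInterpolant N d p :=
  ⟨(⟨_, _, isWeakDeriv_const_add_volterra hT P.x₀
      (P.rateOf Y (gridVolterra P.T hT.le N) (sampleFn P.T N P.f) y)⟩, _),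
    (isInterpolant_iff Y hT hN hd hy).mpr ⟨rfl, rfl⟩⟩

end ControlProblem

/-! ### The terminal constraints -/

lemma norm_vecMin_sub_le {a : ℕ} (z v w : Vec a) : ‖vecMin z v - vecMin z w‖ ≤ ‖v - w‖ := by
  rw [EuclideanSpace.norm_eq, EuclideanSpace.norm_eq]
  refine Real.sqrt_le_sqrt (Finset.sum_le_sum fun i _ => ?_)
  have h := abs_min_sub_min_le_max (z i) (v i) (z i) (w i)
  rw [sub_self, abs_zero, max_eq_right (abs_nonneg _)] at h
  exact pow_le_pow_left₀ (abs_nonneg _) h 2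

lemma continuous_vecMin {X : Type*} [TopologicalSpace X] {a : ℕ} {v w : X → Vec a}
    (hv : Continuous v) (hw : Continuous w) : Continuous fun x => vecMin (v x) (w x) := by
  refine (PiLp.continuous_toLp 2 _).comp (continuous_pi fun i => ?_)
  exact ((EuclideanSpace.proj i).continuous.comp hv).min ((EuclideanSpace.proj i).continuous.comp hw)

lemma vecMin_eq_zero_iff {a : ℕ} (z v : Vec a) :
    vecMin z v = 0 ↔ (∀ i, 0 ≤ z i) ∧ (∀ i, 0 ≤ v i) ∧ ∑ i, z i * v i = 0 := by
  have h1 : vecMin z v = 0 ↔ ∀ i, min (z i) (v i) = 0 := by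
    rw [PiLp.ext_iff]
    rfl
  rw [h1]
  constructor
  · intro h
    have hz : ∀ i, 0 ≤ z i := fun i => (h i).ge.trans (min_le_left _ _)
    have hv : ∀ i, 0 ≤ v i := fun i => (h i).ge.trans (min_le_right _ _)
    refine ⟨hz, hv, Finset.sum_eq_zero fun i _ => ?_⟩
    rcases min_choice (z i) (v i) with h2 | h2
    · rw [← h2, h i, zero_mul]
    · rw [← h2, h i, mul_zero]
  · rintro ⟨hz, hv, hsum⟩ i
    have h2 := (Finset.sum_eq_zero_iff_of_nonneg fun i _ => mul_nonneg (hz i) (hv i)).mp hsum i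
      (Finset.mem_univ i)
    rcases mul_eq_zero.mp h2 with h3 | h3
    · rw [h3]
      exact min_eq_left (hv i)
    · rw [h3]
      exact min_eq_right (hz i)

lemma norm_le_sum_abs {a : ℕ} (z : Vec a) : ‖z‖ ≤ ∑ i, |z i| := by
  rw [EuclideanSpace.norm_eq]
  refine Real.sqrt_le_iff.mpr ⟨Finset.sum_nonneg fun i _ => abs_nonneg _, ?_⟩
  exact Finset.sum_sq_le_sq_sum_of_nonneg fun i _ => abs_nonneg _

lemma continuous_mulV {a b : ℕ} (A : Matrix (Fin a) (Fin b) ℝ) : Continuous (mulV A) :=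
  (mulVL A).continuous

namespace ControlProblem

variable {n m l k : ℕ} {Ξ : Type*} {P : ControlProblem n m l k Ξ} {κ₁ : Ξ → ℝ}

/-- The violation of the sample average terminal constraints. -/
def sampleResidual (P : ControlProblem n m l k Ξ) (ν : ℕ) (s : ℕ → Ξ) (z : Vec n) : ℝ :=
  max ‖vecMin z (sampleAvg ν s fun a => mulV (P.M a) z + P.q a)‖
    (Metric.infDist (sampleAvg ν s fun a => P.g z a) P.K)

lemma relaxedTerminal_iff (ε : ℝ) (ν : ℕ) (s : ℕ → Ξ) (z : Vec n) :
    P.RelaxedTerminal ε ν s z ↔ P.sampleResidual ν s z ≤ ε :=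
  max_le_iff.symm

lemma continuous_sampleAvg {X E : Type*} [TopologicalSpace X] [NormedAddCommGroup E]
    [NormedSpace ℝ E] {G : X → Ξ → E} {s : ℕ → Ξ} (h : ∀ j, Continuous fun z => G z (s j)) (ν : ℕ) :
    Continuous fun z => sampleAvg ν s (G z) :=
  (continuous_finsetSum _ fun j _ => h j).const_smul _

lemma sampleAvg_lower {s : ℕ → Ξ} (h : ∀ j, ∀ z, |P.F z (s j) - P.F 0 (s j)| ≤ κ₁ (s j) * ‖z‖)
    (ν : ℕ) (z : Vec n) :
    sampleAvg ν s (P.F 0) - sampleAvg ν s κ₁ * ‖z‖ ≤ sampleAvg ν s (P.F z) := by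
  rw [sampleAvg, sampleAvg, sampleAvg, smul_eq_mul, smul_eq_mul, smul_eq_mul, mul_assoc, ← mul_sub,
    Finset.sum_mul, ← Finset.sum_sub_distrib]
  refine mul_le_mul_of_nonneg_left (Finset.sum_le_sum fun j _ => ?_) (by positivity)
  linarith [(abs_le.mp (h j z)).1]

variable [MeasurableSpace Ξ] {μ : Measure Ξ} {κ₂ κ₃ κ₄ : Ξ → ℝ}

/-- The violation of the terminal constraints in expectation. -/
def terminalResidual (P : ControlProblem n m l k Ξ) (μ : Measure Ξ) (z : Vec n) : ℝ :=
  max ‖vecMin z (P.meanLCP μ z)‖ (Metric.infDist (∫ s, P.g z s ∂μ) P.K)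

lemma terminalResidual_eq_zero_iff (hP : P.Standing μ) (z : Vec n) :
    P.terminalResidual μ z = 0 ↔ P.Terminal μ z := by
  have h1 : P.terminalResidual μ z = 0 ↔ ‖vecMin z (P.meanLCP μ z)‖ = 0 ∧
      Metric.infDist (∫ s, P.g z s ∂μ) P.K = 0 := by
    rw [terminalResidual]
    constructor
    · intro h
      exact ⟨le_antisymm (h ▸ le_max_left _ _) (norm_nonneg _),
        le_antisymm (h ▸ le_max_right _ _) Metric.infDist_nonneg⟩
    · rintro ⟨h2, h3⟩
      rw [h2, h3, max_self]
  rw [h1, norm_eq_zero, vecMin_eq_zero_iff, ← hP.K_closed.mem_iff_infDist_zero hP.K_nonempty,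
    Terminal]
  tauto

lemma measurable_mulV_add (hP : P.Standing μ) (z : Vec n) :
    Measurable fun s => mulV (P.M s) z + P.q s := by
  refine Measurable.add ?_ hP.q_meas
  refine (WithLp.measurable_toLp 2 _).comp (measurable_pi_iff.mpr fun i => ?_)
  change Measurable fun s => ∑ j, P.M s i j * z j
  exact Finset.measurable_sum _ fun j _ => (hP.M_meas i j).mul_const _

lemma isDominatedCaratheodory_F (hP : P.Standing μ) (hκ : P.GrowthBounds μ κ₁ κ₂ κ₃ κ₄) :
    IsDominatedCaratheodory μ P.F where
  meas := hP.F_meas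
  cont := hP.F_contDiff.mono fun _ h => h.continuous
  dominated R := by
    refine ⟨fun s => |P.F 0 s| + κ₁ s * |R|,
      (hP.F_integrable 0).abs.add (hκ.integrable.1.mul_const _), fun z hz => ?_⟩
    filter_upwards [hκ.F_lipschitz z 0] with s hs
    rw [sub_zero] at hs
    have h1 : κ₁ s * ‖z‖ ≤ κ₁ s * |R| :=
      mul_le_mul_of_nonneg_left (hz.trans (le_abs_self R)) (hκ.nonneg s).1
    have h2 := abs_sub_abs_le_abs_sub (P.F z s) (P.F 0 s)
    rw [Real.norm_eq_abs]
    linarith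

lemma isDominatedCaratheodory_g (hP : P.Standing μ) (hκ : P.GrowthBounds μ κ₁ κ₂ κ₃ κ₄) :
    IsDominatedCaratheodory μ P.g where
  meas := hP.g_meas
  cont := hP.g_contDiff.mono fun _ h => h.continuous
  dominated R := by
    refine ⟨fun s => κ₂ s * |R|, hκ.integrable.2.1.mul_const _, fun z hz => ?_⟩
    filter_upwards [hκ.g_bound z] with s hs
    exact hs.trans (mul_le_mul_of_nonneg_left (hz.trans (le_abs_self R)) (hκ.nonneg s).2.1)

lemma isDominatedCaratheodory_lcp (hP : P.Standing μ) (hκ : P.GrowthBounds μ κ₁ κ₂ κ₃ κ₄) :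
    IsDominatedCaratheodory μ fun z s => mulV (P.M s) z + P.q s where
  meas := measurable_mulV_add hP
  cont := Eventually.of_forall fun s => (continuous_mulV (P.M s)).add continuous_const
  dominated R := by
    refine ⟨fun s => κ₃ s * |R| + κ₄ s,
      (hκ.integrable.2.2.1.mul_const _).add hκ.integrable.2.2.2, fun z hz => ?_⟩
    refine Eventually.of_forall fun s => (norm_add_le _ _).trans (add_le_add ?_ (hκ.q_bound s))
    exact (hκ.M_bound s z).trans
      (mul_le_mul_of_nonneg_left (hz.trans (le_abs_self R)) (hκ.nonneg s).2.2.1)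

lemma integrable_q (hP : P.Standing μ) (hκ : P.GrowthBounds μ κ₁ κ₂ κ₃ κ₄) :
    Integrable P.q μ :=
  hκ.integrable.2.2.2.mono' hP.q_meas.aestronglyMeasurable (Eventually.of_forall hκ.q_bound)

lemma integrable_M (hP : P.Standing μ) (hκ : P.GrowthBounds μ κ₁ κ₂ κ₃ κ₄) (i j : Fin n) :
    Integrable (fun s => P.M s i j) μ := by
  refine hκ.integrable.2.2.1.mono' (hP.M_meas i j).aestronglyMeasurable
    (Eventually.of_forall fun s => ?_)
  have h1 := hκ.M_bound s (EuclideanSpace.single j 1)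
  have h2 : mulV (P.M s) (EuclideanSpace.single j 1) i = P.M s i j := by
    simp [mulV]
  have h3 := PiLp.norm_apply_le (mulV (P.M s) (EuclideanSpace.single j 1)) i
  rw [h2] at h3
  simp only [PiLp.norm_single, norm_one, mul_one] at h1
  exact h3.trans h1

lemma integral_coord {a : ℕ} {φ : Ξ → Vec a} (hφ : Integrable φ μ) (i : Fin a) :
    (∫ s, φ s ∂μ) i = ∫ s, φ s i ∂μ :=
  ((EuclideanSpace.proj i : Vec a →L[ℝ] ℝ).integral_comp_comm hφ).symm

lemma meanLCP_apply (hP : P.Standing μ) (hκ : P.GrowthBounds μ κ₁ κ₂ κ₃ κ₄) (z : Vec n)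
    (i : Fin n) :
    P.meanLCP μ z i = (P.meanM μ *ᵥ z.ofLp + (∫ s, P.q s ∂μ).ofLp) i := by
  have hq : Integrable (fun s => P.q s i) μ :=
    (EuclideanSpace.proj i : Vec n →L[ℝ] ℝ).integrable_comp (integrable_q hP hκ)
  have hM : ∀ j, Integrable (fun s => P.M s i j * z j) μ := fun j =>
    (integrable_M hP hκ i j).mul_const _
  rw [meanLCP, integral_coord ((isDominatedCaratheodory_lcp hP hκ).integrable z) i,
    Pi.add_apply, integral_coord (integrable_q hP hκ) i]
  have h1 : ∀ s, (mulV (P.M s) z + P.q s) i = (∑ j, P.M s i j * z j) + P.q s i := fun s => rfl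
  simp only [h1]
  rw [integral_add (integrable_finsetSum _ fun j _ => hM j) hq,
    integral_finsetSum _ fun j _ => hM j]
  simp only [integral_mul_const, meanM, Matrix.mulVec, dotProduct, Matrix.of_apply]

/-- The terminal constraints are consistent: the linear complementarity problem has a solution of
`ℓ¹` norm at most `β ‖𝔼[q]‖₁`, which is small enough for the remaining constraint. -/
lemma exists_terminal (hP : P.Standing μ) (hκ : P.GrowthBounds μ κ₁ κ₂ κ₃ κ₄)
    (hK : Metric.closedBall (0 : Vec k)
      (betaConst (P.meanM μ) * (∫ s, κ₂ s ∂μ) * P.meanQOneNorm μ) ⊆ P.K)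
    (hV : ∃ v : Vec n, (∀ i, 0 ≤ P.meanLCP μ v i) ∧ ∀ i, 0 ≤ v i)
    (hM : Adequate (P.meanM μ) ∨ IsZMatrix (P.meanM μ)) : ∃ z, P.Terminal μ z := by
  obtain ⟨v, hv1, hv2⟩ := hV
  obtain ⟨z, hz, hnorm⟩ := exists_lcpSolution_sum_abs_le hM (q := (∫ s, P.q s ∂μ).ofLp)
    (v := v.ofLp) hv2 fun i => by
      rw [← meanLCP_apply hP hκ]
      exact hv1 i
  refine ⟨WithLp.toLp 2 z, hz.nonneg, fun i => ?_, Finset.sum_eq_zero fun i _ => ?_, hK ?_⟩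
  · rw [meanLCP_apply hP hκ]
    exact hz.slack_nonneg i
  · rw [meanLCP_apply hP hκ]
    exact hz.compl i
  · rw [mem_closedBall_zero_iff]
    have h1 : ‖∫ s, P.g (WithLp.toLp 2 z) s ∂μ‖ ≤
        ∫ s, κ₂ s * ‖(WithLp.toLp 2 z : Vec n)‖ ∂μ :=
      norm_integral_le_of_norm_le (hκ.integrable.2.1.mul_const _) (hκ.g_bound _)
    rw [integral_mul_const] at h1
    have h2 : ‖(WithLp.toLp 2 z : Vec n)‖ ≤ betaConst (P.meanM μ) * P.meanQOneNorm μ :=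
      (norm_le_sum_abs _).trans hnorm
    have h3 : 0 ≤ ∫ s, κ₂ s ∂μ := integral_nonneg fun s => (hκ.nonneg s).2.1
    calc _ ≤ (∫ s, κ₂ s ∂μ) * ‖(WithLp.toLp 2 z : Vec n)‖ := h1
      _ ≤ (∫ s, κ₂ s ∂μ) * (betaConst (P.meanM μ) * P.meanQOneNorm μ) := by gcongr
      _ = _ := by ring

/-! ### Convergence of the sample average problems -/

lemma ae_forall_sample {Ω : Type*} [MeasurableSpace Ω] {Pr : Measure Ω} {ξ : ℕ → Ω → Ξ}
    (hmeas : ∀ j, Measurable (ξ j)) (hlaw : ∀ j, Pr.map (ξ j) = μ) {p : Ξ → Prop}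
    (hp : ∀ᵐ s ∂μ, p s) : ∀ᵐ w ∂Pr, ∀ j, p (ξ j w) := by
  rw [ae_all_iff]
  intro j
  rw [← hlaw j] at hp
  exact ae_of_ae_map (hmeas j).aemeasurable hp

lemma ae_forall_abs_sub_le (hP : P.Standing μ) (hκ : P.GrowthBounds μ κ₁ κ₂ κ₃ κ₄) :
    ∀ᵐ s ∂μ, ∀ z, |P.F z s - P.F 0 s| ≤ κ₁ s * ‖z‖ := by
  have h1 : ∀ᵐ s ∂μ, ∀ i : ℕ, |P.F (TopologicalSpace.denseSeq (Vec n) i) s - P.F 0 s| ≤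
      κ₁ s * ‖TopologicalSpace.denseSeq (Vec n) i‖ := by
    rw [ae_all_iff]
    intro i
    filter_upwards [hκ.F_lipschitz (TopologicalSpace.denseSeq (Vec n) i) 0] with s hs
    rwa [sub_zero] at hs
  filter_upwards [h1, hP.F_contDiff] with s hs hc z
  have hcl : IsClosed {z | |P.F z s - P.F 0 s| ≤ κ₁ s * ‖z‖} :=
    isClosed_le (hc.continuous.sub continuous_const).abs (continuous_const.mul continuous_norm)
  have hsub : closure (range (TopologicalSpace.denseSeq (Vec n))) ⊆
      {z | |P.F z s - P.F 0 s| ≤ κ₁ s * ‖z‖} :=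
    closure_minimal (by rintro _ ⟨i, rfl⟩; exact hs i) hcl
  exact hsub (TopologicalSpace.denseRange_denseSeq (Vec n) z)

lemma abs_sampleResidual_sub_le {ν : ℕ} {s : ℕ → Ξ} {z : Vec n} {η : ℝ}
    (h1 : ‖(sampleAvg ν s fun a => mulV (P.M a) z + P.q a) - P.meanLCP μ z‖ ≤ η)
    (h2 : ‖(sampleAvg ν s fun a => P.g z a) - ∫ s, P.g z s ∂μ‖ ≤ η) :
    |P.sampleResidual ν s z - P.terminalResidual μ z| ≤ η := by
  refine (abs_max_sub_max_le_max _ _ _ _).trans (max_le ?_ ?_)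
  · exact (abs_norm_sub_norm_le _ _).trans ((norm_vecMin_sub_le _ _ _).trans h1)
  · have h3 := (Metric.lipschitz_infDist_pt P.K).dist_le_mul
      (sampleAvg ν s fun a => P.g z a) (∫ s, P.g z s ∂μ)
    rw [Real.dist_eq, dist_eq_norm, NNReal.coe_one, one_mul] at h3
    exact h3.trans h2

/-- With probability one, the reduced problems satisfy the hypotheses of the stability theorem. -/
theorem ae_stableMinimization [IsProbabilityMeasure μ] {Ω : Type*} [MeasurableSpace Ω]
    {Pr : Measure Ω} {ξ : ℕ → Ω → Ξ} (hmeas : ∀ j, Measurable (ξ j))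
    (hlaw : ∀ j, Pr.map (ξ j) = μ) (hindep : iIndepFun ξ Pr) (hP : P.Standing μ)
    (hκ : P.GrowthBounds μ κ₁ κ₂ κ₃ κ₄) {Y : Matrix (Fin m) (Fin (m - l)) ℝ}
    (hY : P.Controllable Y)
    (hK : Metric.closedBall (0 : Vec k)
      (betaConst (P.meanM μ) * (∫ s, κ₂ s ∂μ) * P.meanQOneNorm μ) ⊆ P.K)
    (hV : ∃ v : Vec n, (∀ i, 0 ≤ P.meanLCP μ v i) ∧ ∀ i, 0 ≤ v i)
    (hM : Adequate (P.meanM μ) ∨ IsZMatrix (P.meanM μ)) :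
    ∀ᵐ w ∂Pr, StableMinimization (fun z => ∫ s, P.F z s ∂μ) (P.terminalResidual μ)
      ((P.limitLS Y hP.T_pos hP.f_mem hP.xd_mem hP.ud_mem).value P.slackSet)
      (fun ν z => sampleAvg ν (fun j => ξ j w) (P.F z))
      (fun ν => P.sampleResidual ν fun j => ξ j w)
      (fun N => (P.gridLS Y hP.T_pos N).value P.slackSet) := by
  obtain ⟨γ, R₀, R, hreg₀, hR, hreg⟩ := exists_regular hP.δ_pos hY hP.T_pos hP.f_mem hP.xd_mem
    hP.ud_mem
  obtain ⟨tL, tc, tG, tb⟩ := P.tendsto_gridLS Y hP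
  have hF := isDominatedCaratheodory_F hP hκ
  have hg := isDominatedCaratheodory_g hP hκ
  have hlcp := isDominatedCaratheodory_lcp hP hκ
  have hconv := P.convex_slackSet
  have hclosed := P.isClosed_slackSet
  have h0 := P.zero_mem_slackSet
  obtain ⟨z₀, hz₀⟩ := exists_terminal hP hκ hK hV hM
  filter_upwards [hF.uniform_sampleAvg hmeas hlaw hindep, hg.uniform_sampleAvg hmeas hlaw hindep,
    hlcp.uniform_sampleAvg hmeas hlaw hindep, ae_forall_sample hmeas hlaw hF.cont,
    ae_forall_sample hmeas hlaw hg.cont, ae_forall_sample hmeas hlaw (ae_forall_abs_sub_le hP hκ),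
    tendsto_sampleAvg hmeas hlaw hindep (hP.F_meas 0) (hP.F_integrable 0),
    tendsto_sampleAvg hmeas hlaw hindep hκ.meas.1 hκ.integrable.1]
    with w w1 w2 w3 w4 w5 w6 w7 w8
  have hcoer := LeastSquares.exists_norm_le_residual hreg₀.pos (hreg.mono fun _ h => h.bound)
    tL tc tb
  have hcoer₀ := LeastSquares.exists_norm_le_residual (P := fun _ : ℕ =>
    P.limitLS Y hP.T_pos hP.f_mem hP.xd_mem hP.ud_mem) hreg₀.pos
    (Eventually.of_forall fun _ => hreg₀.bound) tendsto_const_nhds tendsto_const_nhds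
    tendsto_const_nhds
  have hκ1 : 0 ≤ ∫ s, κ₁ s ∂μ := integral_nonneg fun s => (hκ.nonneg s).1
  refine
    { cont := hF.continuous_integral
      cont_constraint := (continuous_vecMin continuous_id hlcp.continuous_integral).norm.max
        ((Metric.continuous_infDist_pt P.K).comp hg.continuous_integral)
      cont_value := hreg₀.continuous_value hconv hclosed h0
      nonneg := fun z => (norm_nonneg _).trans (le_max_left _ _)
      feasible := ⟨z₀, (terminalResidual_eq_zero_iff hP z₀).mpr hz₀⟩
      cont_seq := fun ν => continuous_sampleAvg w4 ν
      cont_constraint_seq := fun ν => (continuous_vecMin continuous_id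
        (continuous_sampleAvg (G := fun z a => mulV (P.M a) z + P.q a) (fun j =>
          (continuous_mulV (P.M (ξ j w))).add continuous_const) ν)).norm.max
        ((Metric.continuous_infDist_pt P.K).comp (continuous_sampleAvg w5 ν))
      cont_value_seq := hreg.mono fun N h => h.continuous_value hconv hclosed h0
      tendsto := w1
      tendsto_constraint := ?_
      tendsto_value := ?_
      lower := ?_
      coercive := ?_ }
  · intro r η hη
    filter_upwards [w2 r η hη, w3 r η hη] with ν h1 h2 z hz
    exact abs_sampleResidual_sub_le (h2 z hz) (h1 z hz)
  · intro r η hη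
    obtain ⟨r', hr', h⟩ := LeastSquares.eventually_argmin_close hconv hclosed h0 hreg hreg₀ tL tc
      tG tb hR r hη
    filter_upwards [h] with N hN z hz
    exact (hN z z hz (by simpa using hr'.le)).2
  · refine ⟨|∫ s, P.F 0 s ∂μ| + 1, (∫ s, κ₁ s ∂μ) + 1, by positivity, fun z => ?_, ?_⟩
    · have h1 : |(∫ s, P.F z s ∂μ) - ∫ s, P.F 0 s ∂μ| ≤ ∫ s, κ₁ s * ‖z‖ ∂μ := by
        rw [← integral_sub (hP.F_integrable z) (hP.F_integrable 0)]
        exact norm_integral_le_of_norm_le (f := fun s => P.F z s - P.F 0 s)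
          (hκ.integrable.1.mul_const _) ((ae_forall_abs_sub_le hP hκ).mono fun s hs => hs z)
      rw [integral_mul_const] at h1
      nlinarith [(abs_le.mp h1).1, neg_abs_le (∫ s, P.F 0 s ∂μ), norm_nonneg z]
    · filter_upwards [w7.eventually (lt_mem_nhds (sub_one_lt _)),
        w8.eventually (gt_mem_nhds (lt_add_one _))] with ν h1 h2 z
      have h3 := sampleAvg_lower w6 ν z
      nlinarith [neg_abs_le (∫ s, P.F 0 s ∂μ), norm_nonneg z,
        mul_le_mul_of_nonneg_right h2.le (norm_nonneg z)]
  · obtain ⟨C, hC, h1⟩ := hcoer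
    obtain ⟨C₀, hC₀, h2⟩ := hcoer₀
    obtain ⟨-, h2⟩ := h2.exists
    refine ⟨max C C₀, lt_max_of_lt_left hC, fun z => ⟨_, norm_nonneg _, rfl, ?_⟩, ?_⟩
    · have hmin := LeastSquares.argmin_spec (hreg₀.exists_isMinimizer hconv hclosed h0 z)
      have h3 := h2 ((P.limitLS Y hP.T_pos hP.f_mem hP.xd_mem hP.ud_mem).argmin P.slackSet z)
      rw [hmin.eq] at h3
      exact h3.trans (mul_le_mul_of_nonneg_right (le_max_right _ _) (by positivity))
    · filter_upwards [h1, hreg] with N hN hregN z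
      refine ⟨_, norm_nonneg _, rfl, ?_⟩
      have hmin := LeastSquares.argmin_spec (hregN.exists_isMinimizer hconv hclosed h0 z)
      have h3 := hN ((P.gridLS Y hP.T_pos N).argmin P.slackSet z)
      rw [hmin.eq] at h3
      exact h3.trans (mul_le_mul_of_nonneg_right (le_max_left _ _) (by positivity))

end ControlProblem

end

theorem theorem4p2 {n m l k : ℕ} {Ξ Ω : Type*} [MeasurableSpace Ξ] [MeasurableSpace Ω]
    (μ : Measure Ξ) [IsProbabilityMeasure μ] (Pr : Measure Ω) [IsProbabilityMeasure Pr]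
    -- the i.i.d. sample, of law `μ`
    (ξ : ℕ → Ω → Ξ) (hξ_meas : ∀ j, Measurable (ξ j)) (hξ_law : ∀ j, Pr.map (ξ j) = μ)
    (hξ_indep : iIndepFun ξ Pr)
    (P : ControlProblem n m l k Ξ) (hP : P.Standing μ)
    (κ₁ κ₂ κ₃ κ₄ : Ξ → ℝ) (hκ : P.GrowthBounds μ κ₁ κ₂ κ₃ κ₄)
    (Y : Matrix (Fin m) (Fin (m - l)) ℝ) (hY : P.Controllable Y)
    (hK : Metric.closedBall (0 : Vec k)
      (betaConst (P.meanM μ) * (∫ s, κ₂ s ∂μ) * P.meanQOneNorm μ) ⊆ P.K)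
    (hV : ∃ v : Vec n, (∀ i, 0 ≤ P.meanLCP μ v i) ∧ ∀ i, 0 ≤ v i)
    (hM : Adequate (P.meanM μ) ∨ IsZMatrix (P.meanM μ)) :
    (P.optimalSet μ).Nonempty ∧
    ∀ᵐ w ∂Pr,
      (∀ ε : ℝ, 0 < ε → ∀ᶠ ν : ℕ in atTop, ∀ᶠ N : ℕ in atTop,
        (P.discreteOptimalSet ε ν (fun j => ξ j w) N).Nonempty) ∧
      Tendsto (fun ε : ℝ =>
          limsup (fun ν : ℕ =>
            limsup (fun N : ℕ =>
              deviation (P.discreteOptimalSet ε ν (fun j => ξ j w) N) (P.optimalSet μ))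
              atTop)
            atTop)
        (𝓝[>] 0) (𝓝 0) := by

  obtain ⟨γ, R₀, R, hreg₀, hRb, hreg⟩ := ControlProblem.exists_regular hP.δ_pos hY hP.T_pos
    hP.f_mem hP.xd_mem hP.ud_mem
  obtain ⟨tL, tc, tG, tb⟩ := P.tendsto_gridLS Y hP
  have hconv := P.convex_slackSet
  have hclosed := P.isClosed_slackSet
  have h0 := P.zero_mem_slackSet
  have hred₀ := ControlProblem.isReduction_limit hP hY
  have hstable := ControlProblem.ae_stableMinimization hξ_meas hξ_law hξ_indep hP hκ hY hK hV hM
  set LS := P.limitLS Y hP.T_pos hP.f_mem hP.xd_mem hP.ud_mem with hLS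
  set S : Set (Vec n) := {z | P.terminalResidual μ z = 0} with hS
  set Φ : Vec n → ℝ := fun z => ∫ s, P.F z s ∂μ with hΦ
  -- Optimal terminal states are those of the solutions, with slack variables given by `argmin`.
  have hopt₀ : ∀ z ∈ argminOn S (fun z => Φ z + LS.value P.slackSet z), ∃ p ∈ P.optimalSet μ,
      P.Related Y (volterra P.T hP.T_pos.le id measurable_id) (hP.f_mem.toLp P.f) p
        (LS.argmin P.slackSet z) := by
    intro z hz
    obtain ⟨p, hp, hterm, hmin⟩ := hred₀.exists_optimal hreg₀ hconv hclosed h0 hz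
    have hpS : p.1.value P.T ∈ S := hterm ▸ hz.1
    refine ⟨p, ⟨⟨hp, (ControlProblem.terminalResidual_eq_zero_iff hP _).mp hpS⟩,
      fun p' hp' => hmin p' hp'.1
        ((ControlProblem.terminalResidual_eq_zero_iff hP _).mpr hp'.2)⟩, ?_⟩
    have h1 := (hred₀.of_optimal hreg₀ hconv hclosed h0 hp hpS hmin).2
    rwa [hterm] at h1
  have hgrid : ∀ᶠ N in atTop, 0 < N ∧ (P.gridLS Y hP.T_pos N).Regular P.slackSet γ (R N) ∧
      IsReduction (P.DiscreteDynamics N) (fun d => d.1 (Fin.last N)) (P.discreteTracking N)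
        (P.GridRelated Y hP.T_pos N) (P.gridLS Y hP.T_pos N) P.slackSet := by
    filter_upwards [eventually_gt_atTop 0, hreg, P.eventually_isUnit_grid hP.T_pos]
      with N h1 h2 h3
    exact ⟨h1, h2, ControlProblem.isReduction_grid hP.T_pos hP.δ_pos hY h1 h3⟩
  constructor
  · obtain ⟨w, hw⟩ := hstable.exists
    obtain ⟨z, hz⟩ := hw.argmin_nonempty
    obtain ⟨p, hp, -⟩ := hopt₀ z hz
    exact ⟨p, hp⟩
  filter_upwards [hstable] with w hw
  refine ⟨fun ε hε => ?_, ?_⟩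
  · filter_upwards [hw.argmin_seq_nonempty hε] with ν hν
    filter_upwards [hν, hgrid] with N hN hgN
    obtain ⟨hN0, hregN, hredN⟩ := hgN
    obtain ⟨z, hz⟩ := hN
    obtain ⟨d, hd, hterm, hmin⟩ := hredN.exists_optimal hregN hconv hclosed h0 hz
    have hdS := hterm ▸ hz.1
    obtain ⟨y, -, hrel, -⟩ := hredN.exists_point d hd
    obtain ⟨p, hp⟩ := ControlProblem.exists_isInterpolant hP.T_pos hN0 hd hrel
    have hdyn : ∀ d', P.DiscreteFeasible ε ν (fun j => ξ j w) N d' ↔ P.DiscreteDynamics N d' ∧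
        P.sampleResidual ν (fun j => ξ j w) (d'.1 (Fin.last N)) ≤ ε := by
      intro d'
      rw [← ControlProblem.relaxedTerminal_iff, ControlProblem.DiscreteFeasible,
        ControlProblem.DiscreteDynamics]
      tauto
    exact ⟨p, d, ⟨(hdyn d).mpr ⟨hd, hdS⟩, fun d' hd' =>
      hmin d' ((hdyn d').mp hd').1 ((hdyn d').mp hd').2⟩, hp⟩
  · rw [ENNReal.tendsto_nhds_zero]
    intro e he
    obtain ⟨η, hη, hηe⟩ := ENNReal.lt_iff_exists_nnreal_btwn.mp he
    have hη' : (0 : ℝ) < η := by exact_mod_cast hη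
    obtain ⟨ρ, hclose⟩ := hw.argmin_close
    obtain ⟨C, hC⟩ := hreg₀.exists_argmin_bound hconv hclosed h0 (ρ + 1)
    obtain ⟨r₁, hr₁, hdist⟩ := ControlProblem.eventually_scDist_le (Y := Y) hP C hη'
    obtain ⟨r₂, hr₂, hargmin⟩ := LeastSquares.eventually_argmin_close hconv hclosed h0 hreg hreg₀
      tL tc tG tb hRb ρ hr₁
    obtain ⟨ε₀, hε₀, hε⟩ := hclose (min r₂ 1) (by positivity)
    filter_upwards [Ioc_mem_nhdsGT hε₀] with ε hεm
    refine limsup_le_of_le (by isBoundedDefault) ?_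
    filter_upwards [hε ε hεm.1 hεm.2] with ν hν
    refine limsup_le_of_le (by isBoundedDefault) ?_
    filter_upwards [hν, hgrid, hdist, hargmin] with N hN hgN hdN haN
    obtain ⟨hN0, hregN, hredN⟩ := hgN
    refine le_trans ?_ hηe.le
    refine iSup₂_le fun p hp => ?_
    obtain ⟨d, ⟨⟨hd1, hd2, hd3, hd4⟩, hdmin⟩, hpd⟩ := hp
    have hd : P.DiscreteDynamics N d := ⟨hd1, hd2, hd3⟩
    obtain ⟨hz, hrel⟩ := hredN.of_optimal hregN hconv hclosed h0
      (S := {z | P.sampleResidual ν (fun j => ξ j w) z ≤ ε})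
      (Φ := fun z => ControlProblem.sampleAvg ν (fun j => ξ j w) (P.F z)) hd
      ((ControlProblem.relaxedTerminal_iff ε ν _ _).mp hd4) fun d' hd' hS' =>
        hdmin d' ⟨hd'.1, hd'.2.1, hd'.2.2, (ControlProblem.relaxedTerminal_iff ε ν _ _).mpr hS'⟩
    obtain ⟨hzρ, z', hz', hzz'⟩ := hN _ hz
    obtain ⟨p', hp', hrel'⟩ := hopt₀ z' hz'
    have hz'ρ : ‖z'‖ ≤ ρ + 1 := by
      have h1 := norm_sub_norm_le z' (d.1 (Fin.last N))
      rw [norm_sub_rev] at h1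
      linarith [hzz'.trans (min_le_right _ _)]
    have hfin := hdN _ _ (hC z' hz'ρ) (haN _ z' hzρ (hzz'.trans (min_le_left _ _))).1 d p p' hd
      hrel hpd hrel'
    refine (iInf₂_le p' hp').trans ?_
    rw [← ENNReal.ofReal_coe_nnreal]
    exact ENNReal.ofReal_le_ofReal hfin
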